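/- **Theorem 1.5.** Let $(M,g)$ be a smooth 4-dimensional Lorentzian manifold of signature $(+,-,-,-)$ with a spin structure. Let $\nabla_{AA'}$ be its Levi-Civita spinor connection, $\Psi_{ABCD}$ its Weyl spinor and $\Phi_{ABA'B'}$ its Ricci spinor (conventions of Penrose and Rindler). A *Killing spinor of valence $(k,0)$* on an open set is a smooth symmetric spinor field $\varphi_{A_1\cdots A_k}$ there with $$\nabla_{(A_1}{}^{A'}\varphi_{A_2\cdots A_{k+1})}=0 .$$ Assume that the aligned matter condition $$\Psi_{(ABC}{}^{F}\,\Phi_{D)FA'B'}=0$$ holds on $M$ and that $\Psi_{ABCD}$ vanishes at no point of $M$. Let $L_{ABCD}$ be a Killing spinor of valence $(4,0)$ on $M$. Then: 1. every point of $M$ has an open neighbourhood on which there is a Killing spinor $\kappa_{AB}$ of valence $(2,0)$ with $$L_{ABCD}=\kappa_{(AB}\,\kappa_{CD)} ;$$ 2. if $M$ is simply connected, there is such a $\kappa_{AB}$ on all of $M$. -/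

import Mathlib

open scoped Manifold ContDiff Matrix

noncomputable section

/-! ## Lorentzian metrics, signature `(+,-,-,-)` -/

/-- The diagonal of the Minkowski metric. -/
def minkowskiDiag : Fin 4 → ℝ := ![1, -1, -1, -1]

/-- A smooth Lorentzian metric of signature `(+,-,-,-)` on a 4-manifold. -/
structure LorentzMetric (M : Type*) [TopologicalSpace M]
    [ChartedSpace (EuclideanSpace ℝ (Fin 4)) M] [IsManifold (𝓡 4) ∞ M] where
  inner (x : M) : TangentSpace (𝓡 4) x →L[ℝ] TangentSpace (𝓡 4) x →L[ℝ] ℝ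
  symm (x : M) (v w : TangentSpace (𝓡 4) x) : inner x v w = inner x w v
  signature (x : M) : ∃ b : Module.Basis (Fin 4) ℝ (TangentSpace (𝓡 4) x),
    ∀ a c, inner x (b a) (b c) = if a = c then minkowskiDiag a else 0
  contMDiff : ContMDiff (𝓡 4)
    ((𝓡 4).prod 𝓘(ℝ, EuclideanSpace ℝ (Fin 4) →L[ℝ] EuclideanSpace ℝ (Fin 4) →L[ℝ] ℝ)) ∞
    (fun x => Bundle.TotalSpace.mk'
      (EuclideanSpace ℝ (Fin 4) →L[ℝ] EuclideanSpace ℝ (Fin 4) →L[ℝ] ℝ)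
      (E := fun x : M => TangentSpace (𝓡 4) x →L[ℝ] TangentSpace (𝓡 4) x →L[ℝ] ℝ)
      x (inner x))

/-! ## Pointwise spinor algebra

An unprimed (or primed) spinor index takes values in `Fin 2`; a spinor with `k` unprimed lower
indices has components indexed by `Fin k → Fin 2`. -/

/-- The Infeld-van der Waerden symbols `σ_a^{AA'}`: a vector `V` with orthonormal components
`V^a = (T, X, Y, Z)` corresponds to the Hermitian matrix
`V^{AA'} = (1/√2) [[T + Z, X + iY], [X - iY, T - Z]]`. -/
def infeld : Fin 4 → Matrix (Fin 2) (Fin 2) ℂ := fun a =>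
  (1 / (Real.sqrt 2 : ℂ)) •
    (![!![1, 0; 0, 1], !![0, 1; 1, 0], !![0, Complex.I; -Complex.I, 0], !![1, 0; 0, -1]] a)

/-- The inverse symbols `σ^a_{AA'}`, which turn covector components into spinor components:
`T_{AA'} = σ^a_{AA'} T_a`. -/
def infeldInv (a : Fin 4) (A A' : Fin 2) : ℂ := star (infeld a A A')

/-- The spin metric with `ε^{01} = 1`; indices are raised by `κ^A = ε^{AB} κ_B`, and in the same
way for primed indices. -/
def spinEps : Matrix (Fin 2) (Fin 2) ℂ := !![0, 1; -1, 0]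

/-- Total symmetrization `T_{(A₁…Aₙ)}`. -/
def spinSymm {n : ℕ} (T : (Fin n → Fin 2) → ℂ) (α : Fin n → Fin 2) : ℂ :=
  (1 / (n.factorial : ℂ)) * ∑ π : Equiv.Perm (Fin n), T (α ∘ π)

/-- Symmetrized square `κ_{(AB} κ_{CD)}`. -/
def spinSymmSq (κ : (Fin 2 → Fin 2) → ℂ) : (Fin 4 → Fin 2) → ℂ :=
  spinSymm fun α => κ ![α 0, α 1] * κ ![α 2, α 3]

variable {M : Type*} [TopologicalSpace M]
  [ChartedSpace (EuclideanSpace ℝ (Fin 4)) M] [IsManifold (𝓡 4) ∞ M]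

/-- The derivative `v(f)` of a function along a tangent vector. -/
def dirDeriv {F : Type*} [NormedAddCommGroup F] [NormedSpace ℝ F] (f : M → F) (x : M)
    (v : TangentSpace (𝓡 4) x) : F :=
  mfderiv (𝓡 4) 𝓘(ℝ, F) f x v

/-! ## Connection and curvature in an orthonormal frame

`E : Fin 4 → Π x, T_x M` is a frame field, used only where it is smooth and orthonormal. -/

/-- `Γ_{abc} = g(∇_{E_a} E_b, E_c)` for the Levi-Civita connection, by the Koszul formula
(in an orthonormal frame the terms that differentiate `g(E_b, E_c)` vanish). -/
def frameConnLow (g : LorentzMetric M) (E : Fin 4 → (x : M) → TangentSpace (𝓡 4) x)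
    (a b c : Fin 4) (x : M) : ℝ :=
  (1 / 2) * (g.inner x (VectorField.mlieBracket (𝓡 4) (E a) (E b) x) (E c x)
    - g.inner x (VectorField.mlieBracket (𝓡 4) (E b) (E c) x) (E a x)
    + g.inner x (VectorField.mlieBracket (𝓡 4) (E c) (E a) x) (E b x))

/-- `Γ_{ab}{}^c`, that is `∇_{E_a} E_b = ∑_c Γ_{ab}{}^c E_c`. -/
def frameConn (g : LorentzMetric M) (E : Fin 4 → (x : M) → TangentSpace (𝓡 4) x)
    (a b c : Fin 4) (x : M) : ℝ :=
  minkowskiDiag c * frameConnLow g E a b c x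

/-- Riemann tensor in the frame with all indices lowered:
`R_{abcd} = g((∇_{E_a} ∇_{E_b} - ∇_{E_b} ∇_{E_a} - ∇_{[E_a, E_b]}) E_c, E_d)`. -/
def frameRiem (g : LorentzMetric M) (E : Fin 4 → (x : M) → TangentSpace (𝓡 4) x)
    (a b c d : Fin 4) (x : M) : ℝ :=
  minkowskiDiag d *
    (dirDeriv (frameConn g E b c d) x (E a x)
      - dirDeriv (frameConn g E a c d) x (E b x)
      + ∑ f, (frameConn g E b c f x * frameConn g E a f d x
          - frameConn g E a c f x * frameConn g E b f d x)
      - ∑ f, (frameConn g E a b f x - frameConn g E b a f x) * frameConn g E f c d x)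

/-- Spinor components `R_{AA'BB'CC'DD'}` of the Riemann tensor. -/
def spinRiem (g : LorentzMetric M) (E : Fin 4 → (x : M) → TangentSpace (𝓡 4) x) (x : M)
    (A A' B B' C C' D D' : Fin 2) : ℂ :=
  ∑ a, ∑ b, ∑ c, ∑ d, infeldInv a A A' * infeldInv b B B' * infeldInv c C C' * infeldInv d D D'
    * (frameRiem g E a b c d x : ℂ)

/-- The curvature spinor `X_{ABCD} = (1/4) R_{AE'B}{}^{E'}{}_{CF'D}{}^{F'}`. -/
def curvX (g : LorentzMetric M) (E : Fin 4 → (x : M) → TangentSpace (𝓡 4) x) (x : M)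
    (A B C D : Fin 2) : ℂ :=
  (1 / 4) * ∑ E', ∑ G', ∑ F', ∑ H', spinEps E' G' * spinEps F' H'
    * spinRiem g E x A E' B G' C F' D H'

/-- The Weyl spinor `Ψ_{ABCD} = X_{(ABCD)}`. -/
def weylSpinor (g : LorentzMetric M) (E : Fin 4 → (x : M) → TangentSpace (𝓡 4) x) (x : M) :
    (Fin 4 → Fin 2) → ℂ :=
  spinSymm fun α => curvX g E x (α 0) (α 1) (α 2) (α 3)

/-- The Ricci spinor `Φ_{ABA'B'} = (1/4) R_{AE'B}{}^{E'}{}_{FA'}{}^F{}_{B'}`. -/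
def ricciSpinor (g : LorentzMetric M) (E : Fin 4 → (x : M) → TangentSpace (𝓡 4) x) (x : M)
    (A B A' B' : Fin 2) : ℂ :=
  (1 / 4) * ∑ E', ∑ G', ∑ F, ∑ H, spinEps E' G' * spinEps F H
    * spinRiem g E x A E' B G' F A' H B'

/-- The spin connection matrix `(γ_a)^A{}_B = (1/2) Γ_{ab}{}^c σ_c^{AA'} σ^b_{BA'}`, so that
`∇_{E_a} ψ^A = E_a(ψ^A) + (γ_a)^A{}_B ψ^B`. It is the trace-free matrix with
`γ_a σ_b + σ_b γ_a^† = ∑_c Γ_{ab}{}^c σ_c`. -/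
def spinConn (g : LorentzMetric M) (E : Fin 4 → (x : M) → TangentSpace (𝓡 4) x)
    (a : Fin 4) (x : M) (A B : Fin 2) : ℂ :=
  (1 / 2) * ∑ b, ∑ c, ∑ A', (frameConn g E a b c x : ℂ) * infeld c A A' * infeldInv b B A'

/-- `∇_{E_a} φ_{A₁…A_k}`. -/
def spinCovDeriv (g : LorentzMetric M) (E : Fin 4 → (x : M) → TangentSpace (𝓡 4) x) {k : ℕ}
    (φ : M → (Fin k → Fin 2) → ℂ) (a : Fin 4) (x : M) (α : Fin k → Fin 2) : ℂ :=
  dirDeriv (fun y => φ y α) x (E a x)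
    - ∑ r, ∑ C, spinConn g E a x C (α r) * φ x (Function.update α r C)

/-- `∇_{AA'} φ_{A₁…A_k}`. -/
def spinNabla (g : LorentzMetric M) (E : Fin 4 → (x : M) → TangentSpace (𝓡 4) x) {k : ℕ}
    (φ : M → (Fin k → Fin 2) → ℂ) (x : M) (A A' : Fin 2) (α : Fin k → Fin 2) : ℂ :=
  ∑ a, infeldInv a A A' * spinCovDeriv g E φ a x α

/-- The twistor operator `∇_{(A₁}{}^{A'} φ_{A₂…A_{k+1})}`. -/
def spinTwist (g : LorentzMetric M) (E : Fin 4 → (x : M) → TangentSpace (𝓡 4) x) {k : ℕ}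
    (φ : M → (Fin k → Fin 2) → ℂ) (x : M) (A' : Fin 2) : (Fin (k + 1) → Fin 2) → ℂ :=
  spinSymm fun α => ∑ B', spinEps A' B' * spinNabla g E φ x (α 0) B' (Fin.tail α)

/-! ## Spin structures and spinor fields -/

/-- The matrix `V^{AA'}` of a tangent vector with respect to an orthonormal frame. -/
def vecSpinor (g : LorentzMetric M) (E : Fin 4 → (x : M) → TangentSpace (𝓡 4) x) (x : M)
    (v : TangentSpace (𝓡 4) x) : Matrix (Fin 2) (Fin 2) ℂ :=
  ∑ b, ((minkowskiDiag b * g.inner x v (E b x) : ℝ) : ℂ) • infeld b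

/-- A spin structure on `(M, g)`, given by local data: an open cover with smooth orthonormal
frames on its members, and smooth `SL(2, ℂ)`-valued transition functions on the overlaps that
satisfy the cocycle condition and cover the changes of frame. -/
structure SpinStructure (g : LorentzMetric M) (ι : Type*) where
  dom : ι → Set M
  isOpen_dom (i : ι) : IsOpen (dom i)
  cover (x : M) : ∃ i, x ∈ dom i
  frame : ι → Fin 4 → (x : M) → TangentSpace (𝓡 4) x
  frame_smooth (i : ι) (a : Fin 4) : ContMDiffOn (𝓡 4) (𝓡 4).tangent ∞
    (fun x => (⟨x, frame i a x⟩ : TangentBundle (𝓡 4) M)) (dom i)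
  frame_orthonormal (i : ι) (x : M) (hx : x ∈ dom i) (a b : Fin 4) :
    g.inner x (frame i a x) (frame i b x) = if a = b then minkowskiDiag a else 0
  trans : ι → ι → M → Matrix (Fin 2) (Fin 2) ℂ
  trans_smooth (i j : ι) (A B : Fin 2) :
    ContMDiffOn (𝓡 4) 𝓘(ℝ, ℂ) ∞ (fun x => trans i j x A B) (dom i ∩ dom j)
  trans_det (i j : ι) (x : M) (hx : x ∈ dom i ∩ dom j) : (trans i j x).det = 1
  trans_cocycle (i j k : ι) (x : M) (hx : x ∈ dom i ∩ dom j ∩ dom k) :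
    trans i j x * trans j k x = trans i k x
  trans_frame (i j : ι) (x : M) (hx : x ∈ dom i ∩ dom j) (a : Fin 4) :
    vecSpinor g (frame i) x (frame j a x) = trans i j x * infeld a * (trans i j x)ᴴ

/-- `φ` is a smooth symmetric spinor field `φ_{A₁…A_k}` of valence `(k,0)` on the open set `W`.
It is given by its components in the spin frames; their values outside `W` or outside the domain of
the frame are irrelevant. -/
structure IsSpinorField {g : LorentzMetric M} {ι : Type*} (s : SpinStructure g ι) (W : Set M)
    (k : ℕ) (φ : ι → M → (Fin k → Fin 2) → ℂ) : Prop where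
  smooth (i : ι) (α : Fin k → Fin 2) :
    ContMDiffOn (𝓡 4) 𝓘(ℝ, ℂ) ∞ (fun x => φ i x α) (s.dom i ∩ W)
  symmetric (i : ι) (x : M) (hx : x ∈ s.dom i ∩ W) (π : Equiv.Perm (Fin k))
    (α : Fin k → Fin 2) : φ i x (α ∘ π) = φ i x α
  transform (i j : ι) (x : M) (hx : x ∈ s.dom i ∩ s.dom j ∩ W) (β : Fin k → Fin 2) :
    φ j x β = ∑ α : Fin k → Fin 2, (∏ r, s.trans i j x (α r) (β r)) * φ i x α

/-- `φ` is a Killing spinor of valence `(k,0)` on the open set `W`. -/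
structure IsKillingSpinor {g : LorentzMetric M} {ι : Type*} (s : SpinStructure g ι) (W : Set M)
    (k : ℕ) (φ : ι → M → (Fin k → Fin 2) → ℂ) : Prop extends IsSpinorField s W k φ where
  twist_eq_zero (i : ι) (x : M) (hx : x ∈ s.dom i ∩ W) (A' : Fin 2)
    (α : Fin (k + 1) → Fin 2) : spinTwist g (s.frame i) (φ i) x A' α = 0

/-- The aligned matter condition `Ψ_{(ABC}{}^F Φ_{D)FA'B'} = 0`. -/
def AlignedMatter {g : LorentzMetric M} {ι : Type*} (s : SpinStructure g ι) : Prop :=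
  ∀ i, ∀ x ∈ s.dom i, ∀ A' B' : Fin 2, ∀ α : Fin 4 → Fin 2,
    spinSymm (fun β : Fin 4 → Fin 2 => ∑ F, ∑ G,
      spinEps F G * weylSpinor g (s.frame i) x ![β 0, β 1, β 2, G]
        * ricciSpinor g (s.frame i) x (β 3) F A' B') α = 0

/-- The Weyl spinor vanishes at no point. -/
def WeylNonvanishing {g : LorentzMetric M} {ι : Type*} (s : SpinStructure g ι) : Prop :=
  ∀ i, ∀ x ∈ s.dom i, weylSpinor g (s.frame i) x ≠ 0

/-- `L_{ABCD} = κ_{(AB} κ_{CD)}` on `W`. -/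
def IsSymmSquareOn {g : LorentzMetric M} {ι : Type*} (s : SpinStructure g ι) (W : Set M)
    (L : ι → M → (Fin 4 → Fin 2) → ℂ) (κ : ι → M → (Fin 2 → Fin 2) → ℂ) : Prop :=
  ∀ i, ∀ x ∈ s.dom i ∩ W, L i x = spinSymmSq (κ i x)

end

open scoped Manifold ContDiff Matrix

noncomputable section

/-! A symmetric spinor field is encoded as a binary form in `x⁰, x¹` with coefficients in the ring
of smooth functions on a small open set. Covariant differentiation along a frame vector becomes a
derivation of the polynomial ring, `x^A ∇_{AA'}` becomes the twistor operator, and contracting one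
index between two spinors and symmetrizing becomes, up to a factor, the bracket `{f, h} = ε^{AB} ∂_A
f ∂_B h`. Commutators of the derivations produce the curvature as Hamiltonian fields of quadrics, so
the whole local argument is commutative algebra over a `FrameAlgebra`.

Commuting two twistor operators on `L` gives `{Ψ, L} = 0` (`FrameAlgebra.ham_weylPoly_eq_zero`).
Quartic forms with vanishing bracket are proportional, so `L = c Ψ` at each point, and alignment of
the matter becomes `{Φ_{A'B'}, L} = 0`. A quartic whose bracket with a nonzero quadric `q` vanishes
is a multiple of `q²`.

Suppose `L` is not a square at a point. Squares form a closed set, so `L` is not a square on a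
neighbourhood, and there `Φ = 0`. Write `Ψ = b L` up to a constant factor. The Bianchi identity says
that `b L` is divergence free; with the twistor equation this determines all first derivatives of
`L` through `θ = d log b`, namely `5 ∇_{AA'} L = x_A {θ_{A'}, L}`. Commuting these equations, and
using again that `L` has no infinitesimal symmetry, shows that the curvature quadrics `X_{AB}` are
multiples of `x_A x_B`: only scalar curvature is left and `Ψ = 0`, a contradiction
(`FrameAlgebra.weylPoly_eq_zero`, `LocalKilling.false_of_not_isFormSquare`). Hence `L` is a square
at every point.

Where `L` does not vanish, the Taylor coefficients of the form at a fixed spinor give a smooth root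
(`LocalKilling.exists_root_of_eval`), and the Leibniz rule makes it a Killing spinor. In `L = c Ψ`
the factor `c` satisfies a linear homogeneous first-order equation, so the zero set of `L` is open,
and near a zero the root is `0`. On a simply connected manifold `L` vanishes identically or nowhere.
In the second case the local roots are unique up to sign, and the signs define a double cover, which
has a section. -/

variable {M : Type*} [TopologicalSpace M]
  [ChartedSpace (EuclideanSpace ℝ (Fin 4)) M] [IsManifold (𝓡 4) ∞ M]

/-! ## Frames and directional derivatives -/

/-- Smoothness of a vector field on a set. -/
abbrev SmoothFieldOn (V : (x : M) → TangentSpace (𝓡 4) x) (U : Set M) : Prop :=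
  ContMDiffOn (𝓡 4) (𝓡 4).tangent ∞ (fun x => (⟨x, V x⟩ : TangentBundle (𝓡 4) M)) U

theorem contMDiffOn_dirDeriv {F : Type*} [NormedAddCommGroup F] [NormedSpace ℝ F] {U : Set M}
    (hU : IsOpen U) {f : M → F} {V : (x : M) → TangentSpace (𝓡 4) x}
    (hf : ContMDiffOn (𝓡 4) 𝓘(ℝ, F) ∞ f U) (hV : SmoothFieldOn V U) :
    ContMDiffOn (𝓡 4) 𝓘(ℝ, F) ∞ (fun x => dirDeriv f x (V x)) U := by
  have h1 := hf.contMDiffOn_tangentMapWithin (m := ∞) (by simp) hU.uniqueMDiffOn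
  have h2 := h1.comp hV (fun x hx => hx)
  have h3 := (contMDiff_snd_tangentBundle_modelSpace F 𝓘(ℝ, F) (n := ∞)).comp_contMDiffOn h2
  exact h3.congr fun x hx =>
    congrArg (fun T : TangentSpace (𝓡 4) x →L[ℝ] F => T (V x)) (mfderivWithin_of_isOpen hU hx).symm

theorem LorentzMetric.contMDiffOn_inner (g : LorentzMetric M) {U : Set M}
    {V W : (x : M) → TangentSpace (𝓡 4) x} (hV : SmoothFieldOn V U) (hW : SmoothFieldOn W U) :
    ContMDiffOn (𝓡 4) 𝓘(ℝ, ℝ) ∞ (fun x => g.inner x (V x) (W x)) U := by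
  intro x hx
  have h := ContMDiffWithinAt.clm_bundle_apply₂ (E₃ := fun _ : M => ℝ) (F₃ := ℝ)
    (F₁ := EuclideanSpace ℝ (Fin 4)) (F₂ := EuclideanSpace ℝ (Fin 4))
    (b := fun x : M => x) (s := U) (x := x) (g.contMDiff.contMDiffOn x hx) (hV x hx) (hW x hx)
  simp only [Bundle.contMDiffWithinAt_totalSpace] at h
  exact h.2

theorem SmoothFieldOn.mlieBracket {U : Set M} (hU : IsOpen U)
    {V W : (x : M) → TangentSpace (𝓡 4) x} (hV : SmoothFieldOn V U) (hW : SmoothFieldOn W U) :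
    SmoothFieldOn (VectorField.mlieBracket (𝓡 4) V W) U := by
  intro x hx
  have : IsManifold (𝓡 4) (minSmoothness ℝ 2) M := by
    rw [minSmoothness_of_isRCLikeNormedField]; infer_instance
  have : IsManifold (𝓡 4) (((⊤ : ℕ∞) : ℕ∞ω) + 1) M := ‹IsManifold (𝓡 4) ∞ M›
  have h := ContMDiffAt.mlieBracket_vectorField (m := ⊤) (n := ⊤) (I := 𝓡 4) (M := M)
    (hV.contMDiffAt (hU.mem_nhds hx)) (hW.contMDiffAt (hU.mem_nhds hx)) (by simp)
  exact h.contMDiffWithinAt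

/-- Applied with `A` the derivative of the chart and `B` that of its inverse: a field pulled back to
the manifold and then into the chart is the original one. -/
theorem inverse_inverse_apply {E F : Type*} [NormedAddCommGroup E] [NormedSpace ℝ E]
    [NormedAddCommGroup F] [NormedSpace ℝ F] {A : E →L[ℝ] F} {B : F →L[ℝ] E} (hA : A.IsInvertible)
    (h : A.comp B = ContinuousLinearMap.id ℝ F) (u : F) : B.inverse (A.inverse u) = u := by
  rw [← hA.inverse_comp_apply_of_left, h, ContinuousLinearMap.inverse_id]
  rfl

/-- The chain rule. It moves iterated directional derivatives to the model space, where the field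
becomes its pullback. -/
theorem dirDeriv_extChartAt_symm {F : Type*} [NormedAddCommGroup F] [NormedSpace ℝ F] {x : M}
    {f : M → F} (V : (x : M) → TangentSpace (𝓡 4) x) {z : EuclideanSpace ℝ (Fin 4)}
    (hz : z ∈ (extChartAt (𝓡 4) x).target)
    (hf : MDifferentiableAt (𝓡 4) 𝓘(ℝ, F) f ((extChartAt (𝓡 4) x).symm z)) :
    dirDeriv f ((extChartAt (𝓡 4) x).symm z) (V ((extChartAt (𝓡 4) x).symm z)) =
      fderiv ℝ (f ∘ (extChartAt (𝓡 4) x).symm) z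
        (VectorField.mpullbackWithin 𝓘(ℝ, EuclideanSpace ℝ (Fin 4)) (𝓡 4)
          (extChartAt (𝓡 4) x).symm V (Set.range (𝓡 4)) z) := by
  have hs : MDifferentiableAt 𝓘(ℝ, EuclideanSpace ℝ (Fin 4)) (𝓡 4)
      (extChartAt (𝓡 4) x).symm z := by
    have := (contMDiffOn_extChartAt_symm (n := ∞) (I := 𝓡 4) x).contMDiffAt
      ((isOpen_extChartAt_target (I := 𝓡 4) x).mem_nhds hz)
    exact this.mdifferentiableAt (by simp)
  have hinv := isInvertible_mfderivWithin_extChartAt_symm (I := 𝓡 4) hz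
  have h1 : mfderivWithin 𝓘(ℝ, EuclideanSpace ℝ (Fin 4)) (𝓡 4) (extChartAt (𝓡 4) x).symm
      (Set.range (𝓡 4)) z = mfderiv 𝓘(ℝ, EuclideanSpace ℝ (Fin 4)) (𝓡 4)
      (extChartAt (𝓡 4) x).symm z := by
    rw [ModelWithCorners.range_eq_univ, mfderivWithin_univ]
  have h2 : fderiv ℝ (f ∘ (extChartAt (𝓡 4) x).symm) z =
      (mfderiv (𝓡 4) 𝓘(ℝ, F) f ((extChartAt (𝓡 4) x).symm z)).comp
        (mfderiv 𝓘(ℝ, EuclideanSpace ℝ (Fin 4)) (𝓡 4) (extChartAt (𝓡 4) x).symm z) := by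
    rw [← mfderiv_eq_fderiv]
    exact mfderiv_comp z hf hs
  rw [VectorField.mpullbackWithin_apply]
  rw [h1] at hinv ⊢
  rw [h2]
  exact (congrArg (mfderiv (𝓡 4) 𝓘(ℝ, F) f ((extChartAt (𝓡 4) x).symm z))
    (congrArg (fun T => T (V ((extChartAt (𝓡 4) x).symm z))) hinv.self_comp_inverse)).symm

/-- In the chart at `x` both sides become expressions in the flat second derivative of `f`, whose
symmetry gives the identity. -/
theorem dirDeriv_mlieBracket {F : Type*} [NormedAddCommGroup F] [NormedSpace ℝ F] {U : Set M}
    (hU : IsOpen U) {f : M → F} {V W : (x : M) → TangentSpace (𝓡 4) x}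
    (hf : ContMDiffOn (𝓡 4) 𝓘(ℝ, F) ∞ f U) (hV : SmoothFieldOn V U) (hW : SmoothFieldOn W U)
    {x : M} (hx : x ∈ U) :
    dirDeriv f x (VectorField.mlieBracket (𝓡 4) V W x) =
      dirDeriv (fun y => dirDeriv f y (W y)) x (V x)
        - dirDeriv (fun y => dirDeriv f y (V y)) x (W x) := by
  have : IsManifold (𝓡 4) (2 : ℕ∞ω) M := inferInstance
  have hxs := mem_extChartAt_source (I := 𝓡 4) x
  have hxt := mem_extChartAt_target (I := 𝓡 4) x
  have hxx := extChartAt_to_inv (I := 𝓡 4) x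
  have hcont : ContinuousAt (extChartAt (𝓡 4) x).symm (extChartAt (𝓡 4) x x) :=
    continuousAt_extChartAt_symm x
  have hnear : ∀ᶠ z in nhds (extChartAt (𝓡 4) x x),
      z ∈ (extChartAt (𝓡 4) x).target ∧ (extChartAt (𝓡 4) x).symm z ∈ U := by
    refine Filter.Eventually.and ((isOpen_extChartAt_target (I := 𝓡 4) x).mem_nhds hxt) ?_
    exact hcont.preimage_mem_nhds (by rw [hxx]; exact hU.mem_nhds hx)
  have hfd : ∀ y ∈ U, MDifferentiableAt (𝓡 4) 𝓘(ℝ, F) f y := fun y hy =>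
    (hf.contMDiffAt (hU.mem_nhds hy)).mdifferentiableAt (by simp)
  -- the derivative along one field of the derivative along another, in the chart
  have hsecond : ∀ V W : (x : M) → TangentSpace (𝓡 4) x, SmoothFieldOn W U →
      dirDeriv (fun y => dirDeriv f y (W y)) x (V x) =
      fderiv ℝ (fun z => fderiv ℝ (f ∘ (extChartAt (𝓡 4) x).symm) z
        (VectorField.mpullbackWithin 𝓘(ℝ, EuclideanSpace ℝ (Fin 4)) (𝓡 4)
          (extChartAt (𝓡 4) x).symm W (Set.range (𝓡 4)) z)) (extChartAt (𝓡 4) x x)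
        (VectorField.mpullbackWithin 𝓘(ℝ, EuclideanSpace ℝ (Fin 4)) (𝓡 4)
          (extChartAt (𝓡 4) x).symm V (Set.range (𝓡 4)) (extChartAt (𝓡 4) x x)) := by
    intro V W hW
    have hg := contMDiffOn_dirDeriv hU hf hW
    have h := dirDeriv_extChartAt_symm (f := fun y => dirDeriv f y (W y)) V hxt
      (by rw [hxx]; exact (hg.contMDiffAt (hU.mem_nhds hx)).mdifferentiableAt (by simp))
    rw [hxx] at h
    rw [h]
    congr 1
    apply Filter.EventuallyEq.fderiv_eq
    filter_upwards [hnear] with z hz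
    exact dirDeriv_extChartAt_symm W hz.1 (hfd _ hz.2)
  have hdiff : ∀ W : (x : M) → TangentSpace (𝓡 4) x, SmoothFieldOn W U →
      DifferentiableAt ℝ (VectorField.mpullbackWithin 𝓘(ℝ, EuclideanSpace ℝ (Fin 4)) (𝓡 4)
          (extChartAt (𝓡 4) x).symm W (Set.range (𝓡 4))) (extChartAt (𝓡 4) x x) := by
    intro W hW
    have h := MDifferentiableWithinAt.differentiableWithinAt_mpullbackWithin_vectorField
      (I := 𝓡 4) (V := W) (s := Set.univ) (x := x)
      ((hW.contMDiffAt (hU.mem_nhds hx)).mdifferentiableAt (by simp)).mdifferentiableWithinAt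
    exact h.differentiableAt (by simp)
  have hf' : ContDiffAt ℝ ∞ (f ∘ (extChartAt (𝓡 4) x).symm) (extChartAt (𝓡 4) x x) := by
    rw [← contMDiffAt_iff_contDiffAt]
    refine ContMDiffAt.comp _ (I' := 𝓡 4) ?_ ((contMDiffOn_extChartAt_symm (n := ∞) (I := 𝓡 4)
      x).contMDiffAt ((isOpen_extChartAt_target (I := 𝓡 4) x).mem_nhds hxt))
    rw [hxx]
    exact hf.contMDiffAt (hU.mem_nhds hx)
  rw [hsecond V W hW, hsecond W V hV, ← VectorField.fderiv_apply_lieBracket hf'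
    (by rw [minSmoothness_of_isRCLikeNormedField]; exact WithTop.coe_le_coe.2 le_top) (hdiff W hW) (hdiff V hV)]
  have h3 := dirDeriv_extChartAt_symm (f := f) (VectorField.mlieBracket (𝓡 4) V W) hxt
    (by rw [hxx]; exact hfd x hx)
  rw [hxx] at h3
  rw [h3]
  congr 1
  rw [VectorField.mpullbackWithin_apply, hxx, ← VectorField.mlieBracketWithin_univ,
    VectorField.mlieBracketWithin_apply]
  have h4 := isInvertible_mfderiv_extChartAt (I := 𝓡 4) hxs
  have h5 := mfderiv_extChartAt_comp_mfderivWithin_extChartAt_symm (I := 𝓡 4) hxt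
  rw [hxx] at h5
  refine (@inverse_inverse_apply (EuclideanSpace ℝ (Fin 4)) (EuclideanSpace ℝ (Fin 4)) _ _ _ _ _ _
    h4 h5 _).trans ?_
  simp only [Set.preimage_univ, Set.univ_inter, ModelWithCorners.range_eq_univ]
  exact congrFun (VectorField.lieBracketWithin_univ (𝕜 := ℝ) (E := EuclideanSpace ℝ (Fin 4))) _

/-! ## Orthonormal frames -/

theorem minkowskiDiag_mul_self (a : Fin 4) : minkowskiDiag a * minkowskiDiag a = 1 := by
  fin_cases a <;> simp [minkowskiDiag]

/-- The fields `E_a` form a smooth orthonormal frame on `U`. -/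
structure IsOrthonormalFrame (g : LorentzMetric M) (E : Fin 4 → (x : M) → TangentSpace (𝓡 4) x)
    (U : Set M) : Prop where
  isOpen : IsOpen U
  smooth (a : Fin 4) : SmoothFieldOn (E a) U
  orthonormal (x : M) (hx : x ∈ U) (a b : Fin 4) :
    g.inner x (E a x) (E b x) = if a = b then minkowskiDiag a else 0

namespace IsOrthonormalFrame

variable {g : LorentzMetric M} {E : Fin 4 → (x : M) → TangentSpace (𝓡 4) x} {U : Set M}

theorem mono (h : IsOrthonormalFrame g E U) {V : Set M} (hV : IsOpen V) (hVU : V ⊆ U) :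
    IsOrthonormalFrame g E V :=
  ⟨hV, fun a => (h.smooth a).mono hVU, fun x hx => h.orthonormal x (hVU hx)⟩

theorem linearIndependent (h : IsOrthonormalFrame g E U) {x : M} (hx : x ∈ U) :
    LinearIndependent ℝ (fun a => E a x) := by
  rw [Fintype.linearIndependent_iff]
  intro c hc b
  have h1 : g.inner x (∑ a, c a • E a x) (E b x) = 0 := by rw [hc]; simp
  rw [map_sum] at h1
  simp only [sum_apply, map_smul, smul_apply,
    h.orthonormal x hx, smul_eq_mul, mul_ite, mul_zero, Finset.sum_ite_eq', Finset.mem_univ,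
    if_true] at h1
  have h2 := minkowskiDiag_mul_self b
  calc c b = c b * minkowskiDiag b * minkowskiDiag b := by rw [mul_assoc, h2, mul_one]
    _ = 0 := by rw [h1, zero_mul]

/-- The Minkowski diagonal is its own inverse, hence the factor `minkowskiDiag a` in the
coefficients. -/
theorem eq_sum (h : IsOrthonormalFrame g E U) {x : M} (hx : x ∈ U) (v : TangentSpace (𝓡 4) x) :
    v = ∑ a, (minkowskiDiag a * g.inner x v (E a x)) • E a x := by
  have hli := h.linearIndependent hx
  have hfr : Module.finrank ℝ (TangentSpace (𝓡 4) x) = 4 :=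
    finrank_euclideanSpace_fin (𝕜 := ℝ) (n := 4)
  let b := basisOfLinearIndependentOfCardEqFinrank hli (by rw [hfr]; rfl)
  have hb : ∀ a, b a = E a x := fun a => by simp [b]
  have hv := b.sum_repr v
  have hc : ∀ a, b.repr v a = minkowskiDiag a * g.inner x v (E a x) := by
    intro a
    conv_rhs => rw [← hv]
    rw [map_sum]
    simp only [sum_apply, map_smul, smul_apply, hb,
      h.orthonormal x hx, smul_eq_mul, mul_ite, mul_zero, Finset.sum_ite_eq', Finset.mem_univ,
      if_true]
    rw [mul_left_comm, minkowskiDiag_mul_self, mul_one]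
  conv_lhs => rw [← hv]
  simp only [hc, hb]

theorem frameConn_smooth (h : IsOrthonormalFrame g E U) (a b c : Fin 4) :
    ContMDiffOn (𝓡 4) 𝓘(ℝ, ℝ) ∞ (frameConn g E a b c) U := by
  have h1 : ∀ a b c, ContMDiffOn (𝓡 4) 𝓘(ℝ, ℝ) ∞
      (fun x => g.inner x (VectorField.mlieBracket (𝓡 4) (E a) (E b) x) (E c x)) U :=
    fun a b c => g.contMDiffOn_inner ((h.smooth a).mlieBracket h.isOpen (h.smooth b)) (h.smooth c)
  have h2 : ContMDiffOn (𝓡 4) 𝓘(ℝ, ℝ) ∞ (fun x => minkowskiDiag c * ((1 / 2) *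
    (g.inner x (VectorField.mlieBracket (𝓡 4) (E a) (E b) x) (E c x)
    - g.inner x (VectorField.mlieBracket (𝓡 4) (E b) (E c) x) (E a x)
    + g.inner x (VectorField.mlieBracket (𝓡 4) (E c) (E a) x) (E b x)))) U :=
    contMDiffOn_const.mul (contMDiffOn_const.mul (((h1 a b c).sub (h1 b c a)).add (h1 c a b)))
  exact h2

/-- Metric compatibility of the Koszul expression; it places each `Γ_a` in `so(1,3)`. -/
theorem frameConnLow_swap (a b c : Fin 4) (x : M) :
    frameConnLow g E a b c x = -frameConnLow g E a c b x := by
  have hs : ∀ a b c : Fin 4, g.inner x (VectorField.mlieBracket (𝓡 4) (E a) (E b) x) (E c x) =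
      -g.inner x (VectorField.mlieBracket (𝓡 4) (E b) (E a) x) (E c x) := by
    intro a b c
    rw [VectorField.mlieBracket_swap_apply]
    simp
  unfold frameConnLow
  rw [hs c b a, hs b a c, hs a c b]
  ring

/-- Torsion-freeness: expanded in the frame, the bracket `[E_a, E_b]` has coefficients `Γ_{ab}{}^c -
Γ_{ba}{}^c`. -/
theorem dirDeriv_comm (h : IsOrthonormalFrame g E U) {F : Type*} [NormedAddCommGroup F]
    [NormedSpace ℝ F] {f : M → F} (hf : ContMDiffOn (𝓡 4) 𝓘(ℝ, F) ∞ f U) {x : M} (hx : x ∈ U)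
    (a b : Fin 4) :
    dirDeriv (fun y => dirDeriv f y (E b y)) x (E a x)
        - dirDeriv (fun y => dirDeriv f y (E a y)) x (E b x) =
      ∑ c, (frameConn g E a b c x - frameConn g E b a c x) • dirDeriv f x (E c x) := by
  rw [← dirDeriv_mlieBracket h.isOpen hf (h.smooth a) (h.smooth b) hx]
  conv_lhs => rw [h.eq_sum hx (VectorField.mlieBracket (𝓡 4) (E a) (E b) x)]
  have hc : ∀ c, minkowskiDiag c * g.inner x (VectorField.mlieBracket (𝓡 4) (E a) (E b) x) (E c x)
      = frameConn g E a b c x - frameConn g E b a c x := by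
    intro c
    have hs : ∀ a b c : Fin 4, g.inner x (VectorField.mlieBracket (𝓡 4) (E a) (E b) x) (E c x) =
        -g.inner x (VectorField.mlieBracket (𝓡 4) (E b) (E a) x) (E c x) := by
      intro a b c
      rw [VectorField.mlieBracket_swap_apply]
      simp
    unfold frameConn frameConnLow
    rw [hs b a c, hs a c b, hs c b a]
    ring
  simp only [hc, dirDeriv]
  rw [map_sum]
  exact Finset.sum_congr rfl fun c _ => map_smul _ _ _

end IsOrthonormalFrame

theorem contMDiffOn_coord (p : M) (i : Fin 4) : ContMDiffOn (𝓡 4) 𝓘(ℝ, ℝ) ∞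
    (fun y => extChartAt (𝓡 4) p y i) (extChartAt (𝓡 4) p).source := by
  have h := contMDiffOn_extChartAt (I := 𝓡 4) (n := ∞) (x := p)
  rw [extChartAt_source]
  exact ((EuclideanSpace.proj (𝕜 := ℝ) i).contMDiff (n := ∞)).comp_contMDiffOn h

/-- The coordinates separate tangent vectors, so they can serve as test functions for the
independence of the frame derivations. -/
theorem eq_zero_of_dirDeriv_coord {p x : M} (hx : x ∈ (extChartAt (𝓡 4) p).source)
    {v : TangentSpace (𝓡 4) x}
    (hv : ∀ i : Fin 4, dirDeriv (fun y => extChartAt (𝓡 4) p y i) x v = 0) : v = 0 := by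
  have hinv := isInvertible_mfderiv_extChartAt (I := 𝓡 4) hx
  have hd : MDifferentiableAt (𝓡 4) 𝓘(ℝ, EuclideanSpace ℝ (Fin 4)) (extChartAt (𝓡 4) p) x :=
    mdifferentiableAt_extChartAt (by rwa [extChartAt_source] at hx)
  have h0 : mfderiv (𝓡 4) 𝓘(ℝ, EuclideanSpace ℝ (Fin 4)) (extChartAt (𝓡 4) p) x v = 0 := by
    refine PiLp.ext fun i => ?_
    have h1 : HasMFDerivAt (𝓡 4) 𝓘(ℝ, ℝ) (fun y => extChartAt (𝓡 4) p y i) x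
        ((EuclideanSpace.proj (𝕜 := ℝ) i : EuclideanSpace ℝ (Fin 4) →L[ℝ] ℝ).comp
          (mfderiv (𝓡 4) 𝓘(ℝ, EuclideanSpace ℝ (Fin 4)) (extChartAt (𝓡 4) p) x)) :=
      (EuclideanSpace.proj (𝕜 := ℝ) i : EuclideanSpace ℝ (Fin 4) →L[ℝ] ℝ).hasMFDerivAt.comp x
        hd.hasMFDerivAt
    have h2 := hv i
    unfold dirDeriv at h2
    rw [h1.mfderiv] at h2
    exact h2
  obtain ⟨e, he⟩ := hinv
  rw [← he] at h0
  exact e.injective (h0.trans (map_zero e).symm)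

/-! ## Derivations of `R[x⁰, x¹]`

A spinor field `φ_{A₁…A_k}` is encoded by the polynomial `φ_{A₁…A_k} x^{A₁} ⋯ x^{A_k}`; covariant
derivatives become derivations of the polynomial ring. -/

section PolyDeriv

/-- Polynomials in the two spinor variables. -/
abbrev SpinPoly (R : Type*) [CommRing R] : Type _ := MvPolynomial (Fin 2) R

variable {R : Type*} [CommRing R] [Algebra ℂ R]

/-- The derivation of `R[x⁰, x¹]` that extends a derivation `D` of `R` and maps `x^i` to `v i`. -/
def polyDeriv (D : Derivation ℂ R R) (v : Fin 2 → SpinPoly R) :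
    Derivation ℂ (SpinPoly R) (SpinPoly R) :=
  -- A derivation is the infinitesimal part of a ring homomorphism to the dual numbers lifting the
  -- identity, and such a homomorphism may be prescribed on constants and variables. `D` need not be
  -- `R`-linear, so it must enter through the constants.
  let φ : SpinPoly R →+* TrivSqZeroExt (SpinPoly R) (SpinPoly R) :=
    MvPolynomial.eval₂Hom
      { toFun := fun r => TrivSqZeroExt.inl (MvPolynomial.C r) +
          TrivSqZeroExt.inr (MvPolynomial.C (D r))
        map_one' := by ext <;> simp
        map_mul' := fun r s => by
          ext1
          · simp
          · simp [mul_comm]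
        map_zero' := by ext <;> simp
        map_add' := fun r s => by ext1 <;> simp }
      (fun i => TrivSqZeroExt.inl (MvPolynomial.X i) + TrivSqZeroExt.inr (v i))
  have hfst : ∀ f, (φ f).fst = f := fun f => by
    have : ((TrivSqZeroExt.fstHom (SpinPoly R) (SpinPoly R)
      (SpinPoly R)).toRingHom.comp φ) = RingHom.id _ := by
      apply MvPolynomial.ringHom_ext
      · intro r; simp [φ]
      · intro i; simp [φ]
    exact congrArg (fun ψ : SpinPoly R →+* SpinPoly R => ψ f) this
  Derivation.mk'
    { toFun := fun f => (φ f).snd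
      map_add' := fun f g => by simp
      map_smul' := fun c f => by
        have h : φ (algebraMap ℂ _ c) = TrivSqZeroExt.inl (algebraMap ℂ _ c) := by
          rw [IsScalarTower.algebraMap_apply ℂ R (SpinPoly R), MvPolynomial.algebraMap_eq]
          ext1 <;> simp [φ]
        rw [Algebra.smul_def, map_mul, h]
        simp [Algebra.smul_def] }
    (fun f g => by simp [hfst, mul_comm])

@[simp] theorem polyDeriv_C (D : Derivation ℂ R R) (v : Fin 2 → SpinPoly R) (r : R) :
    polyDeriv D v (MvPolynomial.C r) = MvPolynomial.C (D r) := by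
  simp [polyDeriv]

@[simp] theorem polyDeriv_X (D : Derivation ℂ R R) (v : Fin 2 → SpinPoly R) (i : Fin 2) :
    polyDeriv D v (MvPolynomial.X i) = v i := by
  simp [polyDeriv]

theorem derivation_poly_ext {D₁ D₂ : Derivation ℂ (SpinPoly R) (SpinPoly R)}
    (hC : ∀ r, D₁ (MvPolynomial.C r) = D₂ (MvPolynomial.C r))
    (hX : ∀ i, D₁ (MvPolynomial.X i) = D₂ (MvPolynomial.X i)) : D₁ = D₂ := by
  refine Derivation.ext fun f => ?_
  induction f using MvPolynomial.induction_on with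
  | C r => exact hC r
  | add p q hp hq => rw [map_add, map_add, hp, hq]
  | mul_X p i hp => rw [Derivation.leibniz, Derivation.leibniz, hp, hX]

/-- `∂/∂x^i` as a derivation over `ℂ`. -/
def xDeriv (i : Fin 2) : Derivation ℂ (SpinPoly R) (SpinPoly R) := polyDeriv 0 (Pi.single i 1)

@[simp] theorem xDeriv_C (i : Fin 2) (r : R) : xDeriv i (MvPolynomial.C r : SpinPoly R) = 0 := by
  simp [xDeriv]

@[simp] theorem xDeriv_X_self (i : Fin 2) : xDeriv i (MvPolynomial.X i : SpinPoly R) = 1 := by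
  simp [xDeriv]

@[simp] theorem xDeriv_zero_X_one : xDeriv 0 (MvPolynomial.X 1 : SpinPoly R) = 0 := by
  simp [xDeriv]

@[simp] theorem xDeriv_one_X_zero : xDeriv 1 (MvPolynomial.X 0 : SpinPoly R) = 0 := by
  simp [xDeriv]

theorem xDeriv_comm (f : SpinPoly R) :
    (xDeriv 0 (xDeriv 1 f : SpinPoly R) : SpinPoly R) = xDeriv 1 (xDeriv 0 f : SpinPoly R) := by
  have h : ⁅(xDeriv 0 : Derivation ℂ (SpinPoly R) (SpinPoly R)),
      (xDeriv 1 : Derivation ℂ (SpinPoly R) (SpinPoly R))⁆ = 0 := by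
    apply derivation_poly_ext
    · intro r; simp [Derivation.commutator_apply]
    · intro i; fin_cases i <;> simp [Derivation.commutator_apply]
  have h2 := congrArg (fun D : Derivation ℂ (SpinPoly R) (SpinPoly R) => D f) h
  simpa [Derivation.commutator_apply, sub_eq_zero] using h2

/-- The Hamiltonian derivation `{f, ·}` of the bracket
`{f, h} = ∂₀ f ∂₁ h - ∂₁ f ∂₀ h = ε^{AB} ∂_A f ∂_B h`. -/
def ham (f : SpinPoly R) : Derivation ℂ (SpinPoly R) (SpinPoly R) := xDeriv 0 f • xDeriv 1 - xDeriv 1 f • xDeriv 0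

theorem ham_apply (f h : SpinPoly R) : ham f h = xDeriv 0 f * xDeriv 1 h - xDeriv 1 f * xDeriv 0 h := by
  simp [ham]

theorem ham_add (f h : SpinPoly R) : ham (f + h) = ham f + ham h := by
  refine Derivation.ext fun p => ?_
  simp only [ham_apply, Derivation.add_apply, map_add]; ring

theorem derivation_sum_apply {ι S : Type*} [CommRing S] [Algebra ℂ S] (s : Finset ι)
    (D : ι → Derivation ℂ S S) (f : S) : (∑ i ∈ s, D i) f = ∑ i ∈ s, D i f := by
  classical
  induction s using Finset.induction_on with
  | empty => simp
  | insert i s hi ih => rw [Finset.sum_insert hi, Finset.sum_insert hi, Derivation.add_apply, ih]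

theorem ham_sum {ι : Type*} (s : Finset ι) (f : ι → SpinPoly R) : ham (∑ i ∈ s, f i) = ∑ i ∈ s, ham (f i) := by
  classical
  induction s using Finset.induction_on with
  | empty => exact Derivation.ext fun p => by simp [ham_apply]
  | insert i s hi ih => rw [Finset.sum_insert hi, Finset.sum_insert hi, ham_add, ih]

theorem ham_smul (c : ℂ) (f : SpinPoly R) : ham (c • f) = c • ham f := by
  refine Derivation.ext fun p => ?_
  simp only [ham_apply, Derivation.smul_apply, Derivation.map_smul, smul_mul_assoc, smul_sub]

theorem ham_C_mul (r : R) (f : SpinPoly R) : ham (MvPolynomial.C r * f) = (MvPolynomial.C r : SpinPoly R) • ham f := by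
  refine Derivation.ext fun p => ?_
  simp only [ham_apply, Derivation.smul_apply, Derivation.leibniz, xDeriv_C, smul_eq_mul]
  ring

/-- A derivation of `R[x⁰, x¹]` that acts on the linear forms by a trace-free matrix over `R`. -/
structure IsSpinDeriv (H : Derivation ℂ (SpinPoly R) (SpinPoly R)) (D : Derivation ℂ R R) (γ : Matrix (Fin 2) (Fin 2) R) :
    Prop where
  map_C (r : R) : H (MvPolynomial.C r) = MvPolynomial.C (D r)
  map_X (i : Fin 2) : H (MvPolynomial.X i) = -∑ j, MvPolynomial.C (γ i j) * MvPolynomial.X j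
  trace : γ 0 0 + γ 1 1 = 0

namespace IsSpinDeriv

variable {H : Derivation ℂ (SpinPoly R) (SpinPoly R)} {D : Derivation ℂ R R} {γ : Matrix (Fin 2) (Fin 2) R}

/-- The commutator `[∂_i, H]` and the right-hand combination of partial derivatives are derivations,
so agreement on constants and variables suffices. -/
theorem xDeriv_apply (h : IsSpinDeriv H D γ) (i : Fin 2) (f : SpinPoly R) :
    xDeriv i (H f) = H (xDeriv i f) - ∑ j, MvPolynomial.C (γ j i) * xDeriv j f := by
  have h2 : ⁅(xDeriv i : Derivation ℂ (SpinPoly R) (SpinPoly R)), H⁆ =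
      -∑ j, (MvPolynomial.C (γ j i) : SpinPoly R) • xDeriv j := by
    apply derivation_poly_ext
    · intro r
      simp [Derivation.commutator_apply, h.map_C]
    · intro k
      fin_cases i <;> fin_cases k <;>
      simp [Derivation.commutator_apply, h.map_X, Derivation.leibniz]
  have h3 := congrArg (fun D : Derivation ℂ (SpinPoly R) (SpinPoly R) => D f) h2
  simp only [Derivation.commutator_apply, Derivation.neg_apply, derivation_sum_apply,
    Derivation.smul_apply, smul_eq_mul] at h3
  linear_combination h3

/-- Trace-freeness of `γ` means that `H` preserves `ε^{AB}`, and the bracket is built from `ε^{AB}`.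
-/
theorem map_ham (h : IsSpinDeriv H D γ) (f p : SpinPoly R) :
    H (ham f p) = ham (H f) p + ham f (H p) := by
  have htr : (MvPolynomial.C (γ 0 0) + MvPolynomial.C (γ 1 1) : SpinPoly R) = 0 := by
    rw [← map_add, h.trace, map_zero]
  simp only [ham_apply, map_sub, Derivation.leibniz, smul_eq_mul, h.xDeriv_apply,
    Fin.sum_univ_two]
  linear_combination (xDeriv 0 f * xDeriv 1 p - xDeriv 1 f * xDeriv 0 p) * htr

theorem bracket_ham (h : IsSpinDeriv H D γ) (f : SpinPoly R) : ⁅H, ham f⁆ = ham (H f) := by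
  refine Derivation.ext fun p => ?_
  rw [Derivation.commutator_apply, h.map_ham]
  ring

/-- Homogeneity is recorded by Euler's identity instead of degrees. `H` respects it because it acts
linearly on the variables. -/
theorem euler (h : IsSpinDeriv H D γ) (f : SpinPoly R) :
    MvPolynomial.X 0 * xDeriv 0 (H f) + MvPolynomial.X 1 * xDeriv 1 (H f)
      = H (MvPolynomial.X 0 * xDeriv 0 f + MvPolynomial.X 1 * xDeriv 1 f) := by
  simp only [h.xDeriv_apply, map_add, Derivation.leibniz, smul_eq_mul, h.map_X, Fin.sum_univ_two]
  ring

end IsSpinDeriv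

end PolyDeriv

/-! ## The representation of `so(1,3)` on spinors -/

section SpinRep

variable {R : Type*} [CommRing R] [Algebra ℂ R]

/-- `m_b{}^c` is antisymmetric after lowering an index with the Minkowski metric. -/
def IsLorentz (m : Fin 4 → Fin 4 → R) : Prop :=
  ∀ b c, (minkowskiDiag c : ℂ) • m b c = -((minkowskiDiag b : ℂ) • m c b)

theorem eq_zero_of_eq_neg_self {r : R} (h : r = -r) : r = 0 := by
  have h2 : (2 : ℂ) • r = 0 := by rw [two_smul]; nth_rewrite 1 [h]; simp
  calc r = (2⁻¹ : ℂ) • (2 : ℂ) • r := by rw [smul_smul]; norm_num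
    _ = 0 := by rw [h2, smul_zero]

/-- Reduces to the six independent entries, after which the identities of the representation can be
checked by expansion. -/
theorem IsLorentz.components {m : Fin 4 → Fin 4 → R} (h : IsLorentz m) :
    (m 0 0 = 0 ∧ m 1 1 = 0 ∧ m 2 2 = 0 ∧ m 3 3 = 0) ∧
    (m 1 0 = m 0 1 ∧ m 2 0 = m 0 2 ∧ m 3 0 = m 0 3) ∧
    (m 2 1 = -m 1 2 ∧ m 3 1 = -m 1 3 ∧ m 3 2 = -m 2 3) := by
  have h' := fun b c => h b c
  refine ⟨⟨?_, ?_, ?_, ?_⟩, ⟨?_, ?_, ?_⟩, ⟨?_, ?_, ?_⟩⟩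
  · exact eq_zero_of_eq_neg_self (by simpa [minkowskiDiag] using h' 0 0)
  · exact eq_zero_of_eq_neg_self (by simpa [minkowskiDiag] using (h' 1 1).symm)
  · exact eq_zero_of_eq_neg_self (by simpa [minkowskiDiag] using (h' 2 2).symm)
  · exact eq_zero_of_eq_neg_self (by simpa [minkowskiDiag] using (h' 3 3).symm)
  · simpa [minkowskiDiag] using h' 1 0
  · simpa [minkowskiDiag] using h' 2 0
  · simpa [minkowskiDiag] using h' 3 0
  · simpa [minkowskiDiag, neg_eq_iff_eq_neg] using h' 2 1
  · simpa [minkowskiDiag, neg_eq_iff_eq_neg] using h' 3 1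
  · simpa [minkowskiDiag, neg_eq_iff_eq_neg] using h' 3 2

/-- The spinor representation `m ↦ (1/2) m_b{}^c σ_c^{AA'} σ^b_{BA'}`. -/
def spinRep (m : Fin 4 → Fin 4 → R) (A B : Fin 2) : R :=
  (1 / 2 : ℂ) • ∑ b, ∑ c, ∑ A', (infeld c A A' * infeldInv b B A') • m b c

/-- The conjugate spinor representation `m ↦ (1/2) m_b{}^c σ_c^{AA'} σ^b_{AB'}`. -/
def spinRepConj (m : Fin 4 → Fin 4 → R) (A' B' : Fin 2) : R :=
  (1 / 2 : ℂ) • ∑ b, ∑ c, ∑ A, (infeld c A A' * infeldInv b A B') • m b c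

theorem inv_sqrt_two_mul_self : ((Real.sqrt 2 : ℂ))⁻¹ * ((Real.sqrt 2 : ℂ))⁻¹ = 1 / 2 := by
  rw [← mul_inv, ← Complex.ofReal_mul, Real.mul_self_sqrt (by norm_num)]
  norm_num

/-- `√2 σ_a`. -/
def pauli (a : Fin 4) : Matrix (Fin 2) (Fin 2) ℂ :=
  ![!![1, 0; 0, 1], !![0, 1; 1, 0], !![0, Complex.I; -Complex.I, 0], !![1, 0; 0, -1]] a

theorem infeld_eq (a : Fin 4) (A A' : Fin 2) :
    infeld a A A' = ((Real.sqrt 2 : ℂ))⁻¹ * pauli a A A' := by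
  simp only [infeld, pauli, Matrix.smul_apply, smul_eq_mul, one_div]

theorem infeldInv_eq (a : Fin 4) (A A' : Fin 2) :
    infeldInv a A A' = ((Real.sqrt 2 : ℂ))⁻¹ * star (pauli a A A') := by
  simp only [infeldInv, infeld_eq, star_mul']
  simp

theorem infeld_mul_infeldInv (a b : Fin 4) (A A' B B' : Fin 2) :
    infeld a A A' * infeldInv b B B' = (1 / 2) * (pauli a A A' * star (pauli b B B')) := by
  rw [infeld_eq, infeldInv_eq, mul_mul_mul_comm, inv_sqrt_two_mul_self]

theorem infeldInv_mul_infeldInv (a b : Fin 4) (A A' B B' : Fin 2) :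
    infeldInv a A A' * infeldInv b B B' =
      (1 / 2) * (star (pauli a A A') * star (pauli b B B')) := by
  rw [infeldInv_eq, infeldInv_eq, mul_mul_mul_comm, inv_sqrt_two_mul_self]

theorem spinRep_components {m : Fin 4 → Fin 4 → R} (h : IsLorentz m) :
    spinRep m 0 0 = (1 / 2 : ℂ) • (m 0 3 + Complex.I • m 1 2) ∧
    spinRep m 1 1 = -((1 / 2 : ℂ) • (m 0 3 + Complex.I • m 1 2)) ∧
    spinRep m 0 1 = (1 / 2 : ℂ) • (m 0 1 + Complex.I • m 2 3 + Complex.I • m 0 2 + m 1 3) ∧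
    spinRep m 1 0 = (1 / 2 : ℂ) • (m 0 1 + Complex.I • m 2 3 - Complex.I • m 0 2 - m 1 3) := by
  obtain ⟨⟨h00, h11, h22, h33⟩, ⟨h10, h20, h30⟩, ⟨h21, h31, h32⟩⟩ := h.components
  refine ⟨?_, ?_, ?_, ?_⟩ <;>
  · simp [spinRep, infeld_mul_infeldInv, pauli, Fin.sum_univ_four, h00, h11, h22, h33, h10, h20,
      h30, h21, h31, h32]
    module

theorem spinRepConj_components {m : Fin 4 → Fin 4 → R} (h : IsLorentz m) :
    spinRepConj m 0 0 = (1 / 2 : ℂ) • (m 0 3 - Complex.I • m 1 2) ∧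
    spinRepConj m 1 1 = -((1 / 2 : ℂ) • (m 0 3 - Complex.I • m 1 2)) ∧
    spinRepConj m 0 1 = (1 / 2 : ℂ) • (m 0 1 - Complex.I • m 2 3 - Complex.I • m 0 2 + m 1 3) ∧
    spinRepConj m 1 0 = (1 / 2 : ℂ) • (m 0 1 - Complex.I • m 2 3 + Complex.I • m 0 2 - m 1 3) := by
  obtain ⟨⟨h00, h11, h22, h33⟩, ⟨h10, h20, h30⟩, ⟨h21, h31, h32⟩⟩ := h.components
  refine ⟨?_, ?_, ?_, ?_⟩ <;>
  · simp [spinRepConj, infeld_mul_infeldInv, pauli, Fin.sum_univ_four, h00, h11, h22, h33, h10, h20,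
      h30, h21, h31, h32]
    module

/-- The commutator of two endomorphisms `m_b{}^c`, `n_b{}^c`. -/
def lorentzBracket (m n : Fin 4 → Fin 4 → R) (c d : Fin 4) : R :=
  ∑ f, (n c f * m f d - m c f * n f d)

theorem IsLorentz.bracket {m n : Fin 4 → Fin 4 → R} (hm : IsLorentz m) (hn : IsLorentz n) :
    IsLorentz (lorentzBracket m n) := by
  obtain ⟨⟨h00, h11, h22, h33⟩, ⟨h10, h20, h30⟩, ⟨h21, h31, h32⟩⟩ := hm.components
  obtain ⟨⟨g00, g11, g22, g33⟩, ⟨g10, g20, g30⟩, ⟨g21, g31, g32⟩⟩ := hn.components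
  intro b c
  fin_cases b <;> fin_cases c <;>
  · simp [lorentzBracket, minkowskiDiag, Fin.sum_univ_four, h00, h11, h22, h33, h10, h20,
      h30, h21, h31, h32, g00, g11, g22, g33, g10, g20, g30, g21, g31, g32]
    try ring

theorem spinRep_bracket {m n : Fin 4 → Fin 4 → R} (hm : IsLorentz m) (hn : IsLorentz n)
    (A B : Fin 2) : spinRep (lorentzBracket m n) A B =
      ∑ C, (spinRep m A C * spinRep n C B - spinRep n A C * spinRep m C B) := by
  obtain ⟨k00, k11, k01, k10⟩ := spinRep_components (hm.bracket hn)
  obtain ⟨m00, m11, m01, m10⟩ := spinRep_components hm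
  obtain ⟨n00, n11, n01, n10⟩ := spinRep_components hn
  obtain ⟨⟨h00, h11, h22, h33⟩, ⟨h10, h20, h30⟩, ⟨h21, h31, h32⟩⟩ := hm.components
  obtain ⟨⟨g00, g11, g22, g33⟩, ⟨g10, g20, g30⟩, ⟨g21, g31, g32⟩⟩ := hn.components
  have hi : algebraMap ℂ R Complex.I * algebraMap ℂ R Complex.I = -1 := by
    rw [← map_mul, Complex.I_mul_I, map_neg, map_one]
  have h2 : 2 * algebraMap ℂ R (1 / 2) = 1 := by
    rw [← map_ofNat (algebraMap ℂ R) 2, ← map_mul]; norm_num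
  fin_cases A <;> fin_cases B <;>
  · simp only [Fin.zero_eta, Fin.mk_one, Fin.sum_univ_two, k00, k11, k01, k10, m00, m11, m01, m10,
      n00, n11, n01, n10, lorentzBracket, Fin.sum_univ_four, Algebra.smul_def, h00, h11, h22, h33,
      h10, h20, h21, h31, h32, g00, g11, g22, g33, g10, g20, g21, g31, g32]
    clear k00 k11 k01 k10 m00 m11 m01 m10 n00 n11 n01 n10 h00 h11 h22 h33 h10 h20 h30 h21 h31 h32 g00 g11 g22 g33 g10 g20 g30 g21 g31 g32
    -- What is left is a polynomial identity in a commutative ring with `i² = -1` and `2h = 1`.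
    generalize algebraMap ℂ R Complex.I = i at *
    generalize algebraMap ℂ R (1/2) = h at *
    grind

/-- The symbols `σ^b_{BB'}` are invariant under the sum of the two representations. -/
theorem infeldInv_equivariant {m : Fin 4 → Fin 4 → R} (hm : IsLorentz m) (B B' : Fin 2) (c : Fin 4) :
    ∑ b, infeldInv b B B' • m b c = ∑ C, infeldInv c C B' • spinRep m C B
      + ∑ C', infeldInv c B C' • spinRepConj m C' B' := by
  obtain ⟨m00, m11, m01, m10⟩ := spinRep_components hm
  obtain ⟨n00, n11, n01, n10⟩ := spinRepConj_components hm
  obtain ⟨⟨h00, h11, h22, h33⟩, ⟨h10, h20, h30⟩, ⟨h21, h31, h32⟩⟩ := hm.components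
  fin_cases B <;> fin_cases B' <;> fin_cases c <;>
  · simp [infeldInv_eq, pauli, Fin.sum_univ_four, m00, m11, m01, m10, n00, n11, n01, n10,
      h00, h11, h22, h33, h10, h20, h30, h21, h31, h32]
    match_scalars <;> first
      | ring1
      | linear_combination ((Real.sqrt 2 : ℂ))⁻¹ * Complex.I_sq
      | linear_combination -((Real.sqrt 2 : ℂ))⁻¹ * Complex.I_sq

/-- The spinor representation with both indices lowered, as a contraction with `σ^c_{CC'}`. -/
theorem sum_eps_infeldInv {m : Fin 4 → Fin 4 → R} (hm : IsLorentz m) (C D : Fin 2) :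
    ∑ F', ∑ H', ∑ c, ∑ d, (spinEps F' H' * infeldInv c C F' * infeldInv d D H'
      * (minkowskiDiag d : ℂ)) • m c d = (2 : ℂ) • (![-spinRep m 1 D, spinRep m 0 D] C) := by
  obtain ⟨m00, m11, m01, m10⟩ := spinRep_components hm
  obtain ⟨⟨h00, h11, h22, h33⟩, ⟨h10, h20, h30⟩, ⟨h21, h31, h32⟩⟩ := hm.components
  have hs : ∀ F' H' c d, spinEps F' H' * infeldInv c C F' * infeldInv d D H' *
      (minkowskiDiag d : ℂ) = spinEps F' H' * (minkowskiDiag d : ℂ) * ((1 / 2) *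
      (star (pauli c C F') * star (pauli d D H'))) := by
    intro F' H' c d
    rw [← infeldInv_mul_infeldInv]; ring
  simp only [hs]
  fin_cases C <;> fin_cases D <;>
  · simp [pauli, spinEps, minkowskiDiag, Fin.sum_univ_four, m00, m11, m01, m10,
      h00, h11, h22, h33, h10, h20, h30, h21, h31, h32]
    module

end SpinRep

/-! ## The Levi-Civita connection of an orthonormal frame, algebraically -/

section JacobiFamily

variable {S J : Type*} [CommRing S] [Algebra ℂ S] [Fintype J]

/-- Separates a double commutator into a combination of the family and a remainder. `V` will be zero
for derivations of functions and the curvature for derivations of polynomials. -/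
theorem lie_lie_family {K : J → Derivation ℂ S S} {t : J → J → J → S}
    {V : J → J → Derivation ℂ S S} (h : ∀ i j, ⁅K i, K j⁆ = ∑ k, t i j k • K k + V i j) (i j k : J) :
    ⁅K i, ⁅K j, K k⁆⁆ = ∑ l, (K i (t j k l) + ∑ m, t j k m * t i m l) • K l
      + (⁅K i, V j k⁆ + ∑ m, t j k m • V i m) := by
  refine Derivation.ext fun f => ?_
  have h1 : ∀ m, K i (K m f) = K m (K i f) + (∑ l, t i m l * K l f + V i m f) := by
    intro m
    have := congrArg (fun D : Derivation ℂ S S => D f) (h i m)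
    simp only [Derivation.commutator_apply, Derivation.add_apply, derivation_sum_apply,
      Derivation.smul_apply, smul_eq_mul] at this
    linear_combination this
  rw [h j k]
  simp only [Derivation.commutator_apply, Derivation.add_apply, derivation_sum_apply,
    Derivation.smul_apply, smul_eq_mul, map_add, map_sum, Derivation.leibniz, h1, mul_add, add_mul,
    Finset.sum_add_distrib, Finset.mul_sum, Finset.sum_mul]
  rw [Finset.sum_comm (f := fun l m => t j k m * t i m l * K l f)]
  simp only [mul_assoc, mul_comm (K _ f)]
  ring

/-- The Jacobi identity, sorted. The coefficients of the `K l` carry the first Bianchi identity, the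
terms in `V` the second. -/
theorem jacobi_family {K : J → Derivation ℂ S S} {t : J → J → J → S}
    {V : J → J → Derivation ℂ S S} (h : ∀ i j, ⁅K i, K j⁆ = ∑ k, t i j k • K k + V i j) (i j k : J) :
    ∑ l, ((K i (t j k l) + ∑ m, t j k m * t i m l) + (K j (t k i l) + ∑ m, t k i m * t j m l)
        + (K k (t i j l) + ∑ m, t i j m * t k m l)) • K l
      + ((⁅K i, V j k⁆ + ∑ m, t j k m • V i m) + (⁅K j, V k i⁆ + ∑ m, t k i m • V j m)
        + (⁅K k, V i j⁆ + ∑ m, t i j m • V k m)) = 0 := by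
  have h0 := lie_jacobi (K i) (K j) (K k)
  rw [lie_lie_family h, lie_lie_family h, lie_lie_family h] at h0
  rw [← h0]
  simp only [add_smul, Finset.sum_add_distrib]
  abel

end JacobiFamily

/-! ### Closure properties of `so(1,3)` and linearity of the spin representation -/

section IsLorentz

variable {R : Type*} [CommRing R] [Algebra ℂ R] {m n : Fin 4 → Fin 4 → R}

theorem IsLorentz.add (hm : IsLorentz m) (hn : IsLorentz n) :
    IsLorentz (fun b c => m b c + n b c) := fun b c => by
  rw [smul_add, smul_add, hm, hn]; abel

theorem IsLorentz.sub (hm : IsLorentz m) (hn : IsLorentz n) :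
    IsLorentz (fun b c => m b c - n b c) := fun b c => by
  rw [smul_sub, smul_sub, hm, hn]; abel

theorem IsLorentz.map (hm : IsLorentz m) (D : Derivation ℂ R R) :
    IsLorentz (fun b c => D (m b c)) := fun b c => by
  rw [← D.map_smul, ← D.map_smul, hm, map_neg]

theorem IsLorentz.sum_mul {J : Type*} {s : Finset J} {m : J → Fin 4 → Fin 4 → R} {r : J → R}
    (hm : ∀ j, IsLorentz (m j)) : IsLorentz (fun b c => ∑ j ∈ s, r j * m j b c) := fun b c => by
  rw [Finset.smul_sum, Finset.smul_sum, ← Finset.sum_neg_distrib]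
  refine Finset.sum_congr rfl fun j _ => ?_
  rw [← mul_smul_comm, ← mul_smul_comm, hm j, mul_neg]

end IsLorentz

section SpinRepLinear

variable {R : Type*} [CommRing R] [Algebra ℂ R] (m n : Fin 4 → Fin 4 → R) (A B : Fin 2)

theorem spinRep_add : spinRep (fun b c => m b c + n b c) A B = spinRep m A B + spinRep n A B := by
  simp only [spinRep, smul_add, Finset.sum_add_distrib]

theorem spinRep_sub : spinRep (fun b c => m b c - n b c) A B = spinRep m A B - spinRep n A B := by
  simp only [spinRep, smul_sub, Finset.sum_sub_distrib]

theorem spinRep_mul (r : R) : spinRep (fun b c => r * m b c) A B = r * spinRep m A B := by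
  simp only [spinRep, mul_smul_comm, Finset.mul_sum]

theorem spinRep_map (D : Derivation ℂ R R) :
    spinRep (fun b c => D (m b c)) A B = D (spinRep m A B) := by
  simp only [spinRep, Derivation.map_smul, map_sum]

theorem spinRep_sum_mul (r : Fin 4 → R) (m : Fin 4 → Fin 4 → Fin 4 → R) :
    spinRep (fun b c => ∑ f, r f * m f b c) A B = ∑ f, r f * spinRep (m f) A B := by
  simp only [Fin.sum_univ_four]
  rw [spinRep_add, spinRep_add, spinRep_add, spinRep_mul, spinRep_mul, spinRep_mul, spinRep_mul]

end SpinRepLinear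

/-! ### Trace-free matrices as binary quadrics -/

section MatQuad

variable {R : Type*} [CommRing R] [Algebra ℂ R]

/-- The quadric `(1/2) F_{CD} x^C x^D` of a trace-free matrix `F^C{}_D`. -/
def matQuad (F : Fin 2 → Fin 2 → R) : SpinPoly R :=
  (1 / 2 : ℂ) • (MvPolynomial.C (F 0 1) * (MvPolynomial.X 1 * MvPolynomial.X 1)
    - MvPolynomial.C (F 1 0) * (MvPolynomial.X 0 * MvPolynomial.X 0))
    + MvPolynomial.C (F 0 0) * (MvPolynomial.X 0 * MvPolynomial.X 1)

theorem xDeriv_zero_matQuad (F : Fin 2 → Fin 2 → R) : xDeriv 0 (matQuad F) =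
    MvPolynomial.C (F 0 0) * MvPolynomial.X 1 - MvPolynomial.C (F 1 0) * MvPolynomial.X 0 := by
  simp only [matQuad, Derivation.leibniz, mul_add, map_add, map_sub, Derivation.map_smul,
    xDeriv_C, xDeriv_X_self, xDeriv_zero_X_one, smul_eq_mul, mul_zero, mul_one, add_zero]
  module

theorem xDeriv_one_matQuad (F : Fin 2 → Fin 2 → R) : xDeriv 1 (matQuad F) =
    MvPolynomial.C (F 0 0) * MvPolynomial.X 0 + MvPolynomial.C (F 0 1) * MvPolynomial.X 1 := by
  simp only [matQuad, Derivation.leibniz, mul_add, map_add, map_sub, Derivation.map_smul,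
    xDeriv_C, xDeriv_X_self, xDeriv_one_X_zero, smul_eq_mul, mul_zero, mul_one, add_zero]
  module

end MatQuad

/-- The data of an orthonormal frame over a ring of functions: the derivations `D_a` along the frame
and the Levi-Civita connection coefficients `Γ_{ab}{}^c`. -/
structure FrameAlgebra (R : Type*) [CommRing R] [Algebra ℂ R] where
  D : Fin 4 → Derivation ℂ R R
  Γ : Fin 4 → Fin 4 → Fin 4 → R
  lorentz (a : Fin 4) : IsLorentz (Γ a)
  comm (a b : Fin 4) : ⁅D a, D b⁆ = ∑ c, (Γ a b c - Γ b a c) • D c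
  indep (r : Fin 4 → R) : (∀ f, ∑ c, r c * D c f = 0) → ∀ c, r c = 0

/-! ### Riemann tensor and commutators of covariant derivatives -/

namespace FrameAlgebra

variable {R : Type*} [CommRing R] [Algebra ℂ R] (𝔉 : FrameAlgebra R)

/-- The Riemann tensor `R_{abc}{}^d`. -/
def riem (a b c d : Fin 4) : R :=
  𝔉.D a (𝔉.Γ b c d) - 𝔉.D b (𝔉.Γ a c d)
    + ∑ f, (𝔉.Γ b c f * 𝔉.Γ a f d - 𝔉.Γ a c f * 𝔉.Γ b f d)
    - ∑ f, (𝔉.Γ a b f - 𝔉.Γ b a f) * 𝔉.Γ f c d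

/-- The Riemann tensor `R_{abcd}`. -/
def riemLow (a b c d : Fin 4) : R := (minkowskiDiag d : ℂ) • 𝔉.riem a b c d

theorem riem_swap (a b c d : Fin 4) : 𝔉.riem a b c d = -𝔉.riem b a c d := by
  simp only [riem, Fin.sum_univ_four]; ring

theorem riem_lorentz (a b : Fin 4) : IsLorentz (𝔉.riem a b) :=
  ((((𝔉.lorentz b).map (𝔉.D a)).sub ((𝔉.lorentz a).map (𝔉.D b))).add
    ((𝔉.lorentz a).bracket (𝔉.lorentz b))).sub
    (IsLorentz.sum_mul (r := fun f => 𝔉.Γ a b f - 𝔉.Γ b a f) 𝔉.lorentz)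

/-- First Bianchi identity: the Jacobi identity for the `D a`, whose coefficients vanish by `indep`.
-/
theorem riem_cyclic (a b c d : Fin 4) :
    𝔉.riem a b c d + 𝔉.riem b c a d + 𝔉.riem c a b d = 0 := by
  have h := jacobi_family (K := 𝔉.D) (t := fun a b c => 𝔉.Γ a b c - 𝔉.Γ b a c) (V := 0)
    (fun i j => by simpa using 𝔉.comm i j) a b c
  simp only [Pi.zero_apply, lie_zero, smul_zero, Finset.sum_const_zero, add_zero] at h
  have h2 := 𝔉.indep _ (fun f => by
    have := congrArg (fun D : Derivation ℂ R R => D f) h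
    simpa only [derivation_sum_apply, Derivation.smul_apply, smul_eq_mul,
      Derivation.zero_apply] using this) d
  simp only [riem, Fin.sum_univ_four, map_sub] at h2 ⊢
  linear_combination h2

/-- The usual combination of four cyclic identities with the two antisymmetries; it yields twice the
difference. -/
theorem riemLow_pair_symm (a b c d : Fin 4) : 𝔉.riemLow a b c d = 𝔉.riemLow c d a b := by
  have s1 : ∀ a b c d, 𝔉.riemLow a b c d = -𝔉.riemLow b a c d := fun a b c d => by
    rw [riemLow, riemLow, riem_swap, smul_neg]
  have s2 : ∀ a b c d, 𝔉.riemLow a b c d = -𝔉.riemLow a b d c := fun a b c d =>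
    𝔉.riem_lorentz a b c d
  have s3 : ∀ a b c d, 𝔉.riemLow a b c d + 𝔉.riemLow b c a d + 𝔉.riemLow c a b d = 0 :=
    fun a b c d => by
      rw [riemLow, riemLow, riemLow, ← smul_add, ← smul_add, riem_cyclic, smul_zero]
  have h := eq_zero_of_eq_neg_self (r := 𝔉.riemLow a b c d - 𝔉.riemLow c d a b) (by
    linear_combination s3 a b c d + s3 b c d a - s3 c d a b - s3 d a b c
      - s2 b c d a - s2 c d b a + s2 a b d c + s2 d a c b + s2 a c d b - s1 a c b d + s1 b d a c
      - s2 d b a c)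
  exact sub_eq_zero.1 h

/-! ### Passage to spinors -/

/-- The spin connection matrices `(γ_a)^A{}_B`. -/
def γ (a : Fin 4) : Matrix (Fin 2) (Fin 2) R := spinRep (𝔉.Γ a)

/-- The conjugate spin connection matrices. -/
def γConj (a : Fin 4) : Matrix (Fin 2) (Fin 2) R := spinRepConj (𝔉.Γ a)

/-- The covariant derivative along `E_a`, on polynomials. -/
def H (a : Fin 4) : Derivation ℂ (SpinPoly R) (SpinPoly R) :=
  polyDeriv (𝔉.D a) (fun i => -∑ j, MvPolynomial.C (𝔉.γ a i j) * MvPolynomial.X j)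

theorem isSpinDeriv_H (a : Fin 4) : IsSpinDeriv (𝔉.H a) (𝔉.D a) (𝔉.γ a) where
  map_C r := by simp [H]
  map_X i := by simp [H]
  trace := by
    obtain ⟨h00, h11, -, -⟩ := spinRep_components (𝔉.lorentz a)
    simp only [γ, h00, h11]; abel

/-- The spin representation is linear, commutes with derivations of `R` and preserves brackets, so
it carries the curvature of `Γ` to that of `γ`. -/
theorem spinRep_riem (a b : Fin 4) (A B : Fin 2) :
    spinRep (𝔉.riem a b) A B = 𝔉.D a (𝔉.γ b A B) - 𝔉.D b (𝔉.γ a A B)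
      + ∑ C, (𝔉.γ a A C * 𝔉.γ b C B - 𝔉.γ b A C * 𝔉.γ a C B)
      - ∑ f, (𝔉.Γ a b f - 𝔉.Γ b a f) * 𝔉.γ f A B := by
  have h : 𝔉.riem a b = fun c d => ((𝔉.D a (𝔉.Γ b c d) - 𝔉.D b (𝔉.Γ a c d))
      + lorentzBracket (𝔉.Γ a) (𝔉.Γ b) c d) - ∑ f, (𝔉.Γ a b f - 𝔉.Γ b a f) * 𝔉.Γ f c d := rfl
  rw [h, spinRep_sub, spinRep_add, spinRep_sub, spinRep_map, spinRep_map,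
    spinRep_sum_mul A B (fun f => 𝔉.Γ a b f - 𝔉.Γ b a f),
    spinRep_bracket (𝔉.lorentz a) (𝔉.lorentz b)]
  rfl

/-- Under the identification of trace-free matrices with quadrics, the curvature acts on linear
forms as the Hamiltonian field of its quadric. On constants this field is zero and only the
torsion-free bracket remains. -/
theorem H_comm (a b : Fin 4) : ⁅𝔉.H a, 𝔉.H b⁆ =
    ∑ c, (MvPolynomial.C (𝔉.Γ a b c - 𝔉.Γ b a c) : SpinPoly R) • 𝔉.H c
      + ham (matQuad (spinRep (𝔉.riem a b))) := by
  apply derivation_poly_ext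
  · intro r
    have h := congrArg (fun D : Derivation ℂ R R => D r) (𝔉.comm a b)
    simp only [Derivation.commutator_apply, derivation_sum_apply, Derivation.smul_apply,
      smul_eq_mul] at h
    simp only [Derivation.commutator_apply, (𝔉.isSpinDeriv_H _).map_C, Derivation.add_apply,
      derivation_sum_apply, Derivation.smul_apply, smul_eq_mul, ham_apply, xDeriv_C, ← map_sub, h,
      map_sum, map_mul, mul_zero, sub_zero, add_zero]
  · intro i
    have h00 := 𝔉.spinRep_riem a b 0 0
    have h01 := 𝔉.spinRep_riem a b 0 1
    have h10 := 𝔉.spinRep_riem a b 1 0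
    have h11 := 𝔉.spinRep_riem a b 1 1
    have htr : spinRep (𝔉.riem a b) 1 1 = -spinRep (𝔉.riem a b) 0 0 := by
      obtain ⟨k00, k11, -, -⟩ := spinRep_components (𝔉.riem_lorentz a b)
      rw [k00, k11]
    have e00 := congrArg (MvPolynomial.C : R → SpinPoly R) h00
    have e01 := congrArg (MvPolynomial.C : R → SpinPoly R) h01
    have e10 := congrArg (MvPolynomial.C : R → SpinPoly R) h10
    have e11 := congrArg (MvPolynomial.C : R → SpinPoly R) (htr.symm.trans h11)
    simp only [map_add, map_sub, map_mul, map_neg, Fin.sum_univ_two, Fin.sum_univ_four]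
      at e00 e01 e10 e11
    fin_cases i <;>
    simp only [Fin.zero_eta, Fin.mk_one, Derivation.commutator_apply, Derivation.add_apply,
      Derivation.smul_apply, smul_eq_mul, ham_apply, xDeriv_zero_matQuad,
      xDeriv_one_matQuad, xDeriv_X_self, xDeriv_zero_X_one, xDeriv_one_X_zero,
      (𝔉.isSpinDeriv_H _).map_X, (𝔉.isSpinDeriv_H _).map_C, map_neg, Fin.sum_univ_two,
      Fin.sum_univ_four, map_add, map_sub, Derivation.leibniz]
    · linear_combination MvPolynomial.X 0 * e00 + MvPolynomial.X 1 * e01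
    · linear_combination MvPolynomial.X 0 * e10 + MvPolynomial.X 1 * e11

end FrameAlgebra

/-! ### Spinor-indexed derivatives and the curvature spinors -/

namespace FrameAlgebra

variable {R : Type*} [CommRing R] [Algebra ℂ R] (𝔉 : FrameAlgebra R)

/-- `D_{AA'} = σ^a_{AA'} D_a`. -/
def DS (i : Fin 2 × Fin 2) : Derivation ℂ R R := ∑ a, infeldInv a i.1 i.2 • 𝔉.D a

/-- `∇_{AA'} = σ^a_{AA'} ∇_a` on polynomials. -/
def HS (i : Fin 2 × Fin 2) : Derivation ℂ (SpinPoly R) (SpinPoly R) :=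
  ∑ a, infeldInv a i.1 i.2 • 𝔉.H a

/-- `(γ_{AA'})^B{}_C`. -/
def γS (i : Fin 2 × Fin 2) : Matrix (Fin 2) (Fin 2) R := ∑ a, infeldInv a i.1 i.2 • 𝔉.γ a

/-- `(γ̄_{AA'})^{B'}{}_{C'}`. -/
def γConjS (i : Fin 2 × Fin 2) : Matrix (Fin 2) (Fin 2) R := ∑ a, infeldInv a i.1 i.2 • 𝔉.γConj a

/-- The connection coefficients `Γ_{AA' BB'}{}^{CC'}`. -/
def ΓS (i j k : Fin 2 × Fin 2) : R :=
  (if k.2 = j.2 then 𝔉.γS i k.1 j.1 else 0) + (if k.1 = j.1 then 𝔉.γConjS i k.2 j.2 else 0)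

theorem isSpinDeriv_HS (i : Fin 2 × Fin 2) : IsSpinDeriv (𝔉.HS i) (𝔉.DS i) (𝔉.γS i) where
  map_C r := by
    simp only [HS, DS, derivation_sum_apply, Derivation.smul_apply, (𝔉.isSpinDeriv_H _).map_C,
      map_sum]
    refine Finset.sum_congr rfl fun a _ => ?_
    rw [MvPolynomial.C_eq_smul_one, MvPolynomial.C_eq_smul_one, smul_assoc]
  map_X k := by
    simp only [HS, γS, derivation_sum_apply, Derivation.smul_apply, (𝔉.isSpinDeriv_H _).map_X,
      Matrix.sum_apply, Matrix.smul_apply, smul_neg, Finset.sum_neg_distrib, Finset.smul_sum,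
      map_sum, Finset.sum_mul]
    rw [Finset.sum_comm]
    congr 1
    refine Finset.sum_congr rfl fun a _ => Finset.sum_congr rfl fun b _ => ?_
    rw [← smul_mul_assoc, MvPolynomial.C_eq_smul_one, MvPolynomial.C_eq_smul_one, smul_assoc]
  trace := by
    simp only [γS, Matrix.sum_apply, Matrix.smul_apply, ← Finset.sum_add_distrib, ← smul_add,
      (𝔉.isSpinDeriv_H _).trace, smul_zero, Finset.sum_const_zero]

theorem C_smul (c : ℂ) (r : R) : (MvPolynomial.C (c • r) : SpinPoly R) = c • MvPolynomial.C r := by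
  rw [MvPolynomial.C_eq_smul_one, MvPolynomial.C_eq_smul_one, smul_assoc]

/-- The curvature quadrics `(1/2) F_{AA'BB' CD} x^C x^D`. -/
def QS (i j : Fin 2 × Fin 2) : SpinPoly R :=
  ∑ a, ∑ b, (infeldInv a i.1 i.2 * infeldInv b j.1 j.2) • matQuad (spinRep (𝔉.riem a b))

/-- The origin of `ΓS`: by invariance of the symbols `σ`, the vector connection splits into the spin
connection and its conjugate. -/
theorem sum_infeldInv_Γ (i j : Fin 2 × Fin 2) (c : Fin 4) :
    ∑ a, ∑ b, (infeldInv a i.1 i.2 * infeldInv b j.1 j.2) • 𝔉.Γ a b c =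
      ∑ k : Fin 2 × Fin 2, infeldInv c k.1 k.2 • 𝔉.ΓS i j k := by
  have h : ∀ a, ∑ b, (infeldInv a i.1 i.2 * infeldInv b j.1 j.2) • 𝔉.Γ a b c =
      infeldInv a i.1 i.2 • (∑ C, infeldInv c C j.2 • 𝔉.γ a C j.1
        + ∑ C', infeldInv c j.1 C' • 𝔉.γConj a C' j.2) := fun a => by
    rw [γ, γConj, ← infeldInv_equivariant (𝔉.lorentz a), Finset.smul_sum]
    simp only [smul_smul]
  obtain ⟨B, B'⟩ := j
  simp only [h, ΓS, γS, γConjS, Matrix.sum_apply, Matrix.smul_apply, smul_add,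
    Finset.sum_add_distrib, Fintype.sum_prod_type, Fin.sum_univ_two]
  fin_cases B <;> fin_cases B' <;>
  · simp only [Fin.zero_eta, Fin.mk_one, if_true, if_false, zero_ne_one, one_ne_zero, smul_zero,
      add_zero, zero_add, Finset.smul_sum, smul_comm (infeldInv c _ _)]

theorem lie_sum_smul {S : Type*} [CommRing S] [Algebra ℂ S] (K : Fin 4 → Derivation ℂ S S)
    (c d : Fin 4 → ℂ) :
    ⁅∑ a, c a • K a, ∑ b, d b • K b⁆ = ∑ a, ∑ b, (c a * d b) • ⁅K a, K b⁆ := by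
  rw [sum_lie]
  refine Finset.sum_congr rfl fun a _ => ?_
  rw [lie_sum]
  refine Finset.sum_congr rfl fun b _ => ?_
  rw [smul_lie, lie_smul, smul_smul]

theorem HS_comm (i j : Fin 2 × Fin 2) : ⁅𝔉.HS i, 𝔉.HS j⁆ =
    ∑ k, (MvPolynomial.C (𝔉.ΓS i j k - 𝔉.ΓS j i k) : SpinPoly R) • 𝔉.HS k + ham (𝔉.QS i j) := by
  refine Derivation.ext fun f => ?_
  have h1 : ⁅𝔉.HS i, 𝔉.HS j⁆ f = ∑ a, ∑ b, (infeldInv a i.1 i.2 * infeldInv b j.1 j.2) •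
      (⁅𝔉.H a, 𝔉.H b⁆ f) := by
    rw [HS, HS, lie_sum_smul]
    simp only [derivation_sum_apply, Derivation.smul_apply]
  have h2 : ∀ i j : Fin 2 × Fin 2, ∑ a, ∑ b, (infeldInv a i.1 i.2 * infeldInv b j.1 j.2) •
      (∑ c, MvPolynomial.C (𝔉.Γ a b c) * 𝔉.H c f) =
      ∑ k, MvPolynomial.C (𝔉.ΓS i j k) * 𝔉.HS k f := by
    intro i j
    have h3 : ∀ c, ∑ a, ∑ b, (infeldInv a i.1 i.2 * infeldInv b j.1 j.2) •
        (MvPolynomial.C (𝔉.Γ a b c) * 𝔉.H c f) =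
        ∑ k : Fin 2 × Fin 2, infeldInv c k.1 k.2 • (MvPolynomial.C (𝔉.ΓS i j k) * 𝔉.H c f) := by
      intro c
      have := congrArg (fun r => (MvPolynomial.C r : SpinPoly R) * 𝔉.H c f)
        (𝔉.sum_infeldInv_Γ i j c)
      simpa only [map_sum, C_smul, Finset.sum_mul, smul_mul_assoc] using this
    simp only [Finset.smul_sum]
    rw [Finset.sum_congr rfl fun a _ => Finset.sum_comm, Finset.sum_comm,
      Finset.sum_congr rfl fun c _ => h3 c, Finset.sum_comm]
    simp only [HS, derivation_sum_apply, Derivation.smul_apply, Finset.mul_sum, mul_smul_comm]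
  rw [h1]
  simp only [𝔉.H_comm, Derivation.add_apply, derivation_sum_apply, Derivation.smul_apply,
    smul_eq_mul, smul_add, map_sub, sub_mul, Finset.sum_sub_distrib, smul_sub,
    Finset.sum_add_distrib, h2, QS, ham_sum, ham_smul]
  congr 2
  rw [← h2 j i, Finset.sum_comm]
  simp only [mul_comm]

theorem DS_comm (i j : Fin 2 × Fin 2) (f : R) : 𝔉.DS i (𝔉.DS j f) - 𝔉.DS j (𝔉.DS i f) =
    ∑ k, (𝔉.ΓS i j k - 𝔉.ΓS j i k) * 𝔉.DS k f := by
  have h := congrArg (fun D : Derivation ℂ (SpinPoly R) (SpinPoly R) => D (MvPolynomial.C f))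
    (𝔉.HS_comm i j)
  simp only [Derivation.commutator_apply, Derivation.add_apply, derivation_sum_apply,
    Derivation.smul_apply, smul_eq_mul, (𝔉.isSpinDeriv_HS _).map_C, ham_apply, xDeriv_C, mul_zero,
    sub_zero, add_zero, ← map_mul, ← map_sub, ← map_sum] at h
  exact MvPolynomial.C_injective _ _ h

theorem DS_indep (r : Fin 2 × Fin 2 → R) (h : ∀ f, ∑ k, r k * 𝔉.DS k f = 0) (k : Fin 2 × Fin 2) :
    r k = 0 := by
  have h1 := 𝔉.indep (fun a => ∑ k : Fin 2 × Fin 2, infeldInv a k.1 k.2 • r k) (fun f => by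
    rw [← h f]
    simp only [DS, derivation_sum_apply, Derivation.smul_apply, Finset.mul_sum, Finset.sum_mul]
    rw [Finset.sum_comm]
    simp only [mul_smul_comm, smul_mul_assoc])
  have hs : (Real.sqrt 2 : ℂ)⁻¹ ≠ 0 := by simp
  have h2 := fun a => congrArg (fun r => ((Real.sqrt 2 : ℂ)⁻¹)⁻¹ • r) (h1 a)
  simp only [infeldInv_eq, Fintype.sum_prod_type, Fin.sum_univ_two, smul_add, smul_smul,
    ← mul_assoc, inv_mul_cancel₀ hs, one_mul, smul_zero] at h2
  have e0 := h2 0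
  have e1 := h2 1
  -- The factor `I` clears that of the corresponding Pauli matrix, so that the sum and difference
  -- with `e1` isolate the off-diagonal coefficients.
  have e2 := congrArg (fun r => Complex.I • r) (h2 2)
  have e3 := h2 3
  simp only [pauli, smul_add, smul_smul] at e0 e1 e2 e3
  simp at e0 e1 e2 e3
  have k00 : r (0, 0) = 0 := eq_zero_of_eq_neg_self (by linear_combination e0 + e3)
  have k01 : r (0, 1) = 0 := eq_zero_of_eq_neg_self (by linear_combination e1 + e2)
  have k10 : r (1, 0) = 0 := eq_zero_of_eq_neg_self (by linear_combination e1 - e2)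
  have k11 : r (1, 1) = 0 := eq_zero_of_eq_neg_self (by linear_combination e0 - e3)
  obtain ⟨A, A'⟩ := k
  fin_cases A <;> fin_cases A' <;> assumption

theorem sum_pair_swap {α β γ δ S : Type*} [Fintype α] [Fintype β] [Fintype γ] [Fintype δ]
    [AddCommMonoid S] (f : α → β → γ → δ → S) :
    ∑ a, ∑ b, ∑ c, ∑ d, f a b c d = ∑ c, ∑ d, ∑ a, ∑ b, f a b c d := by
  have h : ∑ p : α × β, ∑ q : γ × δ, f p.1 p.2 q.1 q.2 = ∑ q : γ × δ, ∑ p : α × β, f p.1 p.2 q.1 q.2 :=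
    Finset.sum_comm
  simpa only [Fintype.sum_prod_type] using h

/-! ### The curvature spinors -/

/-- `R_{AA'BB'CC'DD'}`. -/
def spinRiem (A A' B B' C C' D D' : Fin 2) : R :=
  ∑ a, ∑ b, ∑ c, ∑ d, (infeldInv a A A' * infeldInv b B B' * infeldInv c C C' * infeldInv d D D')
    • 𝔉.riemLow a b c d

/-- `X_{ABCD}`. -/
def curvX (A B C D : Fin 2) : R :=
  (1 / 4 : ℂ) • ∑ E', ∑ G', ∑ F', ∑ H', (spinEps E' G' * spinEps F' H')
    • 𝔉.spinRiem A E' B G' C F' D H'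

/-- `Φ_{ABA'B'}`. -/
def ricci (A B A' B' : Fin 2) : R :=
  (1 / 4 : ℂ) • ∑ E', ∑ G', ∑ F, ∑ H, (spinEps E' G' * spinEps F H)
    • 𝔉.spinRiem A E' B G' F A' H B'

theorem spinRiem_pair_symm (A A' B B' C C' D D' : Fin 2) :
    𝔉.spinRiem A A' B B' C C' D D' = 𝔉.spinRiem C C' D D' A A' B B' := by
  rw [spinRiem, spinRiem, sum_pair_swap]
  refine Finset.sum_congr rfl fun _ _ => Finset.sum_congr rfl fun _ _ =>
    Finset.sum_congr rfl fun _ _ => Finset.sum_congr rfl fun _ _ => ?_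
  rw [riemLow_pair_symm]
  congr 1
  ring

theorem curvX_pair_symm (A B C D : Fin 2) : 𝔉.curvX A B C D = 𝔉.curvX C D A B := by
  have h : ∀ E' G' F' H', (spinEps E' G' * spinEps F' H') • 𝔉.spinRiem A E' B G' C F' D H' =
      (spinEps F' H' * spinEps E' G') • 𝔉.spinRiem C F' D H' A E' B G' := fun E' G' F' H' => by
    rw [spinRiem_pair_symm, mul_comm]
  rw [curvX, curvX, sum_pair_swap]
  simp only [h]

/-- The curvature `(1/2) R_{AA'BB'CF'D}{}^{F'}` acting on unprimed spinors. -/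
def PS (i j : Fin 2 × Fin 2) (C D : Fin 2) : R :=
  ∑ a, ∑ b, (infeldInv a i.1 i.2 * infeldInv b j.1 j.2) •
    ![-spinRep (𝔉.riem a b) 1 D, spinRep (𝔉.riem a b) 0 D] C

theorem sum_eps_spinRiem (A A' B B' C D : Fin 2) :
    ∑ F', ∑ H', spinEps F' H' • 𝔉.spinRiem A A' B B' C F' D H' =
      (2 : ℂ) • 𝔉.PS (A, A') (B, B') C D := by
  have h : ∀ a b, ∑ F', ∑ H', ∑ c, ∑ d, (spinEps F' H' * infeldInv c C F' * infeldInv d D H' *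
      (minkowskiDiag d : ℂ)) • 𝔉.riem a b c d = (2 : ℂ) •
      ![-spinRep (𝔉.riem a b) 1 D, spinRep (𝔉.riem a b) 0 D] C := fun a b =>
    sum_eps_infeldInv (𝔉.riem_lorentz a b) C D
  simp only [PS, Finset.smul_sum, smul_comm (2 : ℂ), ← h, spinRiem, smul_smul, riemLow]
  rw [sum_pair_swap]
  refine Finset.sum_congr rfl fun _ _ => Finset.sum_congr rfl fun _ _ =>
    Finset.sum_congr rfl fun _ _ => Finset.sum_congr rfl fun _ _ =>
    Finset.sum_congr rfl fun _ _ => Finset.sum_congr rfl fun _ _ => ?_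
  congr 1
  ring

theorem PS_symm (i j : Fin 2 × Fin 2) (C D : Fin 2) : 𝔉.PS i j C D = 𝔉.PS i j D C := by
  have h : ∀ a b, spinRep (𝔉.riem a b) 1 1 = -spinRep (𝔉.riem a b) 0 0 := fun a b => by
    obtain ⟨k00, k11, -, -⟩ := spinRep_components (𝔉.riem_lorentz a b)
    rw [k00, k11]
  fin_cases C <;> fin_cases D <;> simp [PS, h]

theorem curvX_eq (A B C D : Fin 2) : 𝔉.curvX A B C D =
    (1 / 2 : ℂ) • ∑ E', ∑ G', spinEps E' G' • 𝔉.PS (A, E') (B, G') C D := by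
  have h : ∀ E' G', 𝔉.PS (A, E') (B, G') C D = (1 / 2 : ℂ) •
      ∑ F', ∑ H', spinEps F' H' • 𝔉.spinRiem A E' B G' C F' D H' := fun E' G' => by
    rw [sum_eps_spinRiem, smul_smul]; norm_num
  simp only [h, curvX, Finset.smul_sum, smul_smul]
  refine Finset.sum_congr rfl fun _ _ => Finset.sum_congr rfl fun _ _ =>
    Finset.sum_congr rfl fun _ _ => Finset.sum_congr rfl fun _ _ => ?_
  congr 1
  ring

/-- Pair symmetry is needed here: the definition contracts primed indices in the first pair, whereas
`PS` comes from such a contraction in the last pair. -/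
theorem ricci_eq (A B A' B' : Fin 2) : 𝔉.ricci A B A' B' =
    (1 / 2 : ℂ) • ∑ F, ∑ H, spinEps F H • 𝔉.PS (F, A') (H, B') A B := by
  have h : ∀ F H, 𝔉.PS (F, A') (H, B') A B = (1 / 2 : ℂ) •
      ∑ E', ∑ G', spinEps E' G' • 𝔉.spinRiem A E' B G' F A' H B' := fun F H => by
    simp only [spinRiem_pair_symm 𝔉 A _ B _ F A' H B']
    rw [sum_eps_spinRiem, smul_smul]; norm_num
  simp only [h, ricci, Finset.smul_sum, smul_smul]
  simp only [Fin.sum_univ_two]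
  simp only [spinEps, Matrix.of_apply, Matrix.cons_val', Matrix.cons_val_zero, Matrix.cons_val_one,
    Matrix.cons_val_fin_one, mul_zero, zero_mul, zero_smul, add_zero, zero_add]
  module

theorem curvX_symm_right (A B C D : Fin 2) : 𝔉.curvX A B C D = 𝔉.curvX A B D C := by
  simp only [curvX_eq, 𝔉.PS_symm _ _ C D]

/-- Symmetry in the last two indices expresses trace-freeness of the curvature matrices; pair
symmetry transfers it to the first two. -/
theorem curvX_symm_left (A B C D : Fin 2) : 𝔉.curvX A B C D = 𝔉.curvX B A C D := by
  rw [curvX_pair_symm, curvX_symm_right, curvX_pair_symm]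

/-- The quadric `(1/2) φ_{CD} x^C x^D`. -/
def quad (φ : Fin 2 → Fin 2 → R) : SpinPoly R := (1 / 2 : ℂ) •
  ∑ C, ∑ D, MvPolynomial.C (φ C D) * (MvPolynomial.X C * MvPolynomial.X D)

theorem QS_eq (i j : Fin 2 × Fin 2) : 𝔉.QS i j = quad (𝔉.PS i j) := by
  have h : ∀ a b, spinRep (𝔉.riem a b) 1 1 = -spinRep (𝔉.riem a b) 0 0 := fun a b => by
    obtain ⟨k00, k11, -, -⟩ := spinRep_components (𝔉.riem_lorentz a b)
    rw [k00, k11]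
  have h2 : ∀ a b, matQuad (spinRep (𝔉.riem a b)) = quad (fun C D =>
      ![-spinRep (𝔉.riem a b) 1 D, spinRep (𝔉.riem a b) 0 D] C) := fun a b => by
    simp only [quad, matQuad, Fin.sum_univ_two, Matrix.cons_val_zero, Matrix.cons_val_one, h,
      neg_neg, map_neg, neg_mul]
    rw [mul_comm (MvPolynomial.X 1 : SpinPoly R) (MvPolynomial.X 0)]
    module
  simp only [QS, h2, quad, PS, map_sum, C_smul, Finset.sum_mul, Finset.smul_sum, smul_mul_assoc]
  rw [sum_pair_swap]
  refine Finset.sum_congr rfl fun _ _ => Finset.sum_congr rfl fun _ _ =>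
    Finset.sum_congr rfl fun _ _ => Finset.sum_congr rfl fun _ _ => ?_
  rw [smul_comm]

theorem QS_swap (i j : Fin 2 × Fin 2) : 𝔉.QS i j = -𝔉.QS j i := by
  have h : ∀ a b, matQuad (spinRep (𝔉.riem a b)) = -matQuad (spinRep (𝔉.riem b a)) := fun a b => by
    have : 𝔉.riem a b = fun c d => (-1 : R) * 𝔉.riem b a c d := by
      funext c d; rw [riem_swap]; ring
    have e : ∀ A B, spinRep (𝔉.riem a b) A B = -spinRep (𝔉.riem b a) A B := fun A B => by
      rw [this, spinRep_mul, neg_mul, one_mul]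
    simp only [matQuad, e, map_neg, neg_mul]
    module
  rw [QS, QS, Finset.sum_comm, ← Finset.sum_neg_distrib]
  refine Finset.sum_congr rfl fun a _ => ?_
  rw [← Finset.sum_neg_distrib]
  refine Finset.sum_congr rfl fun b _ => ?_
  rw [h, smul_neg, mul_comm]

/-- The curvature `□_{AB}` as a quadric. -/
def XS (A B : Fin 2) : SpinPoly R := quad (𝔉.curvX A B)

/-- The curvature `□_{A'B'}` as a quadric. -/
def ZS (A' B' : Fin 2) : SpinPoly R := quad (fun A B => 𝔉.ricci A B A' B')

theorem XS_eq (A B : Fin 2) : 𝔉.XS A B = (1 / 2 : ℂ) • (𝔉.QS (A, 0) (B, 1) - 𝔉.QS (A, 1) (B, 0)) := by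
  simp only [XS, QS_eq, quad, curvX_eq, Fin.sum_univ_two, spinEps, Matrix.of_apply, Matrix.cons_val',
    Matrix.cons_val_zero, Matrix.cons_val_one, Matrix.cons_val_fin_one, zero_smul, one_smul,
    zero_add, add_zero, C_smul, map_add, neg_smul, map_neg, add_mul, neg_mul, smul_mul_assoc]
  module

theorem ZS_eq (A' B' : Fin 2) :
    𝔉.ZS A' B' = (1 / 2 : ℂ) • (𝔉.QS (0, A') (1, B') - 𝔉.QS (1, A') (0, B')) := by
  simp only [ZS, QS_eq, quad, ricci_eq, Fin.sum_univ_two, spinEps, Matrix.of_apply, Matrix.cons_val',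
    Matrix.cons_val_zero, Matrix.cons_val_one, Matrix.cons_val_fin_one, zero_smul, one_smul,
    zero_add, add_zero, C_smul, map_add, neg_smul, map_neg, add_mul, neg_mul, smul_mul_assoc]
  module

end FrameAlgebra

/-! ### Recovering a quadric from its Hamiltonian field -/

section Quadrics

variable {R : Type*} [CommRing R] [Algebra ℂ R]

theorem xDeriv_eq_zero_of_ham_eq_zero {q : SpinPoly R} (h : ham q = 0) :
    xDeriv 0 q = 0 ∧ xDeriv 1 q = 0 := by
  have h0 := congrArg (fun D : Derivation ℂ (SpinPoly R) (SpinPoly R) => D (MvPolynomial.X 0)) h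
  have h1 := congrArg (fun D : Derivation ℂ (SpinPoly R) (SpinPoly R) => D (MvPolynomial.X 1)) h
  simp only [ham_apply, xDeriv_X_self, xDeriv_zero_X_one, xDeriv_one_X_zero,
    Derivation.zero_apply] at h0 h1
  exact ⟨by linear_combination h1, by linear_combination -h0⟩

theorem quad_euler (φ : Fin 2 → Fin 2 → R) :
    MvPolynomial.X 0 * xDeriv 0 (FrameAlgebra.quad φ) + MvPolynomial.X 1 * xDeriv 1 (FrameAlgebra.quad φ)
      = 2 * FrameAlgebra.quad φ := by
  simp only [FrameAlgebra.quad, Fin.sum_univ_two, Derivation.map_smul, map_add, Derivation.leibniz,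
    xDeriv_C, xDeriv_X_self, xDeriv_zero_X_one, xDeriv_one_X_zero, smul_eq_mul, mul_smul_comm]
  rw [← smul_add]
  congr 1
  ring

end Quadrics

/-! ### The Bianchi identity and its contraction -/

namespace FrameAlgebra

variable {R : Type*} [CommRing R] [Algebra ℂ R] (𝔉 : FrameAlgebra R)

/-- Second Bianchi identity, from Jacobi for the `HS i`. Hamiltonian fields kill constants, so
testing on constants and `DS_indep` removes the `HS` terms. The Hamiltonian field of the cyclic sum
then vanishes, and Euler's identity in degree two makes the sum itself zero. -/
theorem bianchi (i j k : Fin 2 × Fin 2) :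
    (𝔉.HS i (𝔉.QS j k) + ∑ m, MvPolynomial.C (𝔉.ΓS j k m - 𝔉.ΓS k j m) * 𝔉.QS i m)
      + (𝔉.HS j (𝔉.QS k i) + ∑ m, MvPolynomial.C (𝔉.ΓS k i m - 𝔉.ΓS i k m) * 𝔉.QS j m)
      + (𝔉.HS k (𝔉.QS i j) + ∑ m, MvPolynomial.C (𝔉.ΓS i j m - 𝔉.ΓS j i m) * 𝔉.QS k m) = 0 := by
  have h := jacobi_family (K := 𝔉.HS)
    (t := fun i j k => (MvPolynomial.C (𝔉.ΓS i j k - 𝔉.ΓS j i k) : SpinPoly R))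
    (V := fun i j => ham (𝔉.QS i j)) 𝔉.HS_comm i j k
  simp only [(𝔉.isSpinDeriv_HS _).map_C, (𝔉.isSpinDeriv_HS _).bracket_ham, ← map_mul, ← map_sum,
    ← map_add, ← ham_C_mul, ← ham_sum, ← ham_add] at h
  have h2 := 𝔉.DS_indep _ (fun f => by
    have := congrArg (fun D : Derivation ℂ (SpinPoly R) (SpinPoly R) => D (MvPolynomial.C f)) h
    simp only [derivation_sum_apply, Derivation.smul_apply, smul_eq_mul, Derivation.add_apply,
      Derivation.zero_apply, (𝔉.isSpinDeriv_HS _).map_C, ham_apply, xDeriv_C, mul_zero, sub_zero,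
      add_zero, ← map_mul, ← map_sum] at this
    exact (MvPolynomial.C_injective (Fin 2) R) (this.trans (map_zero _).symm))
  simp only [h2, map_zero, zero_smul, Finset.sum_const_zero, zero_add] at h
  obtain ⟨e0, e1⟩ := xDeriv_eq_zero_of_ham_eq_zero h
  have hE : ∀ i j, MvPolynomial.X 0 * xDeriv 0 (𝔉.QS i j) + MvPolynomial.X 1 * xDeriv 1 (𝔉.QS i j)
      = 2 * 𝔉.QS i j := fun i j => by rw [QS_eq]; exact quad_euler _
  have hE2 : ∀ i j k, MvPolynomial.X 0 * xDeriv 0 (𝔉.HS i (𝔉.QS j k)) +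
      MvPolynomial.X 1 * xDeriv 1 (𝔉.HS i (𝔉.QS j k)) = 2 * 𝔉.HS i (𝔉.QS j k) := fun i j k => by
    rw [(𝔉.isSpinDeriv_HS i).euler, hE, two_mul, two_mul, map_add]
  have hE3 : ∀ (i j k m : Fin 2 × Fin 2), MvPolynomial.X 0 * xDeriv 0 (MvPolynomial.C (𝔉.ΓS j k m - 𝔉.ΓS k j m) * 𝔉.QS i m) +
      MvPolynomial.X 1 * xDeriv 1 (MvPolynomial.C (𝔉.ΓS j k m - 𝔉.ΓS k j m) * 𝔉.QS i m)
      = 2 * (MvPolynomial.C (𝔉.ΓS j k m - 𝔉.ΓS k j m) * 𝔉.QS i m) := fun i j k m => by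
    simp only [Derivation.leibniz, xDeriv_C, smul_eq_mul]
    linear_combination MvPolynomial.C (𝔉.ΓS j k m - 𝔉.ΓS k j m) * hE i m
  refine eq_zero_of_eq_neg_self ?_
  simp only [map_add, map_sum] at e0 e1
  have key := congrArg₂ (fun p q : SpinPoly R => MvPolynomial.X 0 * p + MvPolynomial.X 1 * q) e0 e1
  simp only [mul_add, Finset.mul_sum] at key
  have s1 : ∀ i j k, ∑ m, MvPolynomial.X 0 * xDeriv 0 (MvPolynomial.C (𝔉.ΓS j k m - 𝔉.ΓS k j m) * 𝔉.QS i m) +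
      ∑ m, MvPolynomial.X 1 * xDeriv 1 (MvPolynomial.C (𝔉.ΓS j k m - 𝔉.ΓS k j m) * 𝔉.QS i m)
      = 2 * ∑ m, (MvPolynomial.C (𝔉.ΓS j k m - 𝔉.ΓS k j m) * 𝔉.QS i m) := fun i j k => by
    rw [← Finset.sum_add_distrib, Finset.mul_sum]
    exact Finset.sum_congr rfl fun m _ => hE3 i j k m
  linear_combination key - hE2 i j k - hE2 j k i - hE2 k i j - s1 i j k - s1 j k i - s1 k i j

theorem γS_trace (i : Fin 2 × Fin 2) : 𝔉.γS i 0 0 + 𝔉.γS i 1 1 = 0 := (𝔉.isSpinDeriv_HS i).trace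

theorem γConjS_trace (i : Fin 2 × Fin 2) : 𝔉.γConjS i 0 0 + 𝔉.γConjS i 1 1 = 0 := by
  have h : ∀ a, 𝔉.γConj a 0 0 + 𝔉.γConj a 1 1 = 0 := fun a => by
    obtain ⟨h00, h11, -, -⟩ := spinRepConj_components (𝔉.lorentz a)
    simp only [γConj, h00, h11]; abel
  simp only [γConjS, Matrix.sum_apply, Matrix.smul_apply, ← Finset.sum_add_distrib, ← smul_add, h,
    smul_zero, Finset.sum_const_zero]

theorem XS_symm (A B : Fin 2) : 𝔉.XS A B = 𝔉.XS B A := by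
  have h : 𝔉.curvX A B = 𝔉.curvX B A := by
    funext C D; exact 𝔉.curvX_symm_left A B C D
  rw [XS, XS, h]

theorem QS_self (i : Fin 2 × Fin 2) : 𝔉.QS i i = 0 := eq_zero_of_eq_neg_self (𝔉.QS_swap i i)

/-- If the Ricci spinor vanishes, the curvature quadrics are given by `X_{ABCD}`. -/
theorem QS_values (hZ : ∀ A' B', 𝔉.ZS A' B' = 0) :
    𝔉.QS (0, 0) (1, 0) = 0 ∧ 𝔉.QS (0, 1) (1, 1) = 0 ∧ 𝔉.QS (0, 0) (0, 1) = 𝔉.XS 0 0 ∧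
      𝔉.QS (1, 0) (1, 1) = 𝔉.XS 1 1 ∧ 𝔉.QS (0, 0) (1, 1) = 𝔉.XS 0 1 ∧
      𝔉.QS (0, 1) (1, 0) = -𝔉.XS 0 1 := by
  -- The claims amount to `Q_{AA'BB'} = ε_{A'B'} X_{AB}`: the other irreducible part, `ε_{AB}
  -- Φ_{A'B'}`, is absent.
  have z := fun A' B' => (𝔉.ZS_eq A' B').symm.trans (hZ A' B')
  have x := fun A B => 𝔉.XS_eq A B
  have half : ∀ p : SpinPoly R, (1 / 2 : ℂ) • p + (1 / 2 : ℂ) • p = p := fun p => by module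
  refine ⟨?_, ?_, ?_, ?_, ?_, ?_⟩
  · have := z 0 0
    rw [𝔉.QS_swap (1, 0), sub_neg_eq_add, smul_add, half] at this
    exact this
  · have := z 1 1
    rw [𝔉.QS_swap (1, 1), sub_neg_eq_add, smul_add, half] at this
    exact this
  · rw [x, 𝔉.QS_swap (0, 1), sub_neg_eq_add, smul_add, half]
  · rw [x, 𝔉.QS_swap (1, 1), sub_neg_eq_add, smul_add, half]
  · have := z 0 1
    rw [𝔉.QS_swap (1, 0), sub_neg_eq_add, smul_add] at this
    rw [x, smul_sub]
    linear_combination (this - half (𝔉.QS (0, 0) (1, 1)))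
  · have := z 0 1
    rw [𝔉.QS_swap (1, 0), sub_neg_eq_add, smul_add] at this
    rw [x, smul_sub]
    linear_combination (this - half (𝔉.QS (0, 1) (1, 0)))

/-- `∇_i X_{AB}`, as a quadric. -/
def nablaX (i : Fin 2 × Fin 2) (A B : Fin 2) : SpinPoly R :=
  𝔉.HS i (𝔉.XS A B) - ∑ C, MvPolynomial.C (𝔉.γS i C A) * 𝔉.XS C B
    - ∑ C, MvPolynomial.C (𝔉.γS i C B) * 𝔉.XS A C

/-- Each case is the Bianchi identity for three distinct index pairs, two of them with equal primed
index. The connection terms in the primed indices combine by trace-freeness of the conjugate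
connection. -/
theorem nablaX_curl (hZ : ∀ A' B', 𝔉.ZS A' B' = 0) (A' C : Fin 2) :
    𝔉.nablaX (0, A') 1 C = 𝔉.nablaX (1, A') 0 C := by
  obtain ⟨q1, q2, q3, q4, q5, q6⟩ := 𝔉.QS_values hZ
  have r1 := (𝔉.QS_swap (1, 0) (0, 0)).trans (congrArg Neg.neg q1)
  have r2 := (𝔉.QS_swap (1, 1) (0, 1)).trans (congrArg Neg.neg q2)
  have r3 := (𝔉.QS_swap (0, 1) (0, 0)).trans (congrArg Neg.neg q3)
  have r4 := (𝔉.QS_swap (1, 1) (1, 0)).trans (congrArg Neg.neg q4)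
  have r5 := (𝔉.QS_swap (1, 1) (0, 0)).trans (congrArg Neg.neg q5)
  have r6 := (𝔉.QS_swap (1, 0) (0, 1)).trans (congrArg Neg.neg q6)
  have t := fun i => congrArg (MvPolynomial.C : R → SpinPoly R) (𝔉.γS_trace i)
  have t' := fun i => congrArg (MvPolynomial.C : R → SpinPoly R) (𝔉.γConjS_trace i)
  simp only [map_add, map_zero] at t t'
  have b : ∀ j k : Fin 2 × Fin 2, ∀ i, _ := fun j k i => 𝔉.bianchi i j k
  simp only [ΓS, Fintype.sum_prod_type, Fin.sum_univ_two] at b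
  have s := 𝔉.XS_symm 1 0
  have b1 := b (1, 0) (0, 1) (0, 0)
  have b2 := b (1, 0) (1, 1) (0, 0)
  have b3 := b (1, 1) (0, 0) (0, 1)
  have b4 := b (1, 1) (1, 0) (0, 1)
  clear b
  simp only [QS_self, q1, q2, q3, q4, q5, q6, r1, r2, r3, r4, r5, r6, if_true, zero_ne_one,
    one_ne_zero, if_false, map_neg, map_zero, map_sub, map_add, add_zero, zero_add, neg_zero,
    neg_neg, mul_zero] at b1 b2 b3 b4
  fin_cases A' <;> fin_cases C <;>
  simp only [nablaX, Fin.sum_univ_two, Fin.zero_eta, Fin.mk_one, s]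
  · linear_combination b1 - 𝔉.XS 0 0 * t' (1, 0) + 𝔉.XS 0 1 * t' (0, 0)
  · linear_combination b2 - 𝔉.XS 0 1 * t' (1, 0) + 𝔉.XS 1 1 * t' (0, 0)
  · linear_combination -b3 - 𝔉.XS 0 0 * t' (1, 1) + 𝔉.XS 0 1 * t' (0, 1)
  · linear_combination -b4 - 𝔉.XS 0 1 * t' (1, 1) + 𝔉.XS 1 1 * t' (0, 1)

end FrameAlgebra

/-! ### The Weyl quartic and the integrability of the twistor equation -/

namespace FrameAlgebra

open MvPolynomial

variable {R : Type*} [CommRing R] [Algebra ℂ R] (𝔉 : FrameAlgebra R)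

/-- The quartic `x^A x^B X_{AB}`, which is `(1/2) Ψ_{ABCD} x^A x^B x^C x^D`. -/
def weylPoly : SpinPoly R := X 0 * X 0 * 𝔉.XS 0 0 + 2 * (X 0 * X 1 * 𝔉.XS 0 1) + X 1 * X 1 * 𝔉.XS 1 1

theorem half_add_half (p : SpinPoly R) : (1 / 2 : ℂ) • (p + p) = p := by module

theorem xDeriv_XS (A B : Fin 2) :
    xDeriv 0 (𝔉.XS A B) = C (𝔉.curvX A B 0 0) * X 0 + C (𝔉.curvX A B 0 1) * X 1 ∧
      xDeriv 1 (𝔉.XS A B) = C (𝔉.curvX A B 0 1) * X 0 + C (𝔉.curvX A B 1 1) * X 1 := by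
  have h := 𝔉.curvX_symm_right A B 1 0
  constructor <;>
  · simp only [XS, quad, Fin.sum_univ_two, Derivation.map_smul, map_add, Derivation.leibniz,
      xDeriv_C, xDeriv_X_self, xDeriv_zero_X_one, xDeriv_one_X_zero, smul_eq_mul, h]
    refine Eq.trans ?_ (half_add_half _)
    congr 1
    ring

theorem two_mul_XS (A B : Fin 2) : 2 * 𝔉.XS A B = C (𝔉.curvX A B 0 0) * (X 0 * X 0)
    + 2 * (C (𝔉.curvX A B 0 1) * (X 0 * X 1)) + C (𝔉.curvX A B 1 1) * (X 1 * X 1) := by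
  rw [XS, ← quad_euler, ← XS, (𝔉.xDeriv_XS A B).1, (𝔉.xDeriv_XS A B).2]
  ring

/-- Both sides equal `x^A x^B x^D X_{ABCD}`, read through the first or the last index pair; this is
pair symmetry. -/
theorem quadratic_xDeriv_XS :
    X 0 * X 0 * xDeriv 0 (𝔉.XS 0 0) + 2 * (X 0 * X 1 * xDeriv 0 (𝔉.XS 0 1))
        + X 1 * X 1 * xDeriv 0 (𝔉.XS 1 1) = 2 * (X 0 * 𝔉.XS 0 0 + X 1 * 𝔉.XS 0 1) ∧
      X 0 * X 0 * xDeriv 1 (𝔉.XS 0 0) + 2 * (X 0 * X 1 * xDeriv 1 (𝔉.XS 0 1))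
        + X 1 * X 1 * xDeriv 1 (𝔉.XS 1 1) = 2 * (X 0 * 𝔉.XS 0 1 + X 1 * 𝔉.XS 1 1) := by
  have h1 := 𝔉.curvX_pair_symm 0 1 0 0
  have h2 := 𝔉.curvX_pair_symm 1 1 0 0
  have h3 := 𝔉.curvX_pair_symm 1 1 0 1
  simp only [fun A B => (𝔉.xDeriv_XS A B).1, fun A B => (𝔉.xDeriv_XS A B).2]
  have k00 := 𝔉.two_mul_XS 0 0
  have k01 := 𝔉.two_mul_XS 0 1
  have k11 := 𝔉.two_mul_XS 1 1
  rw [h1] at k01 ⊢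
  rw [h2, h3] at k11 ⊢
  exact ⟨by linear_combination -X 0 * k00 - X 1 * k01, by linear_combination -X 0 * k01 - X 1 * k11⟩

theorem xDeriv_zero_weylPoly : xDeriv 0 𝔉.weylPoly = 4 * (X 0 * 𝔉.XS 0 0 + X 1 * 𝔉.XS 0 1) := by
  have h := 𝔉.quadratic_xDeriv_XS.1
  rw [weylPoly, two_mul]
  simp only [map_add, Derivation.leibniz, xDeriv_X_self, xDeriv_zero_X_one, smul_eq_mul]
  linear_combination h

theorem xDeriv_one_weylPoly : xDeriv 1 𝔉.weylPoly = 4 * (X 0 * 𝔉.XS 0 1 + X 1 * 𝔉.XS 1 1) := by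
  have h := 𝔉.quadratic_xDeriv_XS.2
  rw [weylPoly, two_mul]
  simp only [map_add, Derivation.leibniz, xDeriv_X_self, xDeriv_one_X_zero, smul_eq_mul]
  linear_combination h

/-- The contracted Bianchi identity when the Ricci spinor vanishes. -/
theorem weylPoly_curl (hZ : ∀ A' B', 𝔉.ZS A' B' = 0) (A' : Fin 2) :
    xDeriv 1 (𝔉.HS (0, A') 𝔉.weylPoly) = xDeriv 0 (𝔉.HS (1, A') 𝔉.weylPoly) := by
  have n0 := 𝔉.nablaX_curl hZ A' 0
  have n1 := 𝔉.nablaX_curl hZ A' 1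
  have t := fun i => congrArg (C : R → SpinPoly R) (𝔉.γS_trace i)
  simp only [map_add, map_zero] at t
  have s := 𝔉.XS_symm 1 0
  simp only [nablaX, Fin.sum_univ_two, s] at n0 n1
  have h4 : ∀ i p, 𝔉.HS i (4 * p) = 4 * 𝔉.HS i p := fun i p => by
    rw [show (4 : SpinPoly R) * p = p + p + p + p by ring]
    simp only [map_add]; ring
  simp only [(𝔉.isSpinDeriv_HS _).xDeriv_apply, Fin.sum_univ_two, xDeriv_zero_weylPoly,
    xDeriv_one_weylPoly, h4, map_add, Derivation.leibniz, (𝔉.isSpinDeriv_HS _).map_X, smul_eq_mul]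
  linear_combination 4 * X 0 * n0 + 4 * X 1 * n1

/-- The twistor operator `x^A ∇_{AA'}` on polynomials. -/
def twist (A' : Fin 2) : Derivation ℂ (SpinPoly R) (SpinPoly R) :=
  (X 0 : SpinPoly R) • 𝔉.HS (0, A') + (X 1 : SpinPoly R) • 𝔉.HS (1, A')

theorem twist_apply (A' : Fin 2) (f : SpinPoly R) :
    𝔉.twist A' f = X 0 * 𝔉.HS (0, A') f + X 1 * 𝔉.HS (1, A') f := rfl

/-- The integrability condition `{Ψ, L} = 0` of the twistor equation. -/
theorem ham_weylPoly_eq_zero {L : SpinPoly R} (hL : ∀ A', 𝔉.twist A' L = 0) :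
    ham 𝔉.weylPoly L = 0 := by
  have h0 := hL 0
  have h1 := hL 1
  rw [twist_apply] at h0 h1
  have e0 := congrArg (𝔉.twist 0) h1
  have e1 := congrArg (𝔉.twist 1) h0
  have c := fun i j => congrArg (fun D : Derivation ℂ (SpinPoly R) (SpinPoly R) => D L) (𝔉.HS_comm i j)
  have c1 := c (0, 0) (0, 1)
  have c2 := c (0, 0) (1, 1)
  have c3 := c (1, 0) (0, 1)
  have c4 := c (1, 0) (1, 1)
  clear c
  simp only [Derivation.commutator_apply, Derivation.add_apply, Derivation.smul_apply,
    smul_eq_mul, Fintype.sum_prod_type, Fin.sum_univ_two, ΓS, if_true, zero_ne_one, one_ne_zero, if_false,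
    map_sub, map_add, map_zero, add_zero, zero_add] at c1 c2 c3 c4
  simp only [twist_apply, map_add, map_zero, Derivation.leibniz, (𝔉.isSpinDeriv_HS _).map_X, smul_eq_mul,
    Fin.sum_univ_two] at e0 e1
  have x00 := 𝔉.XS_eq 0 0
  have x01 := congrArg (fun p : SpinPoly R => p + p) (𝔉.XS_eq 0 1)
  have x11 := 𝔉.XS_eq 1 1
  simp only [ham_apply] at c1 c2 c3 c4
  rw [𝔉.QS_swap (0, 1) (0, 0), sub_neg_eq_add, half_add_half] at x00
  rw [𝔉.QS_swap (1, 1) (1, 0), sub_neg_eq_add, half_add_half] at x11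
  rw [𝔉.QS_swap (0, 1) (1, 0), sub_neg_eq_add] at x01
  simp only [← smul_add, half_add_half] at x01
  have y0 := congrArg (xDeriv 0) x01
  have y1 := congrArg (xDeriv 1) x01
  simp only [map_add] at y0 y1
  rw [ham_apply, xDeriv_zero_weylPoly, xDeriv_one_weylPoly]
  obtain ⟨q0, q1⟩ := 𝔉.quadratic_xDeriv_XS
  rw [← x00] at c1
  rw [← x11] at c4
  -- The primed connection terms multiply the twistor equations `h0`, `h1`; the unprimed ones
  -- cancel.
  linear_combination 2 * xDeriv 0 L * q1 - 2 * xDeriv 1 L * q0 + 2 * (e0 - e1)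
    - 2 * (X 0 * X 0 * c1 + X 0 * X 1 * (c2 + c3) + X 1 * X 1 * c4)
    - 2 * (X 0 * C (𝔉.γConjS (0, 0) 0 1) + X 1 * C (𝔉.γConjS (1, 0) 0 1)
      - X 0 * C (𝔉.γConjS (0, 1) 0 0) - X 1 * C (𝔉.γConjS (1, 1) 0 0)) * h0
    - 2 * (X 0 * C (𝔉.γConjS (0, 0) 1 1) + X 1 * C (𝔉.γConjS (1, 0) 1 1)
      - X 0 * C (𝔉.γConjS (0, 1) 1 0) - X 1 * C (𝔉.γConjS (1, 1) 1 0)) * h1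
    + 2 * X 0 * X 1 * (xDeriv 1 L * y0 - xDeriv 0 L * y1)

end FrameAlgebra

/-! ### Prolongation of the twistor equation when the Ricci spinor vanishes -/

namespace FrameAlgebra

open MvPolynomial

variable {R : Type*} [CommRing R] [Algebra ℂ R] (𝔉 : FrameAlgebra R)

/-- The variables with lowered index, `y_A = x_A`. -/
def lowX (A : Fin 2) : SpinPoly R := ![-X 1, X 0] A

/-- The linear form `θ_{AA'} x^A`. -/
def linForm (θ : Fin 2 × Fin 2 → R) (A' : Fin 2) : SpinPoly R :=
  C (θ (0, A')) * X 0 + C (θ (1, A')) * X 1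

/-- `∇_{AA'} θ_{BB'}`. -/
def nablaForm (θ : Fin 2 × Fin 2 → R) (i j : Fin 2 × Fin 2) : R :=
  𝔉.DS i (θ j) - ∑ k, 𝔉.ΓS i j k * θ k

theorem xDeriv_linForm (θ : Fin 2 × Fin 2 → R) (A' : Fin 2) :
    xDeriv 0 (linForm θ A') = C (θ (0, A')) ∧ xDeriv 1 (linForm θ A') = C (θ (1, A')) := by
  constructor <;> simp [linForm, Derivation.leibniz]

theorem HS_lowX (i : Fin 2 × Fin 2) (B : Fin 2) :
    𝔉.HS i (lowX B) = ∑ D, C (𝔉.γS i D B) * lowX D := by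
  have t := congrArg (C : R → SpinPoly R) (𝔉.γS_trace i)
  simp only [map_add, map_zero] at t
  fin_cases B <;>
  simp only [lowX, Fin.zero_eta, Fin.mk_one, Matrix.cons_val_zero, Matrix.cons_val_one, map_neg,
    (𝔉.isSpinDeriv_HS _).map_X, Fin.sum_univ_two]
  · linear_combination X 1 * t
  · linear_combination -X 0 * t

theorem HS_linForm (θ : Fin 2 × Fin 2 → R) (i : Fin 2 × Fin 2) (B' : Fin 2) :
    𝔉.HS i (linForm θ B') = linForm (𝔉.nablaForm θ i) B'
      + ∑ D', C (𝔉.γConjS i D' B') * linForm θ D' := by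
  fin_cases B' <;>
  · simp only [linForm, nablaForm, ΓS, Fin.zero_eta, Fin.mk_one, map_add, map_sub, map_mul, Derivation.leibniz,
      (𝔉.isSpinDeriv_HS _).map_X, (𝔉.isSpinDeriv_HS _).map_C, Fin.sum_univ_two, smul_eq_mul, Fintype.sum_prod_type,
      if_true, zero_ne_one, one_ne_zero, if_false, map_zero, zero_add, add_zero]
    ring

theorem ham_linForm_lowX (θ : Fin 2 × Fin 2 → R) (A B' : Fin 2) :
    ham (linForm θ B') (lowX A) = -C (θ (A, B')) := by
  obtain ⟨h0, h1⟩ := xDeriv_linForm θ B'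
  rw [ham_apply, h0, h1]
  fin_cases A <;> simp [lowX]

/-- The equation is differentiated once and substituted for the first derivatives that appear; `25`
clears the two factors `5`. In the commutator the last term drops out, because Hamiltonian fields of
linear forms have constant coefficients in the variables and commute. -/
theorem HS_HS_of_prolonged {L : SpinPoly R} {θ : Fin 2 × Fin 2 → R}
    (hH : ∀ A A', 5 * 𝔉.HS (A, A') L = lowX A * ham (linForm θ A') L) (A A' B B' : Fin 2) :
    25 * 𝔉.HS (A, A') (𝔉.HS (B, B') L) =
      25 * ∑ k, C (𝔉.ΓS (A, A') (B, B') k) * 𝔉.HS k L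
      + 5 * (lowX B * ham (linForm (𝔉.nablaForm θ (A, A')) B') L)
      - lowX B * (C (θ (A, B')) * ham (linForm θ A') L)
      + lowX A * lowX B * ham (linForm θ B') (ham (linForm θ A') L) := by
  have h5 : ∀ (D : Derivation ℂ (SpinPoly R) (SpinPoly R)) p, D (5 * p) = 5 * D p := fun D p => by
    rw [show (5 : SpinPoly R) * p = p + p + p + p + p by ring]
    simp only [map_add]; ring
  have e1 := congrArg (𝔉.HS (A, A')) (hH B B')
  rw [h5, Derivation.leibniz, (𝔉.isSpinDeriv_HS _).map_ham, HS_linForm, HS_lowX, ham_add, ham_sum] at e1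
  simp only [ham_C_mul, Derivation.add_apply, derivation_sum_apply, Derivation.smul_apply,
    smul_eq_mul] at e1
  have e2 := congrArg (ham (linForm θ B')) (hH A A')
  rw [h5, Derivation.leibniz, ham_linForm_lowX, smul_eq_mul, smul_eq_mul] at e2
  have e3 : 5 * ∑ k, C (𝔉.ΓS (A, A') (B, B') k) * 𝔉.HS k L =
      (∑ D, C (𝔉.γS (A, A') D B) * lowX D) * ham (linForm θ B') L
      + lowX B * ∑ D', C (𝔉.γConjS (A, A') D' B') * ham (linForm θ D') L := by
    have : ∀ k : Fin 2 × Fin 2, 5 * (C (𝔉.ΓS (A, A') (B, B') k) * 𝔉.HS k L) =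
        C (𝔉.ΓS (A, A') (B, B') k) * (lowX k.1 * ham (linForm θ k.2) L) := fun k => by
      rw [← hH k.1 k.2]; ring
    rw [Finset.mul_sum]
    simp only [this]
    simp only [ΓS, Fintype.sum_prod_type, Fin.sum_univ_two]
    fin_cases B <;> fin_cases B' <;>
    · simp only [Fin.zero_eta, Fin.mk_one, if_true, zero_ne_one, one_ne_zero, if_false, map_zero, map_add,
        zero_add, add_zero]
      ring
  linear_combination 5 * e1 + lowX B * e2 - 5 * e3

/-- The integrability conditions of the prolonged twistor equation. -/
theorem ham_QS_of_prolonged {L : SpinPoly R} {θ : Fin 2 × Fin 2 → R}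
    (hH : ∀ A A', 5 * 𝔉.HS (A, A') L = lowX A * ham (linForm θ A') L) (A A' B B' : Fin 2) :
    25 * ham (𝔉.QS (A, A') (B, B')) L =
      5 * (lowX B * ham (linForm (𝔉.nablaForm θ (A, A')) B') L)
      - 5 * (lowX A * ham (linForm (𝔉.nablaForm θ (B, B')) A') L)
      - lowX B * (C (θ (A, B')) * ham (linForm θ A') L)
      + lowX A * (C (θ (B, A')) * ham (linForm θ B') L) := by
  have h1 := 𝔉.HS_HS_of_prolonged hH A A' B B'
  have h2 := 𝔉.HS_HS_of_prolonged hH B B' A A'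
  have h3 := congrArg (fun D : Derivation ℂ (SpinPoly R) (SpinPoly R) => D L) (𝔉.HS_comm (A, A') (B, B'))
  simp only [Derivation.commutator_apply, Derivation.add_apply, derivation_sum_apply,
    Derivation.smul_apply, smul_eq_mul, map_sub, sub_mul, Finset.sum_sub_distrib] at h3
  have h4 : ham (linForm θ B') (ham (linForm θ A') L) = ham (linForm θ A') (ham (linForm θ B') L) := by
    have hx := xDeriv_comm L
    simp only [ham_apply, (xDeriv_linForm θ _).1, (xDeriv_linForm θ _).2, map_sub, Derivation.leibniz,
      xDeriv_C, smul_eq_mul, mul_zero]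
    linear_combination (C (θ (1, A')) * C (θ (0, B')) - C (θ (0, A')) * C (θ (1, B'))) * hx
  linear_combination h1 - h2 - 25 * h3 + lowX A * lowX B * h4

/-- As `c` is the inverse of `b`, the form is `d log b`; it is closed and the connection has no
torsion. -/
theorem nablaForm_log_symm {b c : R} (hb : c * b = 1) (i j : Fin 2 × Fin 2) :
    𝔉.nablaForm (fun i => c * 𝔉.DS i b) i j = 𝔉.nablaForm (fun i => c * 𝔉.DS i b) j i := by
  have h := 𝔉.DS_comm i j b
  have hc : ∀ i, 𝔉.DS i c = -(c * c * 𝔉.DS i b) := fun i => by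
    have := congrArg (𝔉.DS i) hb
    rw [Derivation.leibniz, Derivation.map_one_eq_zero, smul_eq_mul, smul_eq_mul] at this
    linear_combination c * this - 𝔉.DS i c * hb
  have h2 : c * ∑ k, (𝔉.ΓS i j k - 𝔉.ΓS j i k) * 𝔉.DS k b =
      ∑ k, 𝔉.ΓS i j k * (c * 𝔉.DS k b) - ∑ k, 𝔉.ΓS j i k * (c * 𝔉.DS k b) := by
    rw [Finset.mul_sum, ← Finset.sum_sub_distrib]
    exact Finset.sum_congr rfl fun k _ => by ring
  simp only [nablaForm, Derivation.leibniz, hc, smul_eq_mul]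
  linear_combination c * h + h2

/-- Prolongation of the twistor equation for a quartic proportional to the Weyl spinor. -/
theorem prolonged_of_twist {L : SpinPoly R} (hE : X 0 * xDeriv 0 L + X 1 * xDeriv 1 L = 4 * L)
    (hL : ∀ A', 𝔉.twist A' L = 0) (hZ : ∀ A' B', 𝔉.ZS A' B' = 0) {b c : R} (hb : c * b = 1)
    (hΨ : 𝔉.weylPoly = C b * L) (A A' : Fin 2) :
    5 * 𝔉.HS (A, A') L = lowX A * ham (linForm (fun i => c * 𝔉.DS i b) A') L := by
  have h := hL A'
  rw [twist_apply] at h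
  -- With `h_A = ∇_{AA'} L`, differentiating `x^A h_A = 0` and using Euler's identity gives `5 h_B =
  -- x^A (∂_A h_B - ∂_B h_A)`, where `5 = 1 + 4`. What remains unknown is the curl, supplied by the
  -- Bianchi identity.
  have d0 := congrArg (xDeriv 0) h
  have d1 := congrArg (xDeriv 1) h
  simp only [map_add, map_zero, Derivation.leibniz, xDeriv_X_self, xDeriv_zero_X_one,
    xDeriv_one_X_zero, smul_eq_mul] at d0 d1
  have h4 : ∀ i, 𝔉.HS i (4 * L) = 4 * 𝔉.HS i L := fun i => by
    rw [show (4 : SpinPoly R) * L = L + L + L + L by ring]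
    simp only [map_add]; ring
  have e0 := (𝔉.isSpinDeriv_HS (0, A')).euler L
  have e1 := (𝔉.isSpinDeriv_HS (1, A')).euler L
  rw [hE, h4] at e0 e1
  -- For `Ψ = b L` the identity expresses `b` times the curl of `∇L` by a bracket of `db` with `L`.
  have k := 𝔉.weylPoly_curl hZ A'
  simp only [hΨ, map_add, Derivation.leibniz, (𝔉.isSpinDeriv_HS _).map_C, smul_eq_mul, xDeriv_C] at k
  have hb' := congrArg (C : R → SpinPoly R) hb
  rw [map_mul, map_one] at hb'
  rw [ham_apply, (xDeriv_linForm _ A').1, (xDeriv_linForm _ A').2, map_mul, map_mul]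
  fin_cases A <;> simp only [lowX, Fin.zero_eta, Fin.mk_one, Matrix.cons_val_zero, Matrix.cons_val_one]
  · linear_combination d0 - e0 + X 1 * C c * k
      - X 1 * (xDeriv 1 (𝔉.HS (0, A') L) - xDeriv 0 (𝔉.HS (1, A') L)) * hb'
  · linear_combination d1 - e1 - X 0 * C c * k
      + X 0 * (xDeriv 1 (𝔉.HS (0, A') L) - xDeriv 0 (𝔉.HS (1, A') L)) * hb'

theorem ham_quadric (a b c : R) (L : SpinPoly R) :
    ham (C a * (X 0 * X 0) + C b * (X 0 * X 1) + C c * (X 1 * X 1)) L =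
      (2 * (C a * X 0) + C b * X 1) * xDeriv 1 L - (C b * X 0 + 2 * (C c * X 1)) * xDeriv 0 L := by
  simp only [ham_apply, map_add, Derivation.leibniz, xDeriv_C, xDeriv_X_self, xDeriv_zero_X_one,
    xDeriv_one_X_zero, smul_eq_mul]
  ring

/-- If the Ricci spinor vanishes and the Weyl spinor is proportional to a twistor quartic that has no
infinitesimal symmetries, then the Weyl spinor vanishes. -/
theorem weylPoly_eq_zero {L : SpinPoly R} (hE : X 0 * xDeriv 0 L + X 1 * xDeriv 1 L = 4 * L)
    (hL : ∀ A', 𝔉.twist A' L = 0) (hZ : ∀ A' B', 𝔉.ZS A' B' = 0) {b c : R} (hb : c * b = 1)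
    (hΨ : 𝔉.weylPoly = C b * L)
    (hN : ∀ a₀ a₁ a₂ : R, ham (C a₀ * (X 0 * X 0) + C a₁ * (X 0 * X 1) + C a₂ * (X 1 * X 1)) L = 0 →
      a₀ = 0 ∧ a₁ = 0 ∧ a₂ = 0) : 𝔉.weylPoly = 0 := by
  have hH := 𝔉.prolonged_of_twist hE hL hZ hb hΨ
  have hW := 𝔉.nablaForm_log_symm hb
  generalize (fun i => c * 𝔉.DS i b) = θ at hH hW
  have hI := 𝔉.ham_QS_of_prolonged hH
  generalize 𝔉.nablaForm θ = W at hW hI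
  obtain ⟨q1, q2, q3, q4, q5, q6⟩ := 𝔉.QS_values hZ
  have i1 := hI 0 0 0 1
  have i2 := hI 1 0 1 1
  have i3 := hI 0 0 1 1
  have i4 := hI 0 1 1 0
  clear hI
  rw [q3] at i1
  rw [q4] at i2
  rw [q5] at i3
  rw [q6] at i4
  simp only [ham_apply, (xDeriv_linForm _ _).1, (xDeriv_linForm _ _).2, lowX, Matrix.cons_val_zero,
    Matrix.cons_val_one, map_neg, hW (0, 1) (0, 0), hW (1, 1) (0, 0), hW (0, 1) (1, 0),
    hW (1, 1) (1, 0), (𝔉.xDeriv_XS _ _).1, (𝔉.xDeriv_XS _ _).2] at i1 i2 i3 i4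
  -- The scalar to which the right-hand sides collapse once `∇θ` is symmetric: each condition
  -- becomes `50 {X_{AB}, L} = -m {x_A x_B, L}`. As `L` has no infinitesimal symmetry, `50 X_{AB} =
  -- -m x_A x_B`.
  set m : R := 5 * (W (0, 0) (1, 1) - W (1, 0) (0, 1)) + (θ (0, 0) * θ (1, 1) - θ (0, 1) * θ (1, 0))
    with hm
  have hm' : (C m : SpinPoly R) = 5 * (C (W (0, 0) (1, 1)) - C (W (1, 0) (0, 1)))
      + (C (θ (0, 0)) * C (θ (1, 1)) - C (θ (0, 1)) * C (θ (1, 0))) := by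
    simp only [hm, map_add, map_sub, map_mul, map_ofNat]
  have x00 : 50 * 𝔉.XS 0 0 = -(C m * (X 1 * X 1)) := by
    obtain ⟨a1, a2, a3⟩ := hN (25 * 𝔉.curvX 0 0 0 0) (50 * 𝔉.curvX 0 0 0 1)
      (25 * 𝔉.curvX 0 0 1 1 + m) (by
        rw [ham_quadric]
        simp only [map_add, map_mul, map_ofNat, hm']
        linear_combination 2 * i1)
    have e1 := congrArg (C : R → SpinPoly R) a1
    have e2 := congrArg (C : R → SpinPoly R) a2
    have e3 := congrArg (C : R → SpinPoly R) a3
    simp only [map_add, map_mul, map_ofNat, map_zero] at e1 e2 e3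
    linear_combination 25 * 𝔉.two_mul_XS 0 0 + X 0 * X 0 * e1 + X 0 * X 1 * e2 + X 1 * X 1 * e3
  have x11 : 50 * 𝔉.XS 1 1 = -(C m * (X 0 * X 0)) := by
    obtain ⟨a1, a2, a3⟩ := hN (25 * 𝔉.curvX 1 1 0 0 + m) (50 * 𝔉.curvX 1 1 0 1)
      (25 * 𝔉.curvX 1 1 1 1) (by
        rw [ham_quadric]
        simp only [map_add, map_mul, map_ofNat, hm']
        linear_combination 2 * i2)
    have e1 := congrArg (C : R → SpinPoly R) a1
    have e2 := congrArg (C : R → SpinPoly R) a2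
    have e3 := congrArg (C : R → SpinPoly R) a3
    simp only [map_add, map_mul, map_ofNat, map_zero] at e1 e2 e3
    linear_combination 25 * 𝔉.two_mul_XS 1 1 + X 0 * X 0 * e1 + X 0 * X 1 * e2 + X 1 * X 1 * e3
  have x01 : 50 * 𝔉.XS 0 1 = C m * (X 0 * X 1) := by
    obtain ⟨a1, a2, a3⟩ := hN (25 * 𝔉.curvX 0 1 0 0) (50 * 𝔉.curvX 0 1 0 1 - m)
      (25 * 𝔉.curvX 0 1 1 1) (by
        rw [ham_quadric]
        simp only [map_sub, map_mul, map_ofNat, hm']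
        linear_combination i3 - i4)
    have e1 := congrArg (C : R → SpinPoly R) a1
    have e2 := congrArg (C : R → SpinPoly R) a2
    have e3 := congrArg (C : R → SpinPoly R) a3
    simp only [map_sub, map_mul, map_ofNat, map_zero] at e1 e2 e3
    linear_combination 25 * 𝔉.two_mul_XS 0 1 + X 0 * X 0 * e1 + X 0 * X 1 * e2 + X 1 * X 1 * e3
  -- The quartic is `x^A x^B X_{AB}`, and `x^A x_A = 0`.
  have h : (50 : ℂ) • 𝔉.weylPoly = 0 := by
    have : (50 : ℂ) • 𝔉.weylPoly = 50 * 𝔉.weylPoly := by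
      rw [Algebra.smul_def, map_ofNat]
    rw [this, weylPoly]
    linear_combination X 0 * X 0 * x00 + 2 * X 0 * X 1 * x01 + X 1 * X 1 * x11
  have := congrArg (fun p => (50 : ℂ)⁻¹ • p) h
  simpa [smul_smul] using this

end FrameAlgebra


/-! ## Rules for directional derivatives -/

section DirDeriv

variable {U : Set M} {x : M} {F : Type*} [NormedAddCommGroup F] [NormedSpace ℝ F]

theorem dirDeriv_congr {f h : M → F} (hU : IsOpen U) (hx : x ∈ U) (hfh : Set.EqOn f h U)
    (v : TangentSpace (𝓡 4) x) : dirDeriv f x v = dirDeriv h x v := by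
  have : f =ᶠ[nhds x] h := Filter.eventually_of_mem (hU.mem_nhds hx) hfh
  have h2 : mfderiv (𝓡 4) 𝓘(ℝ, F) f x = mfderiv (𝓡 4) 𝓘(ℝ, F) h x := this.mfderiv_eq
  exact congrArg (fun T : TangentSpace (𝓡 4) x →L[ℝ] F => T v) h2

theorem dirDeriv_add {f h : M → F} (hf : MDifferentiableAt (𝓡 4) 𝓘(ℝ, F) f x)
    (hh : MDifferentiableAt (𝓡 4) 𝓘(ℝ, F) h x) (v : TangentSpace (𝓡 4) x) :
    dirDeriv (fun y => f y + h y) x v = dirDeriv f x v + dirDeriv h x v := by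
  have := (hf.hasMFDerivAt.add hh.hasMFDerivAt).mfderiv
  exact congrArg (fun T : TangentSpace (𝓡 4) x →L[ℝ] F => T v) this

theorem dirDeriv_const (c : F) (v : TangentSpace (𝓡 4) x) :
    dirDeriv (fun _ : M => c) x v = 0 := by
  have := (hasMFDerivAt_const (I := 𝓡 4) (I' := 𝓘(ℝ, F)) c x).mfderiv
  exact congrArg (fun T : TangentSpace (𝓡 4) x →L[ℝ] F => T v) this

theorem dirDeriv_mul {f h : M → ℂ} (hf : MDifferentiableAt (𝓡 4) 𝓘(ℝ, ℂ) f x)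
    (hh : MDifferentiableAt (𝓡 4) 𝓘(ℝ, ℂ) h x) (v : TangentSpace (𝓡 4) x) :
    dirDeriv (fun y => f y * h y) x v = f x * dirDeriv h x v + h x * dirDeriv f x v := by
  have := (hf.hasMFDerivAt.mul hh.hasMFDerivAt).mfderiv
  exact congrArg (fun T : TangentSpace (𝓡 4) x →L[ℝ] ℂ => T v) this

theorem dirDeriv_clm {F' : Type*} [NormedAddCommGroup F'] [NormedSpace ℝ F'] (T : F →L[ℝ] F')
    {f : M → F} (hf : MDifferentiableAt (𝓡 4) 𝓘(ℝ, F) f x) (v : TangentSpace (𝓡 4) x) :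
    dirDeriv (fun y => T (f y)) x v = T (dirDeriv f x v) := by
  have h1 : HasMFDerivAt (𝓡 4) 𝓘(ℝ, F') (fun y => T (f y)) x
        (T.comp (mfderiv (𝓡 4) 𝓘(ℝ, F) f x)) := T.hasMFDerivAt.comp x hf.hasMFDerivAt
  exact congrArg (fun T : TangentSpace (𝓡 4) x →L[ℝ] F' => T v) h1.mfderiv

theorem dirDeriv_ofReal {f : M → ℝ} (hf : MDifferentiableAt (𝓡 4) 𝓘(ℝ, ℝ) f x)
    (v : TangentSpace (𝓡 4) x) :
    dirDeriv (fun y => (f y : ℂ)) x v = ((dirDeriv f x v : ℝ) : ℂ) :=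
  dirDeriv_clm Complex.ofRealCLM hf v

theorem ContMDiffOn.mdifferentiableAt_of_mem {f : M → F} (hf : ContMDiffOn (𝓡 4) 𝓘(ℝ, F) ∞ f U)
    (hU : IsOpen U) (hx : x ∈ U) : MDifferentiableAt (𝓡 4) 𝓘(ℝ, F) f x :=
  (hf.contMDiffAt (hU.mem_nhds hx)).mdifferentiableAt (by simp)

theorem ContMDiffOn.ofReal {f : M → ℝ} (hf : ContMDiffOn (𝓡 4) 𝓘(ℝ, ℝ) ∞ f U) :
    ContMDiffOn (𝓡 4) 𝓘(ℝ, ℂ) ∞ (fun x => (f x : ℂ)) U :=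
  (Complex.ofRealCLM.contMDiff (n := ∞)).comp_contMDiffOn hf

end DirDeriv

instance : ContMDiffMul 𝓘(ℝ, ℂ) ∞ ℂ where
  contMDiff_mul := by
    rw [contMDiff_iff]
    refine ⟨continuous_mul, fun x y => ?_⟩
    simp only [mfld_simps, chartAt_self_eq]
    rw [contDiffOn_univ]
    exact contDiff_mul

instance : ContMDiffInv₀ 𝓘(ℝ, ℂ) ∞ ℂ where
  contMDiffAt_inv₀ {x} hx := by
    change ContMDiffAt 𝓘(ℝ, ℂ) 𝓘(ℝ, ℂ) ∞ Inv.inv x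
    rw [contMDiffAt_iff_contDiffAt]
    exact contDiffAt_inv ℝ hx

/-! ## The ring of smooth functions on a set -/

/-- Smooth complex functions on `U`. -/
def smoothRing (U : Set M) : Subalgebra ℂ (U → ℂ) where
  -- The extension `F` is needed because manifold derivatives are taken of functions on `M`; its
  -- values off `U` are arbitrary.
  carrier := {f | ∃ F : M → ℂ, ContMDiffOn (𝓡 4) 𝓘(ℝ, ℂ) ∞ F U ∧ ∀ x : U, F x = f x}
  mul_mem' := by
    rintro f h ⟨F, hF, hf⟩ ⟨G, hG, hh⟩
    exact ⟨fun x => F x * G x, hF.mul hG, fun x => by simp [hf, hh]⟩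
  add_mem' := by
    rintro f h ⟨F, hF, hf⟩ ⟨G, hG, hh⟩
    exact ⟨fun x => F x + G x, hF.add hG, fun x => by simp [hf, hh]⟩
  algebraMap_mem' c := ⟨fun _ => c, contMDiffOn_const, fun x => rfl⟩

namespace smoothRing

variable {U : Set M}

/-- A smooth function as an element of the ring. -/
def mk (F : M → ℂ) (hF : ContMDiffOn (𝓡 4) 𝓘(ℝ, ℂ) ∞ F U) : smoothRing U :=
  ⟨fun x => F x, F, hF, fun _ => rfl⟩

/-- An extension of an element of the ring to `M`. -/
def lift (f : smoothRing U) : M → ℂ := f.2.choose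

theorem lift_smooth (f : smoothRing U) : ContMDiffOn (𝓡 4) 𝓘(ℝ, ℂ) ∞ (lift f) U :=
  f.2.choose_spec.1

theorem lift_apply (f : smoothRing U) {x : M} (hx : x ∈ U) : lift f x = f.1 ⟨x, hx⟩ :=
  f.2.choose_spec.2 ⟨x, hx⟩

theorem ext_lift {f h : smoothRing U} (H : ∀ x ∈ U, lift f x = lift h x) : f = h := by
  refine Subtype.ext (funext fun x => ?_)
  have := H x.1 x.2
  rwa [lift_apply f x.2, lift_apply h x.2] at this

theorem lift_mk (F : M → ℂ) (hF : ContMDiffOn (𝓡 4) 𝓘(ℝ, ℂ) ∞ F U) {x : M} (hx : x ∈ U) :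
    lift (mk F hF) x = F x := lift_apply _ hx

theorem lift_add (f h : smoothRing U) {x : M} (hx : x ∈ U) : lift (f + h) x = lift f x + lift h x := by
  rw [lift_apply _ hx, lift_apply _ hx, lift_apply _ hx]; rfl

theorem lift_mul (f h : smoothRing U) {x : M} (hx : x ∈ U) : lift (f * h) x = lift f x * lift h x := by
  rw [lift_apply _ hx, lift_apply _ hx, lift_apply _ hx]; rfl

theorem lift_smul (c : ℂ) (f : smoothRing U) {x : M} (hx : x ∈ U) : lift (c • f) x = c * lift f x := by
  rw [lift_apply _ hx, lift_apply _ hx]; rfl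

/-- Evaluation at a point of `U`. -/
def ev {x : M} (hx : x ∈ U) : smoothRing U →ₐ[ℂ] ℂ :=
  (Pi.evalAlgHom ℂ (fun _ : U => ℂ) ⟨x, hx⟩).comp (smoothRing U).val

theorem ev_eq_lift {x : M} (hx : x ∈ U) (f : smoothRing U) : ev hx f = lift f x := (lift_apply f hx).symm

theorem ext_ev {f h : smoothRing U} (H : ∀ x (hx : x ∈ U), ev hx f = ev hx h) : f = h :=
  ext_lift fun x hx => by rw [← ev_eq_lift hx, ← ev_eq_lift hx, H x hx]

/-- The derivation along a vector field. -/
def deriv (hU : IsOpen U) (V : (x : M) → TangentSpace (𝓡 4) x) (hV : SmoothFieldOn V U) :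
    Derivation ℂ (smoothRing U) (smoothRing U) :=
  Derivation.mk'
    { toFun := fun f => mk (fun x => dirDeriv (lift f) x (V x))
        (contMDiffOn_dirDeriv hU (lift_smooth f) hV)
      map_add' := fun f h => ext_lift fun x hx => by
        rw [lift_add _ _ hx, lift_mk _ _ hx, lift_mk _ _ hx, lift_mk _ _ hx,
          ← dirDeriv_add ((lift_smooth f).mdifferentiableAt_of_mem hU hx)
            ((lift_smooth h).mdifferentiableAt_of_mem hU hx)]
        exact dirDeriv_congr hU hx (fun y hy => lift_add f h hy) _
      map_smul' := fun c f => ext_lift fun x hx => by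
        rw [RingHom.id_apply, lift_smul _ _ hx, lift_mk _ _ hx, lift_mk _ _ hx]
        have := dirDeriv_mul (x := x) (f := fun _ => c) (contMDiff_const.mdifferentiableAt (n := ∞) (by simp))
          ((lift_smooth f).mdifferentiableAt_of_mem hU hx) (V x)
        rw [dirDeriv_const, mul_zero, add_zero] at this
        rw [← this]
        exact dirDeriv_congr hU hx (fun y hy => lift_smul c f hy) _ }
    (fun f h => ext_lift fun x hx => by
      rw [lift_add _ _ hx, smul_eq_mul, smul_eq_mul, lift_mul _ _ hx, lift_mul _ _ hx]
      simp only [LinearMap.coe_mk, AddHom.coe_mk]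
      rw [lift_mk _ _ hx, lift_mk _ _ hx, lift_mk _ _ hx, 
          ← dirDeriv_mul ((lift_smooth f).mdifferentiableAt_of_mem hU hx)
            ((lift_smooth h).mdifferentiableAt_of_mem hU hx)]
      exact dirDeriv_congr hU hx (fun y hy => lift_mul f h hy) _)

theorem ev_deriv (hU : IsOpen U) (V : (x : M) → TangentSpace (𝓡 4) x) (hV : SmoothFieldOn V U)
    (f : smoothRing U) (F : M → ℂ) (hF : ∀ y (hy : y ∈ U), ev hy f = F y) {x : M} (hx : x ∈ U) :
    ev hx (deriv hU V hV f) = dirDeriv F x (V x) := by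
  refine Eq.trans (b := dirDeriv (lift f) x (V x)) rfl ?_
  exact dirDeriv_congr hU hx (fun y hy => (ev_eq_lift hy f).symm.trans (hF y hy)) _

theorem ev_mk (F : M → ℂ) (hF : ContMDiffOn (𝓡 4) 𝓘(ℝ, ℂ) ∞ F U) {x : M} (hx : x ∈ U) :
    ev hx (mk F hF) = F x := rfl

end smoothRing

/-! ### The frame algebra of an orthonormal frame, and its values at points -/

namespace IsOrthonormalFrame

open smoothRing

variable {g : LorentzMetric M} {E : Fin 4 → (x : M) → TangentSpace (𝓡 4) x} {U : Set M}

theorem isLorentz_frameConn (a : Fin 4) (x : M) :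
    IsLorentz (fun b c => (frameConn g E a b c x : ℂ)) := fun b c => by
  have h := frameConnLow_swap (g := g) (E := E) a b c x
  have hb := minkowskiDiag_mul_self b
  have hc := minkowskiDiag_mul_self c
  simp only [frameConn, smul_eq_mul, ← Complex.ofReal_mul, ← Complex.ofReal_neg, ← mul_assoc, hb, hc,
    one_mul, h]

theorem coeff_eq_zero (h : IsOrthonormalFrame g E U) {p : M} (hp : U ⊆ (extChartAt (𝓡 4) p).source)
    {x : M} (hx : x ∈ U) (r : Fin 4 → ℝ)
    (hr : ∀ i, ∑ c, r c * dirDeriv (fun y => extChartAt (𝓡 4) p y i) x (E c x) = 0) : r = 0 := by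
  have h1 : ∑ c, r c • E c x = 0 := by
    refine eq_zero_of_dirDeriv_coord (hp hx) fun i => ?_
    refine Eq.trans ?_ (hr i)
    unfold dirDeriv
    rw [map_sum]
    exact Finset.sum_congr rfl fun c _ => map_smul _ _ _
  exact funext (Fintype.linearIndependent_iff.1 (h.linearIndependent hx) r h1)

theorem coeff_eq_zero_complex (h : IsOrthonormalFrame g E U) {p : M}
    (hp : U ⊆ (extChartAt (𝓡 4) p).source) {x : M} (hx : x ∈ U) (r : Fin 4 → ℂ)
    (hr : ∀ i, ∑ c, r c * ((dirDeriv (fun y => extChartAt (𝓡 4) p y i) x (E c x) : ℝ) : ℂ) = 0) :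
    r = 0 := by
  have hre := h.coeff_eq_zero hp hx (fun c => (r c).re) fun i => by
    have := congrArg Complex.re (hr i)
    simpa only [Complex.re_sum, Complex.re_mul_ofReal, Complex.zero_re] using this
  have him := h.coeff_eq_zero hp hx (fun c => (r c).im) fun i => by
    have := congrArg Complex.im (hr i)
    simpa only [Complex.im_sum, Complex.im_mul_ofReal, Complex.zero_im] using this
  exact funext fun c => Complex.ext (congrFun hre c) (congrFun him c)

/-- The frame algebra of an orthonormal frame over a coordinate domain. -/
def frameAlgebra (h : IsOrthonormalFrame g E U) {p : M} (hp : U ⊆ (extChartAt (𝓡 4) p).source) :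
    FrameAlgebra (smoothRing U) where
  D a := deriv h.isOpen (E a) (h.smooth a)
  Γ a b c := smoothRing.mk (fun x => (frameConn g E a b c x : ℂ)) (h.frameConn_smooth a b c).ofReal
  lorentz a b c := ext_ev fun x hx => by
    rw [map_neg, map_smul, map_smul, ev_mk, ev_mk]
    exact isLorentz_frameConn a x b c
  comm a b := Derivation.ext fun f => ext_ev fun x hx => by
    have e : ∀ a, ev hx (deriv h.isOpen (E a) (h.smooth a) f) = dirDeriv (lift f) x (E a x) := fun a =>
      ev_deriv h.isOpen _ _ f (lift f) (fun y hy => ev_eq_lift hy f) hx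
    have e2 : ∀ a b, ev hx (deriv h.isOpen (E a) (h.smooth a) (deriv h.isOpen (E b) (h.smooth b) f)) =
        dirDeriv (fun y => dirDeriv (lift f) y (E b y)) x (E a x) := fun a b =>
      ev_deriv h.isOpen _ _ _ _ (fun y hy => ev_deriv h.isOpen _ _ f (lift f)
        (fun y hy => ev_eq_lift hy f) hy) hx
    rw [Derivation.commutator_apply, derivation_sum_apply, map_sub, e2, e2,
      h.dirDeriv_comm (lift_smooth f) hx, map_sum]
    refine Finset.sum_congr rfl fun c _ => ?_
    rw [Derivation.smul_apply, smul_eq_mul, map_mul, e, map_sub, ev_mk, ev_mk, ← Complex.ofReal_sub,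
      Complex.real_smul]
  indep r hr c := ext_ev fun x hx => by
    have key : ∀ i, ∑ c, ev hx (r c) *
        ((dirDeriv (fun y => extChartAt (𝓡 4) p y i) x (E c x) : ℝ) : ℂ) = 0 := fun i => by
      -- The test functions are the chart coordinates; this is why `U` is required to lie in one
      -- chart domain.
      have hs := (contMDiffOn_coord p i).mono hp
      have h1 := congrArg (ev hx) (hr (smoothRing.mk (fun y => (extChartAt (𝓡 4) p y i : ℂ)) hs.ofReal))
      rw [map_sum, map_zero] at h1
      rw [← h1]
      refine Finset.sum_congr rfl fun c _ => ?_
      rw [map_mul, ev_deriv h.isOpen _ _ _ (fun y => (extChartAt (𝓡 4) p y i : ℂ)) (fun y hy => rfl) hx,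
        dirDeriv_ofReal (hs.mdifferentiableAt_of_mem h.isOpen hx)]
    rw [map_zero]
    exact congrFun (h.coeff_eq_zero_complex hp hx (fun c => ev hx (r c)) key) c

variable (h : IsOrthonormalFrame g E U) {p : M} (hp : U ⊆ (extChartAt (𝓡 4) p).source)
  {x : M} (hx : x ∈ U)

theorem ev_D (a : Fin 4) (f : smoothRing U) (F : M → ℂ) (hF : ∀ y (hy : y ∈ U), ev hy f = F y) :
    ev hx ((h.frameAlgebra hp).D a f) = dirDeriv F x (E a x) :=
  ev_deriv h.isOpen _ (h.smooth a) f F hF hx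

theorem ev_Γ (a b c : Fin 4) : ev hx ((h.frameAlgebra hp).Γ a b c) = (frameConn g E a b c x : ℂ) := rfl

/-- The point of contact between the formal curvature and the one in the statement; the curvature
spinors follow by linearity. -/
theorem ev_riemLow (a b c d : Fin 4) :
    ev hx ((h.frameAlgebra hp).riemLow a b c d) = (frameRiem g E a b c d x : ℂ) := by
  have e : ∀ a b c d, ev hx ((h.frameAlgebra hp).D a ((h.frameAlgebra hp).Γ b c d)) =
      ((dirDeriv (frameConn g E b c d) x (E a x) : ℝ) : ℂ) := fun a b c d => by
    rw [h.ev_D hp hx a _ (fun y => (frameConn g E b c d y : ℂ)) (fun y hy => rfl)]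
    exact dirDeriv_ofReal ((h.frameConn_smooth b c d).mdifferentiableAt_of_mem h.isOpen hx) _
  rw [FrameAlgebra.riemLow, map_smul, FrameAlgebra.riem]
  simp only [map_add, map_sub, map_sum, map_mul, e, ev_Γ, frameRiem, Complex.ofReal_mul, Complex.ofReal_add,
    Complex.ofReal_sub, Complex.ofReal_sum, smul_eq_mul]

theorem ev_spinRiem (A A' B B' C C' D D' : Fin 2) :
    ev hx ((h.frameAlgebra hp).spinRiem A A' B B' C C' D D') = spinRiem g E x A A' B B' C C' D D' := by
  simp only [FrameAlgebra.spinRiem, spinRiem, map_sum, map_smul, ev_riemLow, smul_eq_mul]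

theorem ev_curvX (A B C D : Fin 2) :
    ev hx ((h.frameAlgebra hp).curvX A B C D) = curvX g E x A B C D := by
  simp only [FrameAlgebra.curvX, curvX, map_sum, map_smul, ev_spinRiem, smul_eq_mul]

theorem ev_ricci (A B A' B' : Fin 2) :
    ev hx ((h.frameAlgebra hp).ricci A B A' B') = ricciSpinor g E x A B A' B' := by
  simp only [FrameAlgebra.ricci, ricciSpinor, map_sum, map_smul, ev_spinRiem, smul_eq_mul]

theorem ev_γ (a : Fin 4) (A B : Fin 2) :
    ev hx ((h.frameAlgebra hp).γ a A B) = spinConn g E a x A B := by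
  simp only [FrameAlgebra.γ, spinRep, spinConn, map_sum, map_smul, ev_Γ, smul_eq_mul]
  congr 1
  refine Finset.sum_congr rfl fun _ _ => Finset.sum_congr rfl fun _ _ => Finset.sum_congr rfl fun _ _ => ?_
  ring

end IsOrthonormalFrame

/-! ## Symmetric spinors as polynomials -/

section PolyOf

open MvPolynomial

variable {R : Type*} [CommRing R] {n : ℕ}

/-- The polynomial `φ_{A₁…A_n} x^{A₁} ⋯ x^{A_n}`. -/
def polyOf (φ : (Fin n → Fin 2) → R) : SpinPoly R := ∑ α, C (φ α) * ∏ r, X (α r)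

/-- Total symmetry of a spinor. -/
def IsSymmSpinor (φ : (Fin n → Fin 2) → R) : Prop := ∀ (π : Equiv.Perm (Fin n)) α, φ (α ∘ π) = φ α

theorem sum_fin_succ_arrow {S : Type*} [AddCommMonoid S] (f : (Fin (n + 1) → Fin 2) → S) :
    ∑ α, f α = ∑ A, ∑ β, f (Fin.cons A β) := by
  rw [← Fintype.sum_prod_type']
  exact (Fintype.sum_equiv (Fin.consEquiv fun _ => Fin 2) _ _ fun p => rfl).symm

theorem polyOf_zero_index (φ : (Fin 0 → Fin 2) → R) : polyOf φ = C (φ ![]) := by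
  simp [polyOf, Matrix.empty_eq]

theorem polyOf_succ (φ : (Fin (n + 1) → Fin 2) → R) :
    polyOf φ = ∑ A, X A * polyOf fun β => φ (Fin.cons A β) := by
  simp only [polyOf, sum_fin_succ_arrow, Fin.prod_univ_succ, Fin.cons_zero, Fin.cons_succ,
    Finset.mul_sum]
  exact Finset.sum_congr rfl fun _ _ => Finset.sum_congr rfl fun _ _ => by ring

theorem polyOf_add (φ ψ : (Fin n → Fin 2) → R) :
    polyOf (fun α => φ α + ψ α) = polyOf φ + polyOf ψ := by
  simp only [polyOf, map_add, add_mul, Finset.sum_add_distrib]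

theorem polyOf_sub (φ ψ : (Fin n → Fin 2) → R) :
    polyOf (fun α => φ α - ψ α) = polyOf φ - polyOf ψ := by
  simp only [polyOf, map_sub, sub_mul, Finset.sum_sub_distrib]

theorem polyOf_mul (r : R) (φ : (Fin n → Fin 2) → R) :
    polyOf (fun α => r * φ α) = C r * polyOf φ := by
  simp only [polyOf, map_mul, Finset.mul_sum, mul_assoc]

theorem polyOf_sum {J : Type*} (s : Finset J) (φ : J → (Fin n → Fin 2) → R) :
    polyOf (fun α => ∑ j ∈ s, φ j α) = ∑ j ∈ s, polyOf (φ j) := by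
  simp only [polyOf, map_sum, Finset.sum_mul]
  rw [Finset.sum_comm]

theorem polyOf_zero : polyOf (fun _ : Fin n → Fin 2 => (0 : R)) = 0 := by
  simp [polyOf]

theorem map_polyOf {S : Type*} [CommRing S] (f : R →+* S) (φ : (Fin n → Fin 2) → R) :
    map f (polyOf φ) = polyOf fun α => f (φ α) := by
  simp only [polyOf, map_sum, map_mul, map_C, map_prod, map_X]

theorem polyOf_comp_perm (π : Equiv.Perm (Fin n)) (φ : (Fin n → Fin 2) → R) :
    polyOf (fun α => φ (α ∘ π)) = polyOf φ := by
  refine Fintype.sum_equiv (Equiv.arrowCongr π.symm (Equiv.refl _)) _ _ fun α => ?_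
  have h1 : (Equiv.arrowCongr π.symm (Equiv.refl (Fin 2))) α = α ∘ π := rfl
  rw [h1]
  congr 1
  exact (Fintype.prod_equiv π _ _ fun r => rfl).symm

theorem IsSymmSpinor.cons {φ : (Fin (n + 1) → Fin 2) → R} (h : IsSymmSpinor φ) (A : Fin 2) :
    IsSymmSpinor fun β => φ (Fin.cons A β) := fun π β => by
  have := h (Equiv.Perm.decomposeFin.symm (0, π)) (Fin.cons A β)
  refine Eq.trans ?_ this
  show φ (Fin.cons A (β ∘ π)) = _
  congr 1
  funext r
  refine Fin.cases ?_ (fun r => ?_) r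
  · simp
  · simp

theorem IsSymmSpinor.cons_cons {φ : (Fin (n + 2) → Fin 2) → R} (h : IsSymmSpinor φ) (A B : Fin 2)
    (β : Fin n → Fin 2) :
    φ (Fin.cons A (Fin.cons B β)) = φ (Fin.cons B (Fin.cons A β)) := by
  have := h (Equiv.swap 0 1) (Fin.cons B (Fin.cons A β : Fin (n + 1) → Fin 2))
  rw [← this]
  congr 1
  funext r
  refine Fin.cases ?_ (fun r => Fin.cases ?_ (fun r => ?_) r) r
  · simp
  · simp
  · have h0 : (r.succ.succ : Fin (n + 2)) ≠ 0 := Fin.succ_ne_zero _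
    have h1 : (r.succ.succ : Fin (n + 2)) ≠ 1 := by
      rw [← Fin.succ_zero_eq_one, Ne, Fin.succ_inj]; exact Fin.succ_ne_zero _
    simp [Equiv.swap_apply_of_ne_of_ne h0 h1]

/-- Monomials are insensitive to the order of the indices, so the polynomial cannot see
symmetrization. -/
theorem polyOf_spinSymm (T : (Fin n → Fin 2) → ℂ) : polyOf (spinSymm T) = polyOf T := by
  have h : spinSymm T = fun α => (1 / (n.factorial : ℂ)) * ∑ π : Equiv.Perm (Fin n), T (α ∘ π) := rfl
  rw [h, polyOf_mul, polyOf_sum]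
  simp only [polyOf_comp_perm, Finset.sum_const, Finset.card_univ, Fintype.card_perm, Fintype.card_fin]
  rw [nsmul_eq_mul, ← mul_assoc, ← map_natCast (C : ℂ →+* SpinPoly ℂ), ← map_mul, one_div,
    inv_mul_cancel₀ (Nat.cast_ne_zero.2 n.factorial_ne_zero), map_one, one_mul]

theorem isSymmSpinor_spinSymm (T : (Fin n → Fin 2) → ℂ) : IsSymmSpinor (spinSymm T) := fun π α => by
  unfold spinSymm
  congr 1
  exact Fintype.sum_equiv (Equiv.mulLeft π) _ _ fun σ => rfl

section Deriv

variable [Algebra ℂ R]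

theorem xDeriv_X (A B : Fin 2) : xDeriv A (X B : SpinPoly R) = if A = B then 1 else 0 := by
  fin_cases A <;> fin_cases B <;> simp

/-- By symmetry all `n + 1` index positions contribute equally. -/
theorem xDeriv_polyOf {φ : (Fin (n + 1) → Fin 2) → R} (h : IsSymmSpinor φ) (A : Fin 2) :
    xDeriv A (polyOf φ) = (n + 1 : ℂ) • polyOf fun β => φ (Fin.cons A β) := by
  induction n with
  | zero =>
    rw [polyOf_succ, map_sum]
    simp only [polyOf_zero_index, Derivation.leibniz, xDeriv_C, xDeriv_X, smul_eq_mul, mul_zero,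
      zero_add, mul_ite, mul_one]
    simp
  | succ n ih =>
    rw [polyOf_succ, map_sum]
    simp only [Derivation.leibniz, xDeriv_X, smul_eq_mul, ih (h.cons _), mul_ite, mul_one, mul_zero,
      Finset.sum_add_distrib, Finset.sum_ite_eq, Finset.mem_univ, if_true, mul_smul_comm,
      ← Finset.smul_sum, h.cons_cons _ A]
    rw [← polyOf_succ (fun β => φ (Fin.cons A β))]
    push_cast
    module

theorem polyOf_euler {φ : (Fin n → Fin 2) → R} (h : IsSymmSpinor φ) :
    X 0 * xDeriv 0 (polyOf φ) + X 1 * xDeriv 1 (polyOf φ) = (n : ℂ) • polyOf φ := by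
  cases n with
  | zero => simp [polyOf_zero_index]
  | succ n =>
    rw [xDeriv_polyOf h, xDeriv_polyOf h, mul_smul_comm, mul_smul_comm, ← smul_add]
    conv_rhs => rw [polyOf_succ, Fin.sum_univ_two]
    push_cast
    rfl

/-- Repeated differentiation recovers the components up to nonzero integers. Hence symmetric spinors
may be replaced by their forms. -/
theorem IsSymmSpinor.eq_zero {φ : (Fin n → Fin 2) → R} (h : IsSymmSpinor φ) (h0 : polyOf φ = 0) :
    φ = fun _ => 0 := by
  induction n with
  | zero =>
    rw [polyOf_zero_index] at h0
    funext α
    rw [Subsingleton.elim α ![]]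
    exact C_injective _ _ (h0.trans (map_zero C).symm)
  | succ n ih =>
    funext α
    rw [← Fin.cons_self_tail α]
    have h1 := xDeriv_polyOf h (α 0)
    rw [h0, map_zero] at h1
    have h2 : polyOf (fun β => φ (Fin.cons (α 0) β)) = 0 := by
      have hn : (n + 1 : ℂ) ≠ 0 := by exact_mod_cast n.succ_ne_zero
      have := congrArg (fun p => (n + 1 : ℂ)⁻¹ • p) h1.symm
      simpa only [smul_smul, inv_mul_cancel₀ hn, one_smul, smul_zero] using this
    exact congrFun (ih (h.cons _) h2) (Fin.tail α)

theorem IsSymmSpinor.eq_of_polyOf_eq {φ ψ : (Fin n → Fin 2) → R} (h : IsSymmSpinor φ)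
    (h' : IsSymmSpinor ψ) (he : polyOf φ = polyOf ψ) : φ = ψ := by
  have h1 : IsSymmSpinor fun α => φ α - ψ α := fun π α => by
    show φ (α ∘ π) - ψ (α ∘ π) = φ α - ψ α
    rw [h, h']
  have h2 := h1.eq_zero (by rw [polyOf_sub, he, sub_self])
  funext α
  exact sub_eq_zero.1 (congrFun h2 α)

/-- Matches the formal derivation with the covariant derivative: the Leibniz rule produces one
connection term for each index. -/
theorem IsSpinDeriv.map_polyOf {H : Derivation ℂ (SpinPoly R) (SpinPoly R)} {D : Derivation ℂ R R}
    {γ : Matrix (Fin 2) (Fin 2) R} (h : IsSpinDeriv H D γ) (φ : (Fin n → Fin 2) → R) :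
    H (polyOf φ) = polyOf fun α =>
      D (φ α) - ∑ r, ∑ E, γ E (α r) * φ (Function.update α r E) := by
  induction n with
  | zero => simp [polyOf_zero_index, h.map_C]
  | succ n ih =>
    rw [polyOf_succ, map_sum]
    simp only [Derivation.leibniz, ih, h.map_X, smul_eq_mul]
    rw [polyOf_succ]
    simp only [Fin.sum_univ_succ (n := n), Fin.cons_zero, Fin.cons_succ, Fin.update_cons_zero,
      ← Fin.cons_update, polyOf_sub, polyOf_add, polyOf_mul, Fin.sum_univ_two]
    ring

end Deriv

theorem polyOf_two (κ : (Fin 2 → Fin 2) → R) :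
    polyOf κ = ∑ A, ∑ B, C (κ ![A, B]) * (X A * X B) := by
  simp only [polyOf_succ, polyOf_zero_index, Fin.sum_univ_two, Matrix.vecCons]
  ring

theorem polyOf_three (φ : (Fin 3 → Fin 2) → R) :
    polyOf φ = ∑ A, ∑ B, ∑ C', C (φ ![A, B, C']) * (X A * X B * X C') := by
  simp only [polyOf_succ, polyOf_zero_index, Fin.sum_univ_two, Matrix.vecCons]
  ring

theorem polyOf_four (φ : (Fin 4 → Fin 2) → R) :
    polyOf φ = ∑ A, ∑ B, ∑ C', ∑ D, C (φ ![A, B, C', D]) * (X A * X B * X C' * X D) := by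
  simp only [polyOf_succ, polyOf_zero_index, Fin.sum_univ_two, Matrix.vecCons]
  ring

theorem polyOf_spinSymmSq (κ : (Fin 2 → Fin 2) → ℂ) :
    polyOf (spinSymmSq κ) = polyOf κ * polyOf κ := by
  rw [spinSymmSq, polyOf_spinSymm, polyOf_four, polyOf_two]
  simp only [Matrix.cons_val, Fin.sum_univ_two, map_mul]
  ring

end PolyOf

namespace FrameAlgebra

open MvPolynomial

variable {R : Type*} [CommRing R] [Algebra ℂ R] (𝔉 : FrameAlgebra R)

/-- The polynomial of `X_{ABCD}` sees only its symmetric part, so scalar curvature drops out. The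
`2` undoes the `1/2` in `quad`. -/
theorem two_smul_weylPoly : (2 : ℂ) • 𝔉.weylPoly =
    polyOf fun α : Fin 4 → Fin 2 => 𝔉.curvX (α 0) (α 1) (α 2) (α 3) := by
  have h2 : (2 : ℂ) • 𝔉.weylPoly = 2 * 𝔉.weylPoly := by rw [Algebra.smul_def, map_ofNat]
  rw [h2, polyOf_four, weylPoly]
  simp only [Matrix.cons_val, Fin.sum_univ_two]
  have h00 := 𝔉.two_mul_XS 0 0
  have h01 := 𝔉.two_mul_XS 0 1
  have h11 := 𝔉.two_mul_XS 1 1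
  simp only [𝔉.curvX_symm_left 1 0, 𝔉.curvX_symm_right _ _ 1 0]
  linear_combination X 0 * X 0 * h00 + 2 * X 0 * X 1 * h01 + X 1 * X 1 * h11

end FrameAlgebra


/-! ## Evaluation of polynomials over the ring of smooth functions -/

namespace smoothRing

variable {U : Set M} {x : M} (hx : x ∈ U)

/-- Evaluation of the coefficients at a point. -/
def evPoly : SpinPoly (smoothRing U) →ₐ[ℂ] SpinPoly ℂ := MvPolynomial.mapAlgHom (ev hx)

theorem evPoly_C (r : smoothRing U) : evPoly hx (MvPolynomial.C r) = MvPolynomial.C (ev hx r) :=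
  MvPolynomial.map_C _ _

theorem evPoly_X (i : Fin 2) : evPoly hx (MvPolynomial.X i) = MvPolynomial.X i :=
  MvPolynomial.map_X _ _

theorem coeff_evPoly (m : Fin 2 →₀ ℕ) (p : SpinPoly (smoothRing U)) :
    MvPolynomial.coeff m (evPoly hx p) = ev hx (MvPolynomial.coeff m p) :=
  MvPolynomial.coeff_map _ _ _

theorem ext_evPoly {p q : SpinPoly (smoothRing U)} (h : ∀ x (hx : x ∈ U), evPoly hx p = evPoly hx q) :
    p = q := by
  ext m : 1
  refine ext_ev fun x hx => ?_
  rw [← coeff_evPoly, ← coeff_evPoly, h]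

theorem evPoly_polyOf {n : ℕ} (φ : (Fin n → Fin 2) → smoothRing U) :
    evPoly hx (polyOf φ) = polyOf fun α => ev hx (φ α) :=
  map_polyOf (ev hx).toRingHom φ

theorem evPoly_xDeriv (i : Fin 2) (p : SpinPoly (smoothRing U)) :
    evPoly hx (xDeriv i p) = xDeriv i (evPoly hx p) := by
  induction p using MvPolynomial.induction_on with
  | C r => rw [xDeriv_C, evPoly_C, xDeriv_C, map_zero]
  | add p q hp hq => simp only [map_add, hp, hq]
  | mul_X p j hp =>
    simp only [Derivation.leibniz, smul_eq_mul, map_add, map_mul, hp, evPoly_X, xDeriv_X]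
    split_ifs <;> simp

theorem evPoly_ham (p q : SpinPoly (smoothRing U)) :
    evPoly hx (ham p q) = ham (evPoly hx p) (evPoly hx q) := by
  simp only [ham_apply, map_sub, map_mul, evPoly_xDeriv]

theorem evPoly_quad (φ : Fin 2 → Fin 2 → smoothRing U) :
    evPoly hx (FrameAlgebra.quad φ) = FrameAlgebra.quad fun A B => ev hx (φ A B) := by
  simp only [FrameAlgebra.quad, map_smul, map_sum, map_mul, evPoly_C, evPoly_X]

end smoothRing

/-! ## The twistor operator on spinor fields -/

namespace IsOrthonormalFrame

open smoothRing MvPolynomial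

variable {g : LorentzMetric M} {E : Fin 4 → (x : M) → TangentSpace (𝓡 4) x} {U : Set M}
  (h : IsOrthonormalFrame g E U) {p : M} (hp : U ⊆ (extChartAt (𝓡 4) p).source)
  {x : M} (hx : x ∈ U) {k : ℕ}

theorem evPoly_H (a : Fin 4) (φ : (Fin k → Fin 2) → smoothRing U) (f : M → (Fin k → Fin 2) → ℂ)
    (hf : ∀ y (hy : y ∈ U) α, ev hy (φ α) = f y α) :
    evPoly hx ((h.frameAlgebra hp).H a (polyOf φ)) = polyOf (spinCovDeriv g E f a x) := by
  rw [((h.frameAlgebra hp).isSpinDeriv_H a).map_polyOf, evPoly_polyOf]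
  congr 1
  funext α
  simp only [map_sub, map_sum, map_mul, spinCovDeriv, h.ev_γ hp hx, hf]
  rw [h.ev_D hp hx a _ (fun y => f y α) (fun y hy => hf y hy α)]

theorem evPoly_HS (i : Fin 2 × Fin 2) (φ : (Fin k → Fin 2) → smoothRing U)
    (f : M → (Fin k → Fin 2) → ℂ) (hf : ∀ y (hy : y ∈ U) α, ev hy (φ α) = f y α) :
    evPoly hx ((h.frameAlgebra hp).HS i (polyOf φ)) = polyOf (spinNabla g E f x i.1 i.2) := by
  have e : spinNabla g E f x i.1 i.2 =
    fun α => ∑ a, infeldInv a i.1 i.2 * spinCovDeriv g E f a x α := rfl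
  rw [e, polyOf_sum]
  simp only [FrameAlgebra.HS, derivation_sum_apply, Derivation.smul_apply, map_sum, map_smul,
    h.evPoly_H hp hx _ φ f hf, polyOf_mul, MvPolynomial.C_mul']

theorem polyOf_spinTwist (A' : Fin 2) (φ : (Fin k → Fin 2) → smoothRing U)
    (f : M → (Fin k → Fin 2) → ℂ) (hf : ∀ y (hy : y ∈ U) α, ev hy (φ α) = f y α) :
    polyOf (spinTwist g E f x A') =
      ∑ B', C (spinEps A' B') * evPoly hx ((h.frameAlgebra hp).twist B' (polyOf φ)) := by
  rw [spinTwist, polyOf_spinSymm, polyOf_succ]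
  simp only [Fin.cons_zero, Fin.tail_cons, FrameAlgebra.twist_apply, map_add,
    map_mul, evPoly_X, h.evPoly_HS hp hx _ φ f hf, Fin.sum_univ_two, polyOf_add, polyOf_mul]
  ring

/-- `spinTwist` is symmetric, hence determined by its form, and raising the primed index only
permutes the two equations up to sign. -/
theorem twist_eq_zero_iff (φ : (Fin k → Fin 2) → smoothRing U)
    (f : M → (Fin k → Fin 2) → ℂ) (hf : ∀ y (hy : y ∈ U) α, ev hy (φ α) = f y α) :
    (∀ A' α, spinTwist g E f x A' α = 0) ↔
      ∀ A', evPoly hx ((h.frameAlgebra hp).twist A' (polyOf φ)) = 0 := by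
  have key := fun A' => h.polyOf_spinTwist hp hx A' φ f hf
  simp only [Fin.sum_univ_two, spinEps] at key
  constructor
  · intro h0
    have h1 : ∀ A', polyOf (spinTwist g E f x A') = 0 := fun A' => by
      rw [show spinTwist g E f x A' = fun _ => 0 from funext (h0 A'), polyOf_zero]
    have k0 := (key 0).symm.trans (h1 0)
    have k1 := (key 1).symm.trans (h1 1)
    simp at k0 k1
    intro A'
    fin_cases A'
    · exact k1
    · exact k0
  · intro h0 A' α
    have h1 : polyOf (spinTwist g E f x A') = 0 := by
      rw [key, h0, h0]; simp
    exact congrFun ((isSymmSpinor_spinSymm _).eq_zero h1) α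

theorem evPoly_weylPoly :
    (2 : ℂ) • evPoly hx (h.frameAlgebra hp).weylPoly = polyOf (weylSpinor g E x) := by
  rw [weylSpinor, polyOf_spinSymm, ← map_smul, FrameAlgebra.two_smul_weylPoly, evPoly_polyOf]
  simp only [h.ev_curvX hp hx]

theorem evPoly_ZS (A' B' : Fin 2) : evPoly hx ((h.frameAlgebra hp).ZS A' B') =
    FrameAlgebra.quad fun A B => ricciSpinor g E x A B A' B' := by
  rw [FrameAlgebra.ZS, evPoly_quad]
  simp only [h.ev_ricci hp hx]

theorem ricciSpinor_symm (h : IsOrthonormalFrame g E U) (hp : U ⊆ (extChartAt (𝓡 4) p).source)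
    (hx : x ∈ U) (A B A' B' : Fin 2) : ricciSpinor g E x A B A' B' = ricciSpinor g E x B A A' B' := by
  rw [← h.ev_ricci hp hx, ← h.ev_ricci hp hx, FrameAlgebra.ricci_eq, FrameAlgebra.ricci_eq]
  simp only [FrameAlgebra.PS_symm _ _ _ A B]

end IsOrthonormalFrame

/-! ### The aligned matter condition as a bracket of forms -/

section Aligned

open MvPolynomial

theorem xDeriv_quad {φ : Fin 2 → Fin 2 → ℂ} (hφ : ∀ A B, φ A B = φ B A) (F : Fin 2) :
    xDeriv F (FrameAlgebra.quad φ) = ∑ A, C (φ A F) * X A := by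
  have h : FrameAlgebra.quad φ = (1 / 2 : ℂ) • polyOf (fun α : Fin 2 → Fin 2 => φ (α 0) (α 1)) := by
    rw [polyOf_two]; rfl
  have hs : IsSymmSpinor (fun α : Fin 2 → Fin 2 => φ (α 0) (α 1)) := fun π α => by
    have hπ : π = 1 ∨ π = Equiv.swap 0 1 := by revert π; decide
    rcases hπ with rfl | rfl
    · rfl
    · simp [hφ (α 1)]
  rw [h, Derivation.map_smul, xDeriv_polyOf hs, polyOf_succ]
  simp only [polyOf_zero_index, Fin.cons_zero, Fin.cons_one, smul_smul, hφ F, mul_comm (X _)]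
  norm_num

/-- The contraction `Ψ_{(ABC}{}^F Φ_{D)F}` as a bracket of polynomials. -/
theorem ham_quad_polyOf {φ : Fin 2 → Fin 2 → ℂ} (hφ : ∀ A B, φ A B = φ B A)
    {ψ : (Fin 4 → Fin 2) → ℂ} (hψ : IsSymmSpinor ψ) :
    ham (FrameAlgebra.quad φ) (polyOf ψ) = (4 : ℂ) • polyOf (fun β : Fin 4 → Fin 2 =>
      ∑ F, ∑ G, spinEps F G * ψ ![β 0, β 1, β 2, G] * φ (β 3) F) := by
  -- The contracted index is moved to the front, which is the slot that differentiation of the form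
  -- exposes.
  have hr : ∀ a b c d, ψ ![a, b, c, d] = ψ (Fin.cons d ![a, b, c]) := fun a b c d => by
    rw [← hψ (finRotate 4) (Fin.cons d ![a, b, c])]
    congr 1
    funext i
    fin_cases i <;> rfl
  have h4 : ((3 : ℕ) + 1 : ℂ) = 4 := by norm_num
  rw [ham_apply, xDeriv_quad hφ, xDeriv_quad hφ, xDeriv_polyOf hψ, xDeriv_polyOf hψ, polyOf_four, h4,
    polyOf_three, polyOf_three, mul_smul_comm, mul_smul_comm, ← smul_sub]
  congr 1
  simp only [hr, Matrix.cons_val, Fin.sum_univ_two, spinEps, Matrix.of_apply, map_add, map_mul,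
    Matrix.cons_val_fin_one, Matrix.cons_val_zero, Matrix.cons_val_one, map_neg, map_zero, map_one]
  ring

end Aligned

/-! ## Binary quartics over `ℂ` -/

section BinaryForms

open MvPolynomial Filter

/-- If `F` vanished at `0` to exact order `n ≥ 1`, the left side would have order `n - 1` and the
right side order at least `n`. -/
theorem polynomial_eq_zero_of_wronskian {F G : Polynomial ℂ} (hG : G.eval 0 ≠ 0) (hF : F.eval 0 = 0)
    (h : G * F.derivative = F * G.derivative) : F = 0 := by
  have key : ∀ n : ℕ, Polynomial.X ^ n ∣ F := by
    intro n
    induction n with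
    | zero => simp
    | succ n ih =>
      obtain ⟨u, rfl⟩ := ih
      have hu : u.eval 0 = 0 := by
        cases n with
        | zero => simpa using hF
        | succ m =>
          have h1 : (Polynomial.X : Polynomial ℂ) ^ m * (G * ((m + 1 : ℂ) • u)) =
              Polynomial.X ^ m * (Polynomial.X * (u * G.derivative - G * u.derivative)) := by
            rw [Polynomial.derivative_mul, Polynomial.derivative_X_pow] at h
            rw [Polynomial.smul_eq_C_mul]
            simp only [Nat.add_sub_cancel, Nat.cast_add, Nat.cast_one, map_add, map_natCast,
              map_one] at h ⊢
            linear_combination h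
          have h2 := mul_left_cancel₀ (pow_ne_zero m Polynomial.X_ne_zero) h1
          have h3 := congrArg (Polynomial.eval 0) h2
          simp only [Polynomial.eval_mul, Polynomial.eval_smul, Polynomial.eval_X, zero_mul,
            smul_eq_mul] at h3
          rcases mul_eq_zero.1 h3 with h4 | h4
          · exact absurd h4 hG
          · exact (mul_eq_zero.1 h4).resolve_left (by exact_mod_cast m.succ_ne_zero)
      obtain ⟨w, rfl⟩ := Polynomial.X_dvd_iff.2 ((Polynomial.coeff_zero_eq_eval_zero u).trans hu)
      exact ⟨w, by ring⟩
  ext n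
  exact Polynomial.X_pow_dvd_iff.1 (key (n + 1)) n n.lt_succ_self

/-- Restriction of a polynomial to the line `a + t v`. -/
def lineRestrict (a v : Fin 2 → ℂ) : SpinPoly ℂ →+* Polynomial ℂ :=
  eval₂Hom Polynomial.C fun i => Polynomial.C (a i) + Polynomial.X * Polynomial.C (v i)

theorem eval_lineRestrict (a v : Fin 2 → ℂ) (t : ℂ) (p : SpinPoly ℂ) :
    (lineRestrict a v p).eval t = eval (fun i => a i + t * v i) p := by
  have : (Polynomial.evalRingHom t).comp (lineRestrict a v) = eval (fun i => a i + t * v i) := by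
    apply MvPolynomial.ringHom_ext
    · intro r; simp [lineRestrict]
    · intro i; simp [lineRestrict, mul_comm t]
  exact congrArg (fun f : SpinPoly ℂ →+* ℂ => f p) this

theorem derivative_lineRestrict (a v : Fin 2 → ℂ) (p : SpinPoly ℂ) :
    (lineRestrict a v p).derivative =
      ∑ i, Polynomial.C (v i) * lineRestrict a v (xDeriv i p) := by
  induction p using MvPolynomial.induction_on with
  | C r => simp [lineRestrict]
  | add p q hp hq => simp only [map_add, hp, hq, mul_add, Finset.sum_add_distrib]
  | mul_X p j hp =>
    rw [map_mul, Polynomial.derivative_mul, hp]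
    simp only [Derivation.leibniz, smul_eq_mul, map_add, map_mul, xDeriv_X, Fin.sum_univ_two]
    have hX : ∀ j, lineRestrict a v (X j) = Polynomial.C (a j) + Polynomial.X * Polynomial.C (v j) := by
      intro j; simp [lineRestrict]
    simp only [hX]
    fin_cases j <;> simp <;> ring

/-- Two quartic forms with vanishing bracket are proportional. -/
theorem exists_eq_C_mul_of_ham_eq_zero {p q : SpinPoly ℂ}
    (hp : X 0 * xDeriv 0 p + X 1 * xDeriv 1 p = 4 * p)
    (hq : X 0 * xDeriv 0 q + X 1 * xDeriv 1 q = 4 * q) (h0 : p ≠ 0) (h : ham p q = 0) :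
    ∃ c : ℂ, q = C c * p := by
  rw [ham_apply] at h
  have h4 : (4 : SpinPoly ℂ) ≠ 0 := by norm_num
  -- Euler's identities turn the vanishing bracket into the vanishing of the differential of `q /
  -- p`.
  have e0 : p * xDeriv 0 q = q * xDeriv 0 p := by
    refine mul_left_cancel₀ h4 ?_
    linear_combination -xDeriv 0 q * hp + xDeriv 0 p * hq - X 1 * h
  have e1 : p * xDeriv 1 q = q * xDeriv 1 p := by
    refine mul_left_cancel₀ h4 ?_
    linear_combination -xDeriv 1 q * hp + xDeriv 1 p * hq + X 0 * h
  obtain ⟨a, ha⟩ : ∃ a, eval a p ≠ 0 := by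
    by_contra hcon
    push Not at hcon
    exact h0 (MvPolynomial.funext fun a => by rw [hcon, map_zero])
  refine ⟨eval a q / eval a p, ?_⟩
  -- The remainder satisfies the same equations as `q` and vanishes at `a`; restricted to any line
  -- through `a` it is zero by the Wronskian argument.
  obtain ⟨r, hr⟩ : ∃ r, r = q - C (eval a q / eval a p) * p := ⟨_, rfl⟩
  have hr0 : eval a r = 0 := by
    rw [hr, map_sub, map_mul, eval_C, div_mul_cancel₀ _ ha, sub_self]
  have r0 : p * xDeriv 0 r = r * xDeriv 0 p := by
    rw [hr, map_sub, Derivation.leibniz, xDeriv_C, smul_eq_mul, smul_eq_mul]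
    linear_combination e0
  have r1 : p * xDeriv 1 r = r * xDeriv 1 p := by
    rw [hr, map_sub, Derivation.leibniz, xDeriv_C, smul_eq_mul, smul_eq_mul]
    linear_combination e1
  rw [← sub_eq_zero, ← hr]
  refine MvPolynomial.funext fun b => ?_
  have hline := polynomial_eq_zero_of_wronskian (G := lineRestrict a (fun i => b i - a i) p)
    (F := lineRestrict a (fun i => b i - a i) r) (by simpa [eval_lineRestrict] using ha)
    (by simpa [eval_lineRestrict] using hr0)
    (by
      simp only [derivative_lineRestrict, Fin.sum_univ_two]
      have k0 := congrArg (lineRestrict a (fun i => b i - a i)) r0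
      have k1 := congrArg (lineRestrict a (fun i => b i - a i)) r1
      simp only [map_mul] at k0 k1
      linear_combination Polynomial.C (b 0 - a 0) * k0 + Polynomial.C (b 1 - a 1) * k1)
  have := congrArg (Polynomial.eval 1) hline
  simpa [eval_lineRestrict] using this

/-- The quadratic form with given coefficients. -/
def quadric {R : Type*} [CommRing R] (a b c : R) : SpinPoly R :=
  C a * (X 0 * X 0) + C b * (X 0 * X 1) + C c * (X 1 * X 1)

/-- Being the square of a quadratic form. -/
def IsFormSquare (p : SpinPoly ℂ) : Prop := ∃ a b c, p = quadric a b c * quadric a b c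

theorem C_mul_quadric {R : Type*} [CommRing R] (r a b c : R) :
    C r * quadric a b c = quadric (r * a) (r * b) (r * c) := by
  simp only [quadric, map_mul]; ring

theorem quadric_euler (a b c : ℂ) :
    X 0 * xDeriv 0 (quadric a b c) + X 1 * xDeriv 1 (quadric a b c) = 2 * quadric a b c := by
  simp only [quadric, map_add, Derivation.leibniz, xDeriv_C, xDeriv_X_self, xDeriv_zero_X_one,
    xDeriv_one_X_zero, smul_eq_mul]
  ring

theorem eval_quadric (a b c : ℂ) (y : Fin 2 → ℂ) :
    eval y (quadric a b c) = a * (y 0 * y 0) + b * (y 0 * y 1) + c * (y 1 * y 1) := by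
  simp [quadric]

/-- A quartic form with an infinitesimal symmetry is a square. -/
theorem quadric_eq_zero_of_ham {p : SpinPoly ℂ} (hp : X 0 * xDeriv 0 p + X 1 * xDeriv 1 p = 4 * p)
    (hs : ¬IsFormSquare p) {a b c : ℂ} (h : ham (quadric a b c) p = 0) : quadric a b c = 0 := by
  by_contra h0
  -- The square of the quadric is a quartic with the same symmetry, so `p` is a multiple of it; a
  -- square root of the factor is absorbed into the quadric.
  obtain ⟨r, hr⟩ := exists_eq_C_mul_of_ham_eq_zero (p := quadric a b c * quadric a b c) (q := p) (by
      rw [Derivation.leibniz, Derivation.leibniz, smul_eq_mul, smul_eq_mul]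
      linear_combination 2 * quadric a b c * quadric_euler a b c) hp (mul_ne_zero h0 h0) (by
      rw [ham_apply] at h ⊢
      rw [Derivation.leibniz, Derivation.leibniz, smul_eq_mul, smul_eq_mul]
      linear_combination 2 * quadric a b c * h)
  obtain ⟨t, ht⟩ := IsAlgClosed.exists_pow_nat_eq r two_pos
  refine hs ⟨t * a, t * b, t * c, ?_⟩
  rw [← C_mul_quadric, hr, ← ht, map_pow]
  ring

theorem quadric_coeff_eq_zero {a b c : ℂ} (h : quadric a b c = 0) : a = 0 ∧ b = 0 ∧ c = 0 := by
  have h1 := congrArg (eval ![1, 0]) h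
  have h2 := congrArg (eval ![0, 1]) h
  have h3 := congrArg (eval ![1, 1]) h
  simp only [eval_quadric, map_zero, Matrix.cons_val_zero, Matrix.cons_val_one] at h1 h2 h3
  refine ⟨by linear_combination h1, by linear_combination h3 - h1 - h2, by linear_combination h2⟩

/-- Squares are closed: the values at three spinors bound the coefficients of the roots, and a
convergent subsequence of roots has the required square. -/
theorem IsFormSquare.of_tendsto {P : ℕ → SpinPoly ℂ} {Q : SpinPoly ℂ}
    (h : ∀ y, Tendsto (fun n => eval y (P n)) atTop (nhds (eval y Q))) (hP : ∀ n, IsFormSquare (P n)) :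
    IsFormSquare Q := by
  choose a b c habc using hP
  have hq : ∀ n y, eval y (P n) = eval y (quadric (a n) (b n) (c n)) ^ 2 := fun n y => by
    rw [habc, map_mul, sq]
  have hb : ∀ y, ∃ K : ℝ, ∀ n, ‖eval y (quadric (a n) (b n) (c n))‖ ≤ K := fun y => by
    obtain ⟨K, hK⟩ := (h y).norm.bddAbove_range
    -- A real number with square at most `K` is at most `K + 1`.
    refine ⟨K + 1, fun n => ?_⟩
    have h1 : ‖eval y (quadric (a n) (b n) (c n))‖ ^ 2 ≤ K := by
      rw [← norm_pow, ← hq]; exact hK ⟨n, rfl⟩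
    nlinarith [norm_nonneg (eval y (quadric (a n) (b n) (c n)))]
  obtain ⟨K1, h1⟩ := hb ![1, 0]
  obtain ⟨K2, h2⟩ := hb ![0, 1]
  obtain ⟨K3, h3⟩ := hb ![1, 1]
  simp only [eval_quadric, Matrix.cons_val_zero, Matrix.cons_val_one, mul_one, mul_zero, add_zero,
    zero_add] at h1 h2 h3
  have hbd : ∀ n, (a n, b n, c n) ∈ Metric.closedBall (0 : ℂ × ℂ × ℂ) (K1 + K2 + K3) := fun n => by
    have ha := h1 n
    have hc := h2 n
    have hb' : ‖b n‖ ≤ K1 + K2 + K3 := by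
      have : b n = (a n + b n + c n) - a n - c n := by ring
      rw [this]
      have e1 := norm_sub_le (a n + b n + c n - a n) (c n)
      have e2 := norm_sub_le (a n + b n + c n) (a n)
      linarith [h3 n]
    have p1 := norm_nonneg (a n)
    have p2 := norm_nonneg (c n)
    have p3 := (norm_nonneg _).trans (h3 n)
    rw [mem_closedBall_zero_iff, Prod.norm_def, Prod.norm_def]
    exact max_le (by simp only; linarith) (max_le hb' (by simp only; linarith))
  obtain ⟨⟨a', b', c'⟩, -, φ, hφ, hlim⟩ := tendsto_subseq_of_bounded Metric.isBounded_closedBall hbd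
  have la := (continuous_fst.tendsto _).comp hlim
  have lb := ((continuous_fst.comp continuous_snd).tendsto _).comp hlim
  have lc := ((continuous_snd.comp continuous_snd).tendsto _).comp hlim
  refine ⟨a', b', c', MvPolynomial.funext fun y => ?_⟩
  have l1 : Tendsto (fun n => eval y (quadric (a (φ n)) (b (φ n)) (c (φ n))) ^ 2) atTop
      (nhds (eval y (quadric a' b' c') ^ 2)) := by
    simp only [eval_quadric]
    exact (((la.mul_const _).add (lb.mul_const _)).add (lc.mul_const _)).pow 2
  have l2 := (h y).comp hφ.tendsto_atTop
  have l3 : (fun n => eval y (quadric (a (φ n)) (b (φ n)) (c (φ n))) ^ 2) =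
      (fun n => eval y (P n)) ∘ φ := by
    funext n; exact (hq (φ n) y).symm
  rw [l3] at l1
  rw [tendsto_nhds_unique l2 l1, map_mul, sq]

end BinaryForms


/-! ## Uniqueness for logarithmic differential equations -/

/-- Grönwall's inequality along the segment from the centre of the ball. -/
theorem eq_zero_of_norm_fderiv_le {E : Type*} [NormedAddCommGroup E] [NormedSpace ℝ E] {F : E → ℂ}
    {z₀ : E} {r K : ℝ} (hd : ∀ z ∈ Metric.ball z₀ r, DifferentiableAt ℝ F z)
    (hK : ∀ z ∈ Metric.ball z₀ r, ‖fderiv ℝ F z‖ ≤ K * ‖F z‖) (h0 : F z₀ = 0) {z : E}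
    (hz : z ∈ Metric.ball z₀ r) : F z = 0 := by
  set γ : ℝ → E := fun t => z₀ + t • (z - z₀) with hγ
  have hmem : ∀ t ∈ Set.Icc (0 : ℝ) 1, γ t ∈ Metric.ball z₀ r := fun t ht => by
    rw [mem_ball_iff_norm] at hz ⊢
    rw [hγ]
    simp only [add_sub_cancel_left, norm_smul, Real.norm_eq_abs, abs_of_nonneg ht.1]
    nlinarith [norm_nonneg (z - z₀), ht.2]
  have hγd : ∀ t, HasDerivAt γ (z - z₀) t := fun t => by
    have h1 := ((hasDerivAt_id t).smul_const (z - z₀)).const_add z₀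
    rw [one_smul] at h1
    exact h1
  have hFd : ∀ t ∈ Set.Icc (0 : ℝ) 1, HasDerivAt (F ∘ γ) (fderiv ℝ F (γ t) (z - z₀)) t := fun t ht =>
    (hd _ (hmem t ht)).hasFDerivAt.comp_hasDerivAt t (hγd t)
  have := norm_le_gronwallBound_of_norm_deriv_right_le (f := F ∘ γ) (δ := 0) (ε := 0)
    (K := K * ‖z - z₀‖) (a := 0) (b := 1) (fun t ht => (hFd t ht).continuousAt.continuousWithinAt)
    (fun t ht => (hFd t (Set.Ico_subset_Icc_self ht)).hasDerivWithinAt) (by simp [hγ, h0])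
    (fun t ht => by
      have h1 := hK _ (hmem t (Set.Ico_subset_Icc_self ht))
      have h2 := (fderiv ℝ F (γ t)).le_opNorm (z - z₀)
      have h3 := mul_le_mul_of_nonneg_right h1 (norm_nonneg (z - z₀))
      simp only [Function.comp_apply]
      linarith) 1 (by simp)
  rw [gronwallBound_ε0_δ0] at this
  simpa [hγ] using this

theorem clm_eq_sum_single (T : EuclideanSpace ℝ (Fin 4) →L[ℝ] ℂ) (w : EuclideanSpace ℝ (Fin 4)) :
    T w = ∑ j, (w j : ℂ) * T (EuclideanSpace.single j 1) := by
  have h1 : w = ∑ j, w j • EuclideanSpace.single j (1 : ℝ) := by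
    ext i
    simp [Finset.sum_apply, Pi.single_apply]
  conv_lhs => rw [h1]
  simp

namespace smoothRing

variable {U : Set M}

theorem exists_inv {r : smoothRing U} (hr : ∀ x (hx : x ∈ U), ev hx r ≠ 0) : ∃ s, s * r = 1 := by
  refine ⟨mk (fun x => (lift r x)⁻¹) ((lift_smooth r).inv₀ fun x hx => ?_), ext_ev fun x hx => ?_⟩
  · rw [← ev_eq_lift hx]; exact hr x hx
  · rw [map_mul, ev_mk, ← ev_eq_lift hx, inv_mul_cancel₀ (hr x hx), map_one]

theorem continuousAt_lift (hU : IsOpen U) (r : smoothRing U) {x : M} (hx : x ∈ U) :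
    ContinuousAt (lift r) x :=
  ((lift_smooth r).contMDiffAt (hU.mem_nhds hx)).continuousAt

end smoothRing

namespace IsOrthonormalFrame

open smoothRing

variable {g : LorentzMetric M} {E : Fin 4 → (x : M) → TangentSpace (𝓡 4) x} {U : Set M}
  (h : IsOrthonormalFrame g E U) {p : M} (hp : U ⊆ (extChartAt (𝓡 4) p).source)

/-- The coordinates of the chart at `p`. -/
def coord (hp : U ⊆ (extChartAt (𝓡 4) p).source) (i : Fin 4) : smoothRing U :=
  smoothRing.mk (fun y => (extChartAt (𝓡 4) p y i : ℂ)) ((contMDiffOn_coord p i).mono hp).ofReal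

theorem ev_D_coord {x : M} (hx : x ∈ U) (a i : Fin 4) :
    ev hx ((h.frameAlgebra hp).D a (coord hp i)) =
      ((dirDeriv (fun y => extChartAt (𝓡 4) p y i) x (E a x) : ℝ) : ℂ) := by
  rw [h.ev_D hp hx a _ (fun y => (extChartAt (𝓡 4) p y i : ℂ)) (fun y hy => rfl),
    dirDeriv_ofReal (((contMDiffOn_coord p i).mono hp).mdifferentiableAt_of_mem h.isOpen hx)]

/-- The matrix that expresses the coordinate derivatives by the frame derivatives. -/
theorem exists_coordMatrix : ∃ B : Matrix (Fin 4) (Fin 4) (smoothRing U),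
    ∀ i j, ∑ a, B i a * (h.frameAlgebra hp).D a (coord hp j) = if i = j then 1 else 0 := by
  set A : Matrix (Fin 4) (Fin 4) (smoothRing U) :=
    Matrix.of fun a i => (h.frameAlgebra hp).D a (coord hp i) with hA
  have hdet : ∀ x (hx : x ∈ U), ev hx A.det ≠ 0 := fun x hx h0 => by
    have h1 : (A.map (ev hx)).det = 0 := by
      rw [← h0]; exact (RingHom.map_det (ev hx).toRingHom A).symm
    obtain ⟨v, hv, hv2⟩ := Matrix.exists_vecMul_eq_zero_iff.2 h1
    refine hv (h.coeff_eq_zero_complex hp hx v fun i => ?_)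
    have := congrFun hv2 i
    refine Eq.trans ?_ this
    simp only [Matrix.vecMul, dotProduct, Matrix.map_apply, hA, Matrix.of_apply, h.ev_D_coord hp hx]
  obtain ⟨s, hs⟩ := exists_inv hdet
  refine ⟨s • A.adjugate, fun i j => ?_⟩
  have h1 : (s • A.adjugate * A) i j = (1 : Matrix (Fin 4) (Fin 4) (smoothRing U)) i j := by
    rw [Matrix.smul_mul, Matrix.adjugate_mul, smul_smul, hs, one_smul]
  rw [Matrix.mul_apply, Matrix.one_apply] at h1
  exact h1

theorem _root_.dirDeriv_eq_sum_coord {f : M → ℂ} {x : M} (hx : x ∈ (extChartAt (𝓡 4) p).source)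
    (hf : DifferentiableAt ℝ (f ∘ (extChartAt (𝓡 4) p).symm) (extChartAt (𝓡 4) p x))
    (v : TangentSpace (𝓡 4) x) :
    dirDeriv f x v = ∑ j, ((dirDeriv (fun y => extChartAt (𝓡 4) p y j) x v : ℝ) : ℂ) *
      fderiv ℝ (f ∘ (extChartAt (𝓡 4) p).symm) (extChartAt (𝓡 4) p x)
        (EuclideanSpace.single j 1) := by
  have hd : MDifferentiableAt (𝓡 4) 𝓘(ℝ, EuclideanSpace ℝ (Fin 4)) (extChartAt (𝓡 4) p) x :=
    mdifferentiableAt_extChartAt (by rwa [extChartAt_source] at hx)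
  have h1 : HasMFDerivAt (𝓡 4) 𝓘(ℝ, ℂ) ((f ∘ (extChartAt (𝓡 4) p).symm) ∘ extChartAt (𝓡 4) p) x
      ((fderiv ℝ (f ∘ (extChartAt (𝓡 4) p).symm) (extChartAt (𝓡 4) p x)).comp
        (mfderiv (𝓡 4) 𝓘(ℝ, EuclideanSpace ℝ (Fin 4)) (extChartAt (𝓡 4) p) x)) :=
    HasMFDerivAt.comp x hf.hasFDerivAt.hasMFDerivAt hd.hasMFDerivAt
  have h2 : f =ᶠ[nhds x] (f ∘ (extChartAt (𝓡 4) p).symm) ∘ extChartAt (𝓡 4) p := by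
    filter_upwards [(isOpen_extChartAt_source (I := 𝓡 4) p).mem_nhds hx] with y hy
    simp only [Function.comp_apply, (extChartAt (𝓡 4) p).left_inv hy]
  have h3 : ∀ j, dirDeriv (fun y => extChartAt (𝓡 4) p y j) x v =
      (show EuclideanSpace ℝ (Fin 4) from
        mfderiv (𝓡 4) 𝓘(ℝ, EuclideanSpace ℝ (Fin 4)) (extChartAt (𝓡 4) p) x v) j := fun j => by
    have h4 : HasMFDerivAt (𝓡 4) 𝓘(ℝ, ℝ) (fun y => extChartAt (𝓡 4) p y j) x
        ((EuclideanSpace.proj (𝕜 := ℝ) j : EuclideanSpace ℝ (Fin 4) →L[ℝ] ℝ).comp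
          (mfderiv (𝓡 4) 𝓘(ℝ, EuclideanSpace ℝ (Fin 4)) (extChartAt (𝓡 4) p) x)) :=
      (EuclideanSpace.proj (𝕜 := ℝ) j : EuclideanSpace ℝ (Fin 4) →L[ℝ] ℝ).hasMFDerivAt.comp x
        hd.hasMFDerivAt
    unfold dirDeriv
    rw [h4.mfderiv]
    rfl
  simp only [h3]
  unfold dirDeriv
  rw [(h1.congr_of_eventuallyEq h2).mfderiv]
  change fderiv ℝ (f ∘ (extChartAt (𝓡 4) p).symm) (extChartAt (𝓡 4) p x)
    (mfderiv (𝓡 4) 𝓘(ℝ, EuclideanSpace ℝ (Fin 4)) (extChartAt (𝓡 4) p) x v) = _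
  exact clm_eq_sum_single _ _

/-- The equations say `dc = c η` for a one-form `η` with continuous coefficients, which is bounded
near `x₀`; uniqueness along segments in the chart does the rest. -/
theorem eventually_eq_zero {c : smoothRing U} {θ : Fin 4 → smoothRing U}
    (hc : ∀ a, (h.frameAlgebra hp).D a c = θ a * c) {x₀ : M} (hx₀ : x₀ ∈ U) (h0 : lift c x₀ = 0) :
    ∀ᶠ x in nhds x₀, lift c x = 0 := by
  obtain ⟨B, hB⟩ := h.exists_coordMatrix hp
  set φ := extChartAt (𝓡 4) p with hφ
  set F : EuclideanSpace ℝ (Fin 4) → ℂ := lift c ∘ φ.symm with hF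
  have hUn : U ∈ nhds x₀ := h.isOpen.mem_nhds hx₀
  have hpre : ∀ᶠ z in nhds (φ x₀), z ∈ φ.target ∧ φ.symm z ∈ U := by
    have h1 : φ.target ∈ nhds (φ x₀) := (isOpen_extChartAt_target (I := 𝓡 4) p).mem_nhds (φ.map_source (hp hx₀))
    have h2 : ContinuousAt φ.symm (φ x₀) := continuousAt_extChartAt_symm' (hp hx₀)
    have h3 : φ.symm (φ x₀) = x₀ := φ.left_inv (hp hx₀)
    exact Filter.Eventually.and h1 (h2.eventually (by rw [h3]; exact hUn))
  -- The coefficients of the equation in coordinates: `B` converts frame derivatives to coordinate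
  -- derivatives.
  set β : Fin 4 → smoothRing U := fun i => ∑ a, B i a * θ a with hβ
  have hder : ∀ z, z ∈ φ.target → φ.symm z ∈ U → DifferentiableAt ℝ F z ∧
      ∀ i, fderiv ℝ F z (EuclideanSpace.single i 1) = lift (β i) (φ.symm z) * F z := by
    intro z hz hzU
    have hd : DifferentiableAt ℝ F z := by
      have h1 : ContMDiffAt 𝓘(ℝ, EuclideanSpace ℝ (Fin 4)) 𝓘(ℝ, ℂ) ∞ F z :=
        ((lift_smooth c).contMDiffAt (h.isOpen.mem_nhds hzU)).comp z
          ((contMDiffOn_extChartAt_symm (n := ∞) (I := 𝓡 4) p).contMDiffAt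
            ((isOpen_extChartAt_target (I := 𝓡 4) p).mem_nhds hz))
      exact (contMDiffAt_iff_contDiffAt.1 h1).differentiableAt (by simp)
    refine ⟨hd, fun i => ?_⟩
    have hφz : φ (φ.symm z) = z := φ.right_inv hz
    have hDc : ∀ a, ev hzU ((h.frameAlgebra hp).D a c) =
        ∑ j, ev hzU ((h.frameAlgebra hp).D a (coord hp j)) *
          fderiv ℝ F z (EuclideanSpace.single j 1) := fun a => by
      rw [h.ev_D hp hzU a c (lift c) (fun y hy => ev_eq_lift hy _),
        dirDeriv_eq_sum_coord (p := p) (hp hzU) (by rw [← hφ, hφz]; exact hd)]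
      simp only [h.ev_D_coord hp hzU]
      rw [← hφ, hφz]
    calc fderiv ℝ F z (EuclideanSpace.single i 1)
        = ∑ j, ev hzU (∑ a, B i a * (h.frameAlgebra hp).D a (coord hp j)) *
            fderiv ℝ F z (EuclideanSpace.single j 1) := by
          simp only [hB, apply_ite (ev hzU), map_one, map_zero, ite_mul, one_mul, zero_mul,
            Finset.sum_ite_eq, Finset.mem_univ, if_true]
      _ = ∑ a, ev hzU (B i a) * ev hzU ((h.frameAlgebra hp).D a c) := by
          simp only [hDc, map_sum, map_mul, Finset.sum_mul, Finset.mul_sum]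
          rw [Finset.sum_comm]
          simp only [mul_assoc]
      _ = lift (β i) (φ.symm z) * F z := by
          rw [hF, Function.comp_apply, ← ev_eq_lift hzU, ← ev_eq_lift hzU, ← map_mul, hβ,
            Finset.sum_mul, map_sum]
          refine Finset.sum_congr rfl fun a _ => ?_
          rw [hc, ← map_mul, mul_assoc]
  have hbd : ∀ i, ∀ᶠ z in nhds (φ x₀), ‖lift (β i) (φ.symm z)‖ < ‖lift (β i) x₀‖ + 1 := fun i => by
    have h3 : φ.symm (φ x₀) = x₀ := φ.left_inv (hp hx₀)
    have h2 : ContinuousAt (fun z => lift (β i) (φ.symm z)) (φ x₀) :=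
      ContinuousAt.comp (by rw [h3]; exact continuousAt_lift h.isOpen (β i) hx₀)
        (continuousAt_extChartAt_symm' (hp hx₀))
    refine h2.norm.eventually_lt_const ?_
    simp only [h3, lt_add_iff_pos_right, zero_lt_one]
  obtain ⟨r, hr, hball⟩ := Metric.eventually_nhds_iff_ball.1 (hpre.and (Filter.eventually_all.2 hbd))
  have hzero : ∀ z ∈ Metric.ball (φ x₀) r, F z = 0 := fun z hz =>
    eq_zero_of_norm_fderiv_le (K := ∑ i, (‖lift (β i) x₀‖ + 1))
      (fun z hz => (hder z (hball z hz).1.1 (hball z hz).1.2).1)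
      (fun z hz => by
        obtain ⟨⟨h1, h2⟩, h3⟩ := hball z hz
        refine ContinuousLinearMap.opNorm_le_bound _ (mul_nonneg (Finset.sum_nonneg fun i _ =>
          add_nonneg (norm_nonneg _) zero_le_one) (norm_nonneg _)) fun w => ?_
        rw [clm_eq_sum_single, Finset.sum_mul, Finset.sum_mul]
        refine (norm_sum_le _ _).trans (Finset.sum_le_sum fun i _ => ?_)
        rw [(hder z h1 h2).2 i, norm_mul, norm_mul, Complex.norm_real, mul_comm]
        exact mul_le_mul (mul_le_mul_of_nonneg_right (h3 i).le (norm_nonneg _))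
          (PiLp.norm_apply_le w i) (norm_nonneg _) (by positivity))
      (by rw [hF, Function.comp_apply, φ.left_inv (hp hx₀), h0]) hz
  have hcont : ContinuousAt φ x₀ := continuousAt_extChartAt' (hp hx₀)
  filter_upwards [hcont.eventually (Metric.ball_mem_nhds _ hr), hUn] with x hx hxU
  have := hzero (φ x) hx
  rwa [hF, Function.comp_apply, φ.left_inv (hp hxU)] at this

end IsOrthonormalFrame


/-! ## Killing spinors of valence `(4,0)` in a frame and a chart -/

open MvPolynomial Filter smoothRing

/-- The components `f` in the frame `E` of a Killing spinor of valence `(4,0)` on an open subset of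
the domain of the chart at `p`, where the Weyl spinor does not vanish and the matter is aligned. -/
structure LocalKilling (g : LorentzMetric M) (E : Fin 4 → (x : M) → TangentSpace (𝓡 4) x)
    (U : Set M) (p : M) (f : M → (Fin 4 → Fin 2) → ℂ) : Prop where
  frame : IsOrthonormalFrame g E U
  chart : U ⊆ (extChartAt (𝓡 4) p).source
  smooth (α : Fin 4 → Fin 2) : ContMDiffOn (𝓡 4) 𝓘(ℝ, ℂ) ∞ (fun x => f x α) U
  symm (x : M) (hx : x ∈ U) : IsSymmSpinor (f x)
  twist (x : M) (hx : x ∈ U) (A' : Fin 2) (α : Fin 5 → Fin 2) : spinTwist g E f x A' α = 0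
  weyl (x : M) (hx : x ∈ U) : weylSpinor g E x ≠ 0
  aligned (x : M) (hx : x ∈ U) (A' B' : Fin 2) (α : Fin 4 → Fin 2) :
    spinSymm (fun β : Fin 4 → Fin 2 => ∑ F, ∑ G,
      spinEps F G * weylSpinor g E x ![β 0, β 1, β 2, G] * ricciSpinor g E x (β 3) F A' B') α = 0

/-! ### A pointwise square by contradiction -/

namespace LocalKilling

variable {g : LorentzMetric M} {E : Fin 4 → (x : M) → TangentSpace (𝓡 4) x} {U : Set M} {p : M}
  {f : M → (Fin 4 → Fin 2) → ℂ}

theorem mono (h : LocalKilling g E U p f) {V : Set M} (hV : IsOpen V) (hVU : V ⊆ U) :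
    LocalKilling g E V p f where
  frame := h.frame.mono hV hVU
  chart := hVU.trans h.chart
  smooth α := (h.smooth α).mono hVU
  symm x hx := h.symm x (hVU hx)
  twist x hx := h.twist x (hVU hx)
  weyl x hx := h.weyl x (hVU hx)
  aligned x hx := h.aligned x (hVU hx)

/-- The algebra of smooth functions with the derivations of the frame. -/
abbrev algebra (h : LocalKilling g E U p f) : FrameAlgebra (smoothRing U) :=
  h.frame.frameAlgebra h.chart

/-- The quartic form with smooth coefficients. -/
def poly (h : LocalKilling g E U p f) : SpinPoly (smoothRing U) :=
  polyOf fun α => smoothRing.mk (fun x => f x α) (h.smooth α)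

theorem evPoly_poly (h : LocalKilling g E U p f)
    {x : M} (hx : x ∈ U) : evPoly hx h.poly = polyOf (f x) := by
  rw [poly, evPoly_polyOf]
  simp only [ev_mk]

theorem twist_poly (h : LocalKilling g E U p f) (A' : Fin 2) : h.algebra.twist A' h.poly = 0 :=
  ext_evPoly fun x hx => by
    rw [map_zero]
    exact (h.frame.twist_eq_zero_iff h.chart hx _ f (fun y hy α => ev_mk _ _ hy)).1 (h.twist x hx) A'

theorem euler (h : LocalKilling g E U p f) {x : M} (hx : x ∈ U) :
    X 0 * xDeriv 0 (polyOf (f x)) + X 1 * xDeriv 1 (polyOf (f x)) = 4 * polyOf (f x) := by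
  rw [polyOf_euler (h.symm x hx), smul_eq_C_mul, ← map_ofNat C 4]
  norm_num

theorem euler_poly (h : LocalKilling g E U p f) :
    X 0 * xDeriv 0 h.poly + X 1 * xDeriv 1 h.poly = 4 * h.poly :=
  ext_evPoly fun x hx => by
    simp only [map_add, map_mul, evPoly_X, evPoly_xDeriv, h.evPoly_poly hx, h.euler hx, map_ofNat]

theorem weylSpinor_symm (x : M) : IsSymmSpinor (weylSpinor g E x) :=
  isSymmSpinor_spinSymm _

theorem euler_weyl (x : M) : X 0 * xDeriv 0 (polyOf (weylSpinor g E x)) +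
    X 1 * xDeriv 1 (polyOf (weylSpinor g E x)) = 4 * polyOf (weylSpinor g E x) := by
  rw [polyOf_euler (weylSpinor_symm x), smul_eq_C_mul, ← map_ofNat C 4]
  norm_num

theorem polyOf_weyl_ne_zero (h : LocalKilling g E U p f)
    {x : M} (hx : x ∈ U) : polyOf (weylSpinor g E x) ≠ 0 := fun h0 =>
  h.weyl x hx (IsSymmSpinor.eq_zero (weylSpinor_symm x) h0)

theorem evPoly_weylPoly (h : LocalKilling g E U p f) {x : M} (hx : x ∈ U) :
    evPoly hx h.algebra.weylPoly = (1 / 2 : ℂ) • polyOf (weylSpinor g E x) := by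
  rw [← h.frame.evPoly_weylPoly h.chart hx, smul_smul]
  norm_num

theorem ham_weyl (h : LocalKilling g E U p f)
    {x : M} (hx : x ∈ U) : ham (polyOf (weylSpinor g E x)) (polyOf (f x)) = 0 := by
  rw [← h.frame.evPoly_weylPoly h.chart hx, ← h.evPoly_poly hx, ham_smul, Derivation.smul_apply,
    ← evPoly_ham, h.algebra.ham_weylPoly_eq_zero h.twist_poly, map_zero, smul_zero]

theorem exists_eq_C_mul_weyl (h : LocalKilling g E U p f) {x : M} (hx : x ∈ U) :
    ∃ c : ℂ, polyOf (f x) = C c * polyOf (weylSpinor g E x) :=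
  exists_eq_C_mul_of_ham_eq_zero (euler_weyl x) (h.euler hx) (h.polyOf_weyl_ne_zero hx)
    (h.ham_weyl hx)

/-- Alignment of the matter is the vanishing of the bracket with `Ψ`, and `L` is a multiple of `Ψ`
at each point. -/
theorem ham_ricci (h : LocalKilling g E U p f) {x : M} (hx : x ∈ U) (A' B' : Fin 2) :
    ham (FrameAlgebra.quad fun A B => ricciSpinor g E x A B A' B') (polyOf (f x)) = 0 := by
  obtain ⟨c, hc⟩ := h.exists_eq_C_mul_weyl hx
  rw [hc, ← smul_eq_C_mul, Derivation.map_smul,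
    ham_quad_polyOf (fun A B => h.frame.ricciSpinor_symm h.chart hx A B A' B')
      (weylSpinor_symm x), ← polyOf_spinSymm, funext (h.aligned x hx A' B'), polyOf_zero,
    smul_zero, smul_zero]

theorem quad_eq_quadric (φ : Fin 2 → Fin 2 → ℂ) (hφ : ∀ A B, φ A B = φ B A) :
    FrameAlgebra.quad φ = quadric (1 / 2 * φ 0 0) (φ 0 1) (1 / 2 * φ 1 1) := by
  have h2 : (C (1 / 2 : ℂ) : SpinPoly ℂ) * 2 = 1 := by
    rw [← map_ofNat C 2, ← C_mul]; norm_num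
  simp only [FrameAlgebra.quad, quadric, Fin.sum_univ_two, hφ 1 0, smul_eq_C_mul, C_mul]
  linear_combination (C (φ 0 1) * (X 0 * X 1)) * h2

/-- A non-square quartic has no infinitesimal symmetry. This first kills the Ricci spinor and then,
through the prolonged equation, the Weyl spinor. -/
theorem false_of_not_isFormSquare (h : LocalKilling g E U p f) {m : Fin 2 →₀ ℕ}
    (hm : ∀ x ∈ U, coeff m (polyOf (f x)) ≠ 0) (hs : ∀ x ∈ U, ¬IsFormSquare (polyOf (f x)))
    {x₀ : M} (hx₀ : x₀ ∈ U) : False := by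
  have hev : ∀ x (hx : x ∈ U), ev hx (coeff m h.poly) = coeff m (polyOf (f x)) := fun x hx => by
    rw [← coeff_evPoly, h.evPoly_poly hx]
  obtain ⟨s, hs1⟩ := exists_inv (r := coeff m h.poly) fun x hx => by rw [hev]; exact hm x hx
  -- The proportionality factor is known only pointwise; dividing by the nonvanishing coefficient at
  -- `m` makes it a smooth function.
  obtain ⟨b, hb⟩ : ∃ b, b = coeff m h.algebra.weylPoly * s := ⟨_, rfl⟩
  have hprop : ∀ x (hx : x ∈ U), evPoly hx h.algebra.weylPoly = C (ev hx b) * polyOf (f x) := by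
    intro x hx
    have h0 : polyOf (f x) ≠ 0 := fun h0 => hm x hx (by rw [h0, coeff_zero])
    have h1 : ham (polyOf (f x)) (polyOf (weylSpinor g E x)) = 0 := by
      have := h.ham_weyl hx
      rw [ham_apply] at this ⊢
      linear_combination -this
    obtain ⟨c, hc⟩ := exists_eq_C_mul_of_ham_eq_zero (h.euler hx) (euler_weyl x) h0 h1
    have h2 : evPoly hx h.algebra.weylPoly = C (1 / 2 * c) * polyOf (f x) := by
      rw [h.evPoly_weylPoly hx, hc, smul_eq_C_mul, C_mul, mul_assoc]
    have h3 : ev hx b = 1 / 2 * c := by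
      have h4 := congrArg (ev hx) hs1
      rw [map_mul, hev, map_one] at h4
      rw [hb, map_mul, ← coeff_evPoly, h2, coeff_C_mul]
      linear_combination (1 / 2 * c) * h4
    rw [h3, h2]
  obtain ⟨c, hc⟩ := exists_inv (r := b) fun x hx h0 => by
    have h1 := hprop x hx
    rw [h0, C_0, zero_mul, h.evPoly_weylPoly hx] at h1
    exact h.polyOf_weyl_ne_zero hx ((smul_eq_zero.1 h1).resolve_left (by norm_num))
  have hZ : ∀ A' B', h.algebra.ZS A' B' = 0 := fun A' B' => ext_evPoly fun x hx => by
    have h1 := h.ham_ricci hx A' B'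
    rw [h.frame.evPoly_ZS h.chart hx, map_zero]
    rw [quad_eq_quadric _ fun A B => h.frame.ricciSpinor_symm h.chart hx A B A' B'] at h1 ⊢
    exact quadric_eq_zero_of_ham (h.euler hx) (hs x hx) h1
  have h0 : h.algebra.weylPoly = 0 := by
    refine h.algebra.weylPoly_eq_zero h.euler_poly h.twist_poly hZ hc
      (ext_evPoly fun x hx => by rw [hprop x hx, map_mul, evPoly_C, h.evPoly_poly hx]) ?_
    intro a₀ a₁ a₂ ha
    have key : ∀ x (hx : x ∈ U), ev hx a₀ = 0 ∧ ev hx a₁ = 0 ∧ ev hx a₂ = 0 := fun x hx => by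
      refine quadric_coeff_eq_zero (quadric_eq_zero_of_ham (h.euler hx) (hs x hx) ?_)
      have h1 := congrArg (evPoly hx) ha
      simpa only [quadric, evPoly_ham, map_add, map_mul, evPoly_C, evPoly_X, h.evPoly_poly hx, map_zero]
        using h1
    exact ⟨ext_ev fun x hx => by rw [(key x hx).1, map_zero],
      ext_ev fun x hx => by rw [(key x hx).2.1, map_zero],
      ext_ev fun x hx => by rw [(key x hx).2.2, map_zero]⟩
  have h1 := hprop x₀ hx₀
  rw [h.evPoly_weylPoly hx₀] at h1
  have h2 := h.evPoly_weylPoly hx₀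
  rw [h0, map_zero] at h2
  exact h.polyOf_weyl_ne_zero hx₀ ((smul_eq_zero.1 h2.symm).resolve_left (by norm_num))

theorem continuousAt_coeff (h : LocalKilling g E U p f) (m : Fin 2 →₀ ℕ) {x : M} (hx : x ∈ U) :
    ContinuousAt (fun y => coeff m (polyOf (f y))) x := by
  refine (continuousAt_lift h.frame.isOpen (coeff m h.poly) hx).congr ?_
  filter_upwards [h.frame.isOpen.mem_nhds hx] with y hy
  rw [← ev_eq_lift hy, ← coeff_evPoly, h.evPoly_poly hy]

theorem continuousAt_eval (h : LocalKilling g E U p f) (v : Fin 2 → ℂ) {x : M} (hx : x ∈ U) :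
    ContinuousAt (fun y => eval v (polyOf (f y))) x := by
  simp only [polyOf_four, map_sum, map_mul, eval_C, eval_X]
  have hc : ∀ α, ContinuousAt (fun y => f y α) x := fun α =>
    ((h.smooth α).contMDiffAt (h.frame.isOpen.mem_nhds hx)).continuousAt
  fun_prop

/-- Being a square is a closed condition, so a failure at one point would persist on an open set,
where it is contradictory. Sequences suffice for closedness because the neighbourhood filters are
countably generated. -/
theorem isFormSquare [SecondCountableTopology M] (h : LocalKilling g E U p f)
    {x : M} (hx : x ∈ U) :
    IsFormSquare (polyOf (f x)) := by
  by_contra hns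
  have hev : ∀ᶠ y in nhds x, ¬IsFormSquare (polyOf (f y)) := by
    by_contra hne
    rw [not_eventually] at hne
    obtain ⟨u, hu, hu2⟩ := exists_seq_forall_of_frequently hne
    exact hns (IsFormSquare.of_tendsto (fun v => (h.continuousAt_eval v hx).tendsto.comp hu)
      fun n => not_not.1 (hu2 n))
  have h0 : polyOf (f x) ≠ 0 := fun h0 => hns ⟨0, 0, 0, by simp [h0, quadric]⟩
  -- The neighbourhood is shrunk so that one coefficient of the form has no zero on it.
  obtain ⟨m, hm⟩ := ne_zero_iff.1 h0
  obtain ⟨V, hV, hVo, hxV⟩ := eventually_nhds_iff.1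
    ((hev.and ((h.continuousAt_coeff m hx).eventually_ne hm)).and (h.frame.isOpen.mem_nhds hx))
  exact (h.mono hVo fun y hy => (hV y hy).2).false_of_not_isFormSquare
    (fun y hy => (hV y hy).1.2) (fun y hy => (hV y hy).1.1) hxV

end LocalKilling


/-! ### The linear equation for the ratio to the Weyl spinor; openness of the zero set -/

open MvPolynomial Filter smoothRing

theorem sum_infeld_mul_infeldInv (a b : Fin 4) :
    ∑ A, ∑ A', infeld a A A' * infeldInv b A A' = if a = b then 1 else 0 := by
  simp only [infeld_mul_infeldInv, Fin.sum_univ_two]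
  fin_cases a <;> fin_cases b <;> simp [pauli] <;> norm_num

namespace FrameAlgebra

variable {R : Type*} [CommRing R] [Algebra ℂ R] (𝔉 : FrameAlgebra R)

theorem D_eq_sum_DS (a : Fin 4) (r : R) :
    𝔉.D a r = ∑ A, ∑ A', infeld a A A' • 𝔉.DS (A, A') r := by
  simp only [DS, derivation_sum_apply, Derivation.smul_apply, Finset.smul_sum, smul_smul]
  calc 𝔉.D a r = ∑ b, (if a = b then (1 : ℂ) else 0) • 𝔉.D b r := by
        simp only [ite_smul, one_smul, zero_smul, Finset.sum_ite_eq, Finset.mem_univ, if_true]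
    _ = ∑ b, ∑ A, ∑ A', (infeld a A A' * infeldInv b A A') • 𝔉.D b r := by
        simp only [← sum_infeld_mul_infeldInv, Finset.sum_smul]
    _ = _ := by
        rw [Finset.sum_comm]
        exact Finset.sum_congr rfl fun A _ => Finset.sum_comm

/-- The ratio `c` of two quartic forms, the first of which is killed by the twistor operator,
satisfies a logarithmic differential equation where the second does not vanish at two independent
spinors. -/
theorem exists_log_deriv {w : SpinPoly R} {c : R}
    (ht : ∀ A', 𝔉.twist A' (C c * w) = 0) {y z : Fin 2 → R} {s t d : R}
    (hs : s * eval y w = 1) (hz : t * eval z w = 1) (hd : d * (y 0 * z 1 - y 1 * z 0) = 1) :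
    ∃ θ : Fin 4 → R, ∀ a, 𝔉.D a c = θ a * c := by
  -- At a spinor `v` where `w` is invertible, the Leibniz rule gives `v^A ∇_{AA'} c` as a multiple
  -- of `c`; two independent spinors then determine all derivatives of `c`.
  have key : ∀ A', ∀ v : Fin 2 → R, ∀ r, r * eval v w = 1 →
      v 0 * 𝔉.DS (0, A') c + v 1 * 𝔉.DS (1, A') c = -(r * eval v (𝔉.twist A' w)) * c := by
    intro A' v r hr
    have h1 := congrArg (eval v) (ht A')
    rw [Derivation.leibniz, 𝔉.twist_apply A' (C c), (𝔉.isSpinDeriv_HS _).map_C,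
      (𝔉.isSpinDeriv_HS _).map_C] at h1
    simp only [smul_eq_mul, map_add, map_mul, eval_C, eval_X, map_zero] at h1
    linear_combination r * h1 - (v 0 * 𝔉.DS (0, A') c + v 1 * 𝔉.DS (1, A') c) * hr
  set u := fun A' => -(s * eval y (𝔉.twist A' w))
  set v := fun A' => -(t * eval z (𝔉.twist A' w))
  set θ : Fin 2 × Fin 2 → R := fun i =>
    ![d * (z 1 * u i.2 - y 1 * v i.2), d * (y 0 * v i.2 - z 0 * u i.2)] i.1 with hθ
  have hDS : ∀ A A', 𝔉.DS (A, A') c = θ (A, A') * c := fun A A' => by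
    have h1 := key A' y s hs
    have h2 := key A' z t hz
    fin_cases A
    · simp only [hθ, u, v]
      simp only [Fin.zero_eta, Matrix.cons_val_zero]
      linear_combination (-𝔉.DS (0, A') c) * hd + d * z 1 * h1 - d * y 1 * h2
    · simp only [hθ, u, v]
      simp only [Fin.mk_one, Matrix.cons_val_one, Matrix.cons_val_zero]
      linear_combination (-𝔉.DS (1, A') c) * hd + d * y 0 * h2 - d * z 0 * h1
  refine ⟨fun a => ∑ A, ∑ A', infeld a A A' • θ (A, A'), fun a => ?_⟩
  rw [𝔉.D_eq_sum_DS]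
  simp only [hDS, Finset.sum_mul, smul_mul_assoc]

end FrameAlgebra

namespace smoothRing

variable {U : Set M} {x : M} (hx : x ∈ U)

theorem ev_eval (y : Fin 2 → smoothRing U) (q : SpinPoly (smoothRing U)) :
    ev hx (eval y q) = eval (fun i => ev hx (y i)) (evPoly hx q) := by
  induction q using MvPolynomial.induction_on with
  | C r => simp only [eval_C, evPoly_C]
  | add p q hp hq => simp only [map_add, hp, hq]
  | mul_X p i hp => simp only [map_mul, hp, evPoly_X, eval_X]

theorem ev_eval_const (y : Fin 2 → ℂ) (q : SpinPoly (smoothRing U)) :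
    ev hx (eval (fun i => algebraMap ℂ (smoothRing U) (y i)) q) = eval y (evPoly hx q) := by
  rw [ev_eval]
  simp only [AlgHom.commutes, Algebra.algebraMap_self, RingHom.id_apply]

end smoothRing

theorem exists_eval_ne_zero {p : SpinPoly ℂ} (hp : p ≠ 0) : ∃ y, eval y p ≠ 0 := by
  by_contra! h0
  exact hp (MvPolynomial.funext fun y => by rw [h0 y, map_zero])

/-- Multiplying by a variable forces `y` to be nonzero; multiplying by the linear form that vanishes
on the line of `y` forces `z` off this line. -/
theorem exists_independent_eval_ne_zero {p : SpinPoly ℂ} (hp : p ≠ 0) :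
    ∃ y z : Fin 2 → ℂ, eval y p ≠ 0 ∧ eval z p ≠ 0 ∧ y 0 * z 1 - y 1 * z 0 ≠ 0 := by
  obtain ⟨y, hy⟩ := exists_eval_ne_zero (mul_ne_zero hp (X_ne_zero (R := ℂ) (0 : Fin 2)))
  rw [map_mul, eval_X, mul_ne_zero_iff] at hy
  have hl : (C (y 0) * X 1 - C (y 1) * X 0 : SpinPoly ℂ) ≠ 0 := fun h0 => by
    have := congrArg (eval ![0, 1]) h0
    simp only [map_sub, map_mul, eval_C, eval_X, Matrix.cons_val_zero, Matrix.cons_val_one,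
      map_zero] at this
    exact hy.2 (by linear_combination this)
  obtain ⟨z, hz⟩ := exists_eval_ne_zero (mul_ne_zero hp hl)
  simp only [map_mul, map_sub, eval_C, eval_X, mul_ne_zero_iff] at hz
  exact ⟨y, z, hy.1, hz.1, hz.2⟩

namespace LocalKilling

variable {g : LorentzMetric M} {E : Fin 4 → (x : M) → TangentSpace (𝓡 4) x} {U : Set M} {p : M}
  {f : M → (Fin 4 → Fin 2) → ℂ}

theorem continuousAt_eval_weyl (h : LocalKilling g E U p f) (v : Fin 2 → ℂ) {x : M} (hx : x ∈ U) :
    ContinuousAt (fun y => eval v (polyOf (weylSpinor g E y))) x := by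
  refine (continuousAt_lift h.frame.isOpen
    (eval (fun i => algebraMap ℂ (smoothRing U) (v i)) ((2 : ℂ) • h.algebra.weylPoly)) hx).congr ?_
  filter_upwards [h.frame.isOpen.mem_nhds hx] with y hy
  rw [← ev_eq_lift hy, ev_eval_const, map_smul, h.frame.evPoly_weylPoly]

theorem eventually_eq_zero_of_eval_ne_zero (h : LocalKilling g E U p f) {y z : Fin 2 → ℂ}
    (hy : ∀ x ∈ U, eval y (polyOf (weylSpinor g E x)) ≠ 0)
    (hz : ∀ x ∈ U, eval z (polyOf (weylSpinor g E x)) ≠ 0) (hd : y 0 * z 1 - y 1 * z 0 ≠ 0)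
    {x₀ : M} (hx₀ : x₀ ∈ U) (h0 : f x₀ = 0) : ∀ᶠ x in nhds x₀, f x = 0 := by
  set w : SpinPoly (smoothRing U) := (2 : ℂ) • h.algebra.weylPoly with hw
  have hwx : ∀ x (hx : x ∈ U), evPoly hx w = polyOf (weylSpinor g E x) := fun x hx => by
    rw [hw, map_smul, h.frame.evPoly_weylPoly]
  obtain ⟨s, hs⟩ := exists_inv (r := eval (fun i => algebraMap ℂ (smoothRing U) (y i)) w)
    fun x hx => by rw [ev_eval_const, hwx]; exact hy x hx
  obtain ⟨t, ht⟩ := exists_inv (r := eval (fun i => algebraMap ℂ (smoothRing U) (z i)) w)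
    fun x hx => by rw [ev_eval_const, hwx]; exact hz x hx
  -- A quotient of two evaluations at the same spinor, hence smooth.
  set c := eval (fun i => algebraMap ℂ (smoothRing U) (y i)) h.poly * s with hc
  have hcx : ∀ x (hx : x ∈ U), polyOf (f x) = C (ev hx c) * polyOf (weylSpinor g E x) := by
    intro x hx
    obtain ⟨r, hr⟩ := h.exists_eq_C_mul_weyl hx
    have h1 := congrArg (ev hx) hs
    rw [map_mul, ev_eval_const, hwx, map_one] at h1
    have h2 : ev hx c = r := by
      rw [hc, map_mul, ev_eval_const, h.evPoly_poly hx, hr, map_mul, eval_C]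
      linear_combination r * h1
    rw [h2, hr]
  have hpoly : C c * w = h.poly := ext_evPoly fun x hx => by
    rw [map_mul, evPoly_C, hwx, h.evPoly_poly hx, ← hcx]
  obtain ⟨θ, hθ⟩ := h.algebra.exists_log_deriv (c := c) (w := w)
    (d := algebraMap ℂ (smoothRing U) (y 0 * z 1 - y 1 * z 0)⁻¹)
    (fun A' => by rw [hpoly]; exact h.twist_poly A') hs ht
    (by rw [← map_mul, ← map_mul, ← map_sub, ← map_mul, inv_mul_cancel₀ hd, map_one])
  have hc0 : lift c x₀ = 0 := by
    have h1 := hcx x₀ hx₀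
    rw [h0] at h1
    have h2 : polyOf (0 : (Fin 4 → Fin 2) → ℂ) = 0 := polyOf_zero
    rw [h2, eq_comm, mul_eq_zero] at h1
    rw [← ev_eq_lift hx₀]
    exact (C_injective _ _).eq_iff' C_0 |>.1 (h1.resolve_right (h.polyOf_weyl_ne_zero hx₀))
  filter_upwards [h.frame.eventually_eq_zero h.chart hθ hx₀ hc0, h.frame.isOpen.mem_nhds hx₀]
    with x hx hxU
  refine (h.symm x hxU).eq_zero ?_
  rw [hcx x hxU, ev_eq_lift, hx, C_0, zero_mul]

/-- The zero set of a Killing spinor is open. -/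
theorem eventually_eq_zero (h : LocalKilling g E U p f) {x₀ : M} (hx₀ : x₀ ∈ U) (h0 : f x₀ = 0) :
    ∀ᶠ x in nhds x₀, f x = 0 := by
  obtain ⟨y, z, hy, hz, hd⟩ := exists_independent_eval_ne_zero (h.polyOf_weyl_ne_zero hx₀)
  obtain ⟨V, hV, hVo, hxV⟩ := eventually_nhds_iff.1
    ((((h.continuousAt_eval_weyl y hx₀).eventually_ne hy).and
      ((h.continuousAt_eval_weyl z hx₀).eventually_ne hz)).and (h.frame.isOpen.mem_nhds hx₀))
  exact (h.mono hVo fun y hy => (hV y hy).2).eventually_eq_zero_of_eval_ne_zero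
    (fun y hy => (hV y hy).1.1) (fun y hy => (hV y hy).1.2) hd hxV h0

end LocalKilling


/-! ### Smooth square roots of forms -/

open MvPolynomial Filter smoothRing

theorem smoothRing.exists_sqrt {U : Set M} {r : smoothRing U} {w : ℂ} (hw : w ≠ 0)
    (h : ∀ x (hx : x ∈ U), ev hx r / w ∈ Complex.slitPlane) : ∃ s, s * s = r := by
  -- Normalizing by `w` brings the function into the slit plane, where the principal logarithm is
  -- smooth; `t` restores the factor.
  obtain ⟨t, ht⟩ := IsAlgClosed.exists_pow_nat_eq w (n := 2) (by norm_num)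
  have hF : ContMDiffOn (𝓡 4) 𝓘(ℝ, ℂ) ∞
      (fun x => t * Complex.exp (Complex.log (lift r x / w) / 2)) U := fun x hx => by
    have h1 : ContDiffAt ℂ ∞ (fun z : ℂ => t * Complex.exp (Complex.log (z / w) / 2)) (lift r x) := by
      have h2 : ContDiffAt ℂ ∞ (fun z : ℂ => Complex.log (z / w)) (lift r x) :=
        ContDiffAt.comp (lift r x) (Complex.contDiffAt_log (by rw [← ev_eq_lift hx]; exact h x hx))
          (contDiffAt_id.div_const w)
      exact contDiffAt_const.mul (h2.div_const 2).cexp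
    exact (h1.restrict_scalars ℝ).contMDiffAt.comp_contMDiffWithinAt x (lift_smooth r x hx)
  refine ⟨mk _ hF, ext_ev fun x hx => ?_⟩
  have h3 : lift r x / w ≠ 0 := by rw [← ev_eq_lift hx]; exact Complex.slitPlane_ne_zero (h x hx)
  rw [map_mul, ev_mk, mul_mul_mul_comm, ← pow_two t, ht, ← Complex.exp_add, add_halves,
    Complex.exp_log h3, mul_div_cancel₀ _ hw, ev_eq_lift]

theorem xDeriv_zero_quadric (a b c : ℂ) :
    xDeriv 0 (quadric a b c) = C (2 * a) * X 0 + C b * X 1 := by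
  simp only [quadric, map_add, Derivation.leibniz, xDeriv_C, xDeriv_X_self, xDeriv_zero_X_one,
    smul_eq_mul, C_mul, map_ofNat]
  ring

theorem xDeriv_one_quadric (a b c : ℂ) :
    xDeriv 1 (quadric a b c) = C b * X 0 + C (2 * c) * X 1 := by
  simp only [quadric, map_add, Derivation.leibniz, xDeriv_C, xDeriv_X_self, xDeriv_one_X_zero,
    smul_eq_mul, C_mul, map_ofNat]
  ring

/-- The first and second derivatives of the square of a quadratic form at a point. -/
theorem eval_xDeriv_quadric_sq (a b c : ℂ) (y : Fin 2 → ℂ) (i j : Fin 2) :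
    eval y (xDeriv i (quadric a b c * quadric a b c)) =
      2 * eval y (quadric a b c) * eval y (xDeriv i (quadric a b c)) ∧
    eval y (xDeriv i (xDeriv j (quadric a b c * quadric a b c))) =
      2 * eval y (xDeriv i (quadric a b c)) * eval y (xDeriv j (quadric a b c)) +
      2 * eval y (quadric a b c) * eval y (xDeriv i (xDeriv j (quadric a b c))) := by
  simp only [Derivation.leibniz, smul_eq_mul, map_add, map_mul]
  constructor <;> ring

/-- A symmetric spinor of valence `2` with given components. -/
def symmSpinor {R : Type*} (a b c : R) (β : Fin 2 → Fin 2) : R := ![![a, b], ![b, c]] (β 0) (β 1)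

theorem isSymmSpinor_symmSpinor {R : Type*} (a b c : R) : IsSymmSpinor (symmSpinor a b c) := by
  intro π β
  have h01 : π 0 ≠ π 1 := fun h => by simpa using π.injective h
  simp only [symmSpinor, Function.comp_apply]
  generalize π 0 = i at *
  generalize π 1 = j at *
  fin_cases i <;> fin_cases j
  · exact absurd rfl h01
  · rfl
  · simp only [Fin.mk_one, Fin.zero_eta]
    generalize β 0 = k
    generalize β 1 = l
    fin_cases k <;> fin_cases l <;> rfl
  · exact absurd rfl h01

theorem polyOf_symmSpinor (a b c : ℂ) :
    polyOf (symmSpinor a (1 / 2 * b) c) = quadric a b c := by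
  have h2 : (C (1 / 2 : ℂ) : SpinPoly ℂ) * 2 = 1 := by
    rw [← map_ofNat C 2, ← C_mul]; norm_num
  rw [polyOf_two]
  simp only [symmSpinor, Fin.sum_univ_two, Matrix.cons_val_zero, Matrix.cons_val_one, quadric,
    Matrix.cons_val_fin_one, C_mul]
  linear_combination (C b * (X 0 * X 1)) * h2

theorem isSymmSpinor_spinSymmSq (κ : (Fin 2 → Fin 2) → ℂ) : IsSymmSpinor (spinSymmSq κ) :=
  isSymmSpinor_spinSymm _

theorem eq_spinSymmSq_iff {φ : (Fin 4 → Fin 2) → ℂ} (hφ : IsSymmSpinor φ)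
    (κ : (Fin 2 → Fin 2) → ℂ) : φ = spinSymmSq κ ↔ polyOf φ = polyOf κ * polyOf κ := by
  rw [← polyOf_spinSymmSq]
  exact ⟨congrArg _, hφ.eq_of_polyOf_eq (isSymmSpinor_spinSymmSq κ)⟩

namespace LocalKilling

variable {g : LorentzMetric M} {E : Fin 4 → (x : M) → TangentSpace (𝓡 4) x} {U : Set M} {p : M}
  {f : M → (Fin 4 → Fin 2) → ℂ}

theorem exists_root_of_eval [SecondCountableTopology M] (h : LocalKilling g E U p f)
    {y : Fin 2 → ℂ} {w : ℂ} (hw : w ≠ 0)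
    (hy : ∀ x ∈ U, eval y (polyOf (f x)) / w ∈ Complex.slitPlane) :
    ∃ κ : M → (Fin 2 → Fin 2) → ℂ, (∀ β, ContMDiffOn (𝓡 4) 𝓘(ℝ, ℂ) ∞ (fun x => κ x β) U) ∧
      (∀ x ∈ U, IsSymmSpinor (κ x)) ∧ ∀ x ∈ U, f x = spinSymmSq (κ x) := by
  set Y : Fin 2 → smoothRing U := fun i => algebraMap ℂ (smoothRing U) (y i) with hY
  obtain ⟨s, hs⟩ := exists_sqrt (r := eval Y h.poly) hw fun x hx => by
    rw [hY, ev_eval_const, h.evPoly_poly]; exact hy x hx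
  obtain ⟨t, ht⟩ := exists_inv (r := s) fun x hx h0 => by
    have h1 := congrArg (ev hx) hs
    rw [map_mul, h0, zero_mul, hY, ev_eval_const, h.evPoly_poly] at h1
    refine Complex.slitPlane_ne_zero (hy x hx) ?_
    rw [← h1, zero_div]
  set l : Fin 2 → smoothRing U := fun i => eval Y (xDeriv i h.poly) with hl
  set q : Fin 2 → Fin 2 → smoothRing U := fun i j => eval Y (xDeriv i (xDeriv j h.poly)) with hq
  -- If `L = q²` and `v = q(y)`, then `∂_i L = 2 v ∂_i q` and `∂_i ∂_j L = 2 ∂_i q ∂_j q + 2 v ∂_i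
  -- ∂_j q` at `y`. Solving for the constants `∂_i ∂_j q`, with `s` in place of `v`, gives the
  -- coefficients `a`, `b`, `c`.
  obtain ⟨a, ha⟩ : ∃ a, a = (1 / 2 : ℂ) • t *
    ((1 / 2 : ℂ) • q 0 0 - (1 / 4 : ℂ) • (l 0 * l 0 * t * t)) := ⟨_, rfl⟩
  obtain ⟨b, hb⟩ : ∃ b, b = (1 / 2 : ℂ) • t *
    (q 0 1 - (1 / 2 : ℂ) • (l 0 * l 1 * t * t)) := ⟨_, rfl⟩
  obtain ⟨c, hc⟩ : ∃ c, c = (1 / 2 : ℂ) • t *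
    ((1 / 2 : ℂ) • q 1 1 - (1 / 4 : ℂ) • (l 1 * l 1 * t * t)) := ⟨_, rfl⟩
  refine ⟨fun x β => lift (symmSpinor a ((1 / 2 : ℂ) • b) c β) x, fun β => lift_smooth _,
    fun x _ π β => by simp only [isSymmSpinor_symmSpinor _ _ _ π β], fun x hx => ?_⟩
  have hκ : (fun β => lift (symmSpinor a ((1 / 2 : ℂ) • b) c β) x) =
      symmSpinor (ev hx a) (1 / 2 * ev hx b) (ev hx c) := by
    funext β
    rw [← ev_eq_lift hx]
    simp only [symmSpinor]
    generalize β 0 = i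
    generalize β 1 = j
    fin_cases i <;> fin_cases j <;> rfl
  beta_reduce
  rw [hκ, eq_spinSymmSq_iff (h.symm x hx), polyOf_symmSpinor]
  -- This pointwise root need not depend smoothly on `x`; it only serves to identify the smooth
  -- candidate.
  obtain ⟨A, B, C', hf⟩ := h.isFormSquare hx
  have hs' := congrArg (ev hx) hs
  have ht' := congrArg (ev hx) ht
  have hl' : ∀ i, ev hx (l i) = 2 * eval y (quadric A B C') * eval y (xDeriv i (quadric A B C')) :=
    fun i => by
      rw [hl, ev_eval_const, evPoly_xDeriv, h.evPoly_poly, hf, (eval_xDeriv_quadric_sq _ _ _ _ i i).1]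
  have hq' : ∀ i j, ev hx (q i j) =
      2 * eval y (xDeriv i (quadric A B C')) * eval y (xDeriv j (quadric A B C')) +
      2 * eval y (quadric A B C') * eval y (xDeriv i (xDeriv j (quadric A B C'))) := fun i j => by
    rw [hq, ev_eval_const, evPoly_xDeriv, evPoly_xDeriv, h.evPoly_poly, hf,
      (eval_xDeriv_quadric_sq ..).2]
  have h00 : eval y (xDeriv 0 (xDeriv 0 (quadric A B C'))) = 2 * A := by
    simp [xDeriv_zero_quadric]
  have h01 : eval y (xDeriv 0 (xDeriv 1 (quadric A B C'))) = B := by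
    simp [xDeriv_one_quadric]
  have h11 : eval y (xDeriv 1 (xDeriv 1 (quadric A B C'))) = 2 * C' := by
    simp [xDeriv_one_quadric]
  rw [map_mul, hY, ev_eval_const, h.evPoly_poly, hf, map_mul] at hs'
  rw [map_mul, map_one] at ht'
  set v := eval y (quadric A B C')
  set v₀ := eval y (xDeriv 0 (quadric A B C'))
  set v₁ := eval y (xDeriv 1 (quadric A B C'))
  set S := ev hx s
  set T := ev hx t
  -- Since `s² = v²`, the factor `v T` is a sign, and the candidate is the pointwise root times this
  -- sign.
  have hvT : (v * T) * (v * T) = 1 := by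
    linear_combination (T * S + 1) * ht' - T * T * hs'
  have ea : ev hx a = v * T * A := by
    rw [ha]
    simp only [map_mul, map_sub, map_smul, smul_eq_mul, hl', hq', h00]
    linear_combination (-(1 / 2) * T * v₀ * v₀) * hvT
  have eb : ev hx b = v * T * B := by
    rw [hb]
    simp only [map_mul, map_sub, map_smul, smul_eq_mul, hl', hq', h01]
    linear_combination (-T * v₀ * v₁) * hvT
  have ec : ev hx c = v * T * C' := by
    rw [hc]
    simp only [map_mul, map_sub, map_smul, smul_eq_mul, hl', hq', h11]
    linear_combination (-(1 / 2) * T * v₁ * v₁) * hvT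
  rw [ea, eb, ec, ← C_mul_quadric, hf]
  have := congrArg (C (R := ℂ) (σ := Fin 2)) hvT
  rw [map_mul, map_one] at this
  linear_combination -(quadric A B C' * quadric A B C') * this

/-- Where it does not vanish, a Killing spinor is locally a square. -/
theorem exists_root [SecondCountableTopology M] (h : LocalKilling g E U p f) {x₀ : M}
    (hx₀ : x₀ ∈ U) (h0 : f x₀ ≠ 0) : ∃ V : Set M, IsOpen V ∧ x₀ ∈ V ∧ V ⊆ U ∧
      ∃ κ : M → (Fin 2 → Fin 2) → ℂ, (∀ β, ContMDiffOn (𝓡 4) 𝓘(ℝ, ℂ) ∞ (fun x => κ x β) V) ∧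
        (∀ x ∈ V, IsSymmSpinor (κ x)) ∧ ∀ x ∈ V, f x = spinSymmSq (κ x) := by
  obtain ⟨y, hy⟩ := exists_eval_ne_zero fun hp => h0 ((h.symm x₀ hx₀).eq_zero hp)
  have hc : ContinuousAt (fun x => eval y (polyOf (f x)) / eval y (polyOf (f x₀))) x₀ :=
    (h.continuousAt_eval y hx₀).div_const _
  have hs : ∀ᶠ x in nhds x₀, eval y (polyOf (f x)) / eval y (polyOf (f x₀)) ∈ Complex.slitPlane :=
    hc.eventually (Complex.isOpen_slitPlane.mem_nhds (by simp [div_self hy]))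
  obtain ⟨V, hV, hVo, hxV⟩ := eventually_nhds_iff.1 (hs.and (h.frame.isOpen.mem_nhds hx₀))
  have hVU : V ⊆ U := fun x hx => (hV x hx).2
  exact ⟨V, hVo, hxV, hVU, (h.mono hVo hVU).exists_root_of_eval hy fun x hx => (hV x hx).1⟩

/-- A smooth square root of a Killing spinor without zeros is a Killing spinor. -/
theorem twist_root (h : LocalKilling g E U p f) {κ : M → (Fin 2 → Fin 2) → ℂ}
    (hκ : ∀ β, ContMDiffOn (𝓡 4) 𝓘(ℝ, ℂ) ∞ (fun x => κ x β) U)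
    (hf : ∀ x ∈ U, f x = spinSymmSq (κ x)) {x : M} (hx : x ∈ U) (h0 : f x ≠ 0) (A' : Fin 2)
    (α : Fin 3 → Fin 2) : spinTwist g E κ x A' α = 0 := by
  refine (h.frame.twist_eq_zero_iff h.chart hx (fun β => smoothRing.mk _ (hκ β)) κ
    (fun y hy β => ev_mk _ _ hy)).2 (fun A' => ?_) A' α
  set K := polyOf fun β => smoothRing.mk _ (hκ β) with hK
  have hKx : ∀ y (hy : y ∈ U), evPoly hy K = polyOf (κ y) := fun y hy => by
    rw [hK, evPoly_polyOf]
    simp only [ev_mk]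
  have hKK : K * K = h.poly := ext_evPoly fun y hy => by
    rw [map_mul, hKx, h.evPoly_poly, hf y hy, polyOf_spinSymmSq]
  have h1 := congrArg (evPoly hx) (h.twist_poly A')
  -- The twistor operator is a derivation, so it sends `K²` to `2 K` times its value on `K`, and
  -- forms over `ℂ` have no zero divisors.
  rw [← hKK, Derivation.leibniz, smul_eq_mul, map_add, map_mul, map_zero, hKx, ← two_mul,
    mul_eq_zero, mul_eq_zero] at h1
  refine (h1.resolve_left two_ne_zero).resolve_left fun h2 => h0 ((h.symm x hx).eq_zero ?_)
  rw [hf x hx, polyOf_spinSymmSq, h2, zero_mul]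

end LocalKilling

/-! ## Change of spin frame -/

section Transform

open MvPolynomial

variable {k : ℕ}

/-- The action of a matrix on the indices of a spinor. -/
def spinTransform (T : Matrix (Fin 2) (Fin 2) ℂ) (φ : (Fin k → Fin 2) → ℂ) (β : Fin k → Fin 2) : ℂ :=
  ∑ α : Fin k → Fin 2, (∏ r, T (α r) (β r)) * φ α

/-- The linear substitution with a given matrix. -/
def linearSubst (T : Matrix (Fin 2) (Fin 2) ℂ) : SpinPoly ℂ →ₐ[ℂ] SpinPoly ℂ :=
  aeval fun A => ∑ B, C (T A B) * X B

theorem linearSubst_X (T : Matrix (Fin 2) (Fin 2) ℂ) (A : Fin 2) :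
    linearSubst T (X A) = ∑ B, C (T A B) * X B :=
  aeval_X _ _

theorem linearSubst_C (T : Matrix (Fin 2) (Fin 2) ℂ) (r : ℂ) : linearSubst T (C r) = C r :=
  aeval_C _ _

theorem polyOf_spinTransform (T : Matrix (Fin 2) (Fin 2) ℂ) (φ : (Fin k → Fin 2) → ℂ) :
    polyOf (spinTransform T φ) = linearSubst T (polyOf φ) := by
  simp only [polyOf, spinTransform, map_sum, map_mul, linearSubst_C, map_prod, linearSubst_X,
    Finset.sum_mul, Finset.prod_univ_sum, Fintype.piFinset_univ, Finset.mul_sum,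
    Finset.prod_mul_distrib]
  rw [Finset.sum_comm]
  refine Finset.sum_congr rfl fun α _ => Finset.sum_congr rfl fun β _ => ?_
  ring

theorem linearSubst_mul (T T' : Matrix (Fin 2) (Fin 2) ℂ) (p : SpinPoly ℂ) :
    linearSubst T' (linearSubst T p) = linearSubst (T * T') p := by
  suffices h : (linearSubst T').comp (linearSubst T) = linearSubst (T * T') from
    DFunLike.congr_fun h p
  refine MvPolynomial.algHom_ext fun A => ?_
  simp only [AlgHom.comp_apply, linearSubst_X, map_add, map_mul, linearSubst_C, Matrix.mul_apply,
    Fin.sum_univ_two]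
  ring

theorem IsSymmSpinor.spinTransform {φ : (Fin k → Fin 2) → ℂ} (h : IsSymmSpinor φ)
    (T : Matrix (Fin 2) (Fin 2) ℂ) : IsSymmSpinor (spinTransform T φ) := by
  intro π β
  unfold _root_.spinTransform
  refine Fintype.sum_equiv (Equiv.arrowCongr π (Equiv.refl _)) _ _ fun α => ?_
  have h1 : (Equiv.arrowCongr π (Equiv.refl (Fin 2))) α = α ∘ π.symm := rfl
  rw [h1, h π.symm α]
  congr 1
  refine Fintype.prod_equiv π _ _ fun r => ?_
  simp only [Function.comp_apply, Equiv.symm_apply_apply]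

theorem spinTransform_spinTransform {φ : (Fin k → Fin 2) → ℂ} (h : IsSymmSpinor φ)
    (T T' : Matrix (Fin 2) (Fin 2) ℂ) :
    spinTransform T' (spinTransform T φ) = spinTransform (T * T') φ :=
  ((h.spinTransform T).spinTransform T').eq_of_polyOf_eq (h.spinTransform _) (by
    rw [polyOf_spinTransform, polyOf_spinTransform, polyOf_spinTransform, linearSubst_mul])

/-- A change of frame is a linear substitution in the form, hence a ring homomorphism that preserves
squares. -/
theorem spinTransform_spinSymmSq (T : Matrix (Fin 2) (Fin 2) ℂ) (κ : (Fin 2 → Fin 2) → ℂ) :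
    spinTransform T (spinSymmSq κ) = spinSymmSq (spinTransform T κ) :=
  ((isSymmSpinor_spinSymmSq κ).spinTransform T).eq_of_polyOf_eq (isSymmSpinor_spinSymmSq _) (by
    rw [polyOf_spinTransform, polyOf_spinSymmSq, polyOf_spinSymmSq, polyOf_spinTransform, map_mul])

theorem spinTransform_zero (T : Matrix (Fin 2) (Fin 2) ℂ) :
    spinTransform T (0 : (Fin k → Fin 2) → ℂ) = 0 := by
  funext β
  simp only [spinTransform, Pi.zero_apply, mul_zero, Finset.sum_const_zero]

theorem spinTransform_smul (T : Matrix (Fin 2) (Fin 2) ℂ) (r : ℂ) (φ : (Fin k → Fin 2) → ℂ) :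
    spinTransform T (r • φ) = r • spinTransform T φ := by
  funext β
  simp only [spinTransform, Pi.smul_apply, smul_eq_mul, Finset.mul_sum]
  exact Finset.sum_congr rfl fun α _ => by ring

theorem spinSymmSq_zero : spinSymmSq (0 : (Fin 2 → Fin 2) → ℂ) = 0 := by
  funext α
  simp only [spinSymmSq, spinSymm, Pi.zero_apply, mul_zero, Finset.sum_const_zero]

end Transform


/-! ### Spinor fields in all frames and the local theorem -/

theorem spinTwist_zero (g : LorentzMetric M) (E : Fin 4 → (x : M) → TangentSpace (𝓡 4) x) {k : ℕ}
    (x : M) (A' : Fin 2) (α : Fin (k + 1) → Fin 2) :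
    spinTwist g E (fun _ => (0 : (Fin k → Fin 2) → ℂ)) x A' α = 0 := by
  simp only [spinTwist, spinSymm, spinNabla, spinCovDeriv, Pi.zero_apply, dirDeriv_const, mul_zero,
    Finset.sum_const_zero, sub_zero]

namespace IsSpinorField

variable {g : LorentzMetric M} {ι : Type*} {s : SpinStructure g ι} {W : Set M} {k : ℕ}
  {φ : ι → M → (Fin k → Fin 2) → ℂ}

theorem eq_spinTransform (h : IsSpinorField s W k φ) {i j : ι} {x : M} (hi : x ∈ s.dom i)
    (hj : x ∈ s.dom j) (hx : x ∈ W) : φ j x = spinTransform (s.trans i j x) (φ i x) :=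
  funext fun β => h.transform i j x ⟨⟨hi, hj⟩, hx⟩ β

theorem eq_zero_of_eq_zero (h : IsSpinorField s W k φ) {i j : ι} {x : M} (hi : x ∈ s.dom i)
    (hj : x ∈ s.dom j) (hx : x ∈ W) (h0 : φ i x = 0) : φ j x = 0 := by
  rw [h.eq_spinTransform hi hj hx, h0, spinTransform_zero]

/-- Transport of a spinor from one frame to all. -/
theorem of_frame {i : ι} (hW : W ⊆ s.dom i) {ψ : M → (Fin k → Fin 2) → ℂ}
    (hs : ∀ β, ContMDiffOn (𝓡 4) 𝓘(ℝ, ℂ) ∞ (fun x => ψ x β) W) (hψ : ∀ x ∈ W, IsSymmSpinor (ψ x)) :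
    IsSpinorField s W k fun j x => spinTransform (s.trans i j x) (ψ x) where
  smooth j β := by
    unfold spinTransform
    refine contMDiffOn_finsetSum fun α _ => ContMDiffOn.mul ?_ ((hs α).mono Set.inter_subset_right)
    exact contMDiffOn_finsetProd fun r _ => (s.trans_smooth i j (α r) (β r)).mono
      fun x hx => ⟨hW hx.2, hx.1⟩
  symmetric j _ hx := (hψ _ hx.2).spinTransform _
  transform j l x hx β := by
    rw [← s.trans_cocycle i j l x ⟨⟨hW hx.2, hx.1.1⟩, hx.1.2⟩,
      ← spinTransform_spinTransform (hψ x hx.2)]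
    rfl

theorem zero : IsSpinorField s W k fun _ _ => 0 where
  smooth i α := contMDiffOn_const
  symmetric i x hx π α := rfl
  transform i j x hx β := by simp only [Pi.zero_apply, mul_zero, Finset.sum_const_zero]

end IsSpinorField

theorem isKillingSpinor_zero {g : LorentzMetric M} {ι : Type*} (s : SpinStructure g ι) (W : Set M)
    (k : ℕ) : IsKillingSpinor s W k fun _ _ => 0 where
  toIsSpinorField := .zero
  twist_eq_zero i _ _ A' α := spinTwist_zero g (s.frame i) _ A' α

namespace SpinStructure

variable {g : LorentzMetric M} {ι : Type*} (s : SpinStructure g ι)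

theorem isOrthonormalFrame (i : ι) : IsOrthonormalFrame g (s.frame i) (s.dom i) where
  isOpen := s.isOpen_dom i
  smooth := s.frame_smooth i
  orthonormal := s.frame_orthonormal i

variable {s}

theorem localKilling (hA : AlignedMatter s) (hW : WeylNonvanishing s)
    {L : ι → M → (Fin 4 → Fin 2) → ℂ} (hL : IsKillingSpinor s Set.univ 4 L) (i : ι) (p : M) :
    LocalKilling g (s.frame i) (s.dom i ∩ (extChartAt (𝓡 4) p).source) p (L i) where
  frame := (s.isOrthonormalFrame i).mono
    ((s.isOpen_dom i).inter (isOpen_extChartAt_source (I := 𝓡 4) p)) Set.inter_subset_left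
  chart := Set.inter_subset_right
  smooth α := (hL.smooth i α).mono fun _ hx => ⟨hx.1, trivial⟩
  symm _ hx := hL.symmetric i _ ⟨hx.1, trivial⟩
  twist _ hx := hL.twist_eq_zero i _ ⟨hx.1, trivial⟩
  weyl _ hx := hW i _ hx.1
  aligned _ hx := hA i _ hx.1

/-- A square root of a Killing spinor without zeros is a Killing spinor. -/
theorem isKillingSpinor_of_isSymmSquareOn (hA : AlignedMatter s) (hΨ : WeylNonvanishing s)
    {L : ι → M → (Fin 4 → Fin 2) → ℂ} (hL : IsKillingSpinor s Set.univ 4 L) {W : Set M}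
    (hW : IsOpen W) (h0 : ∀ i, ∀ x ∈ s.dom i ∩ W, L i x ≠ 0) {κ : ι → M → (Fin 2 → Fin 2) → ℂ}
    (hκ : IsSpinorField s W 2 κ) (hsq : IsSymmSquareOn s W L κ) : IsKillingSpinor s W 2 κ where
  toIsSpinorField := hκ
  twist_eq_zero i x hx A' α := by
    have h1 : LocalKilling g (s.frame i) (s.dom i ∩ W ∩ (extChartAt (𝓡 4) x).source) x (L i) :=
      (localKilling hA hΨ hL i x).mono
        (((s.isOpen_dom i).inter hW).inter (isOpen_extChartAt_source (I := 𝓡 4) x))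
        fun y hy => ⟨hy.1.1, hy.2⟩
    exact h1.twist_root (fun β => (hκ.smooth i β).mono Set.inter_subset_left)
      (fun y hy => hsq i y hy.1) ⟨hx, mem_extChartAt_source (I := 𝓡 4) x⟩ (h0 i x hx) A' α

theorem eventually_eq_zero (hA : AlignedMatter s) (hΨ : WeylNonvanishing s)
    {L : ι → M → (Fin 4 → Fin 2) → ℂ} (hL : IsKillingSpinor s Set.univ 4 L) {i : ι} {x : M}
    (hx : x ∈ s.dom i) (h0 : L i x = 0) : ∀ᶠ y in nhds x, L i y = 0 :=
  (localKilling hA hΨ hL i x).eventually_eq_zero ⟨hx, mem_extChartAt_source (I := 𝓡 4) x⟩ h0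

theorem eventually_ne_zero {W : Set M} {k : ℕ} {φ : ι → M → (Fin k → Fin 2) → ℂ}
    (h : IsSpinorField s W k φ) (hW : IsOpen W) {i : ι} {x : M} (hx : x ∈ s.dom i ∩ W)
    (h0 : φ i x ≠ 0) : ∀ᶠ y in nhds x, φ i y ≠ 0 := by
  have h1 : ContinuousAt (φ i) x := continuousAt_pi.2 fun α =>
    ((h.smooth i α).contMDiffAt (((s.isOpen_dom i).inter hW).mem_nhds hx)).continuousAt
  exact h1.eventually_ne h0

/-- A Killing spinor of valence `(4,0)` is locally the square of a Killing spinor. -/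
theorem exists_local_root [SecondCountableTopology M] (hA : AlignedMatter s)
    (hΨ : WeylNonvanishing s) {L : ι → M → (Fin 4 → Fin 2) → ℂ}
    (hL : IsKillingSpinor s Set.univ 4 L) (p : M) : ∃ W : Set M, IsOpen W ∧ p ∈ W ∧
      ∃ κ : ι → M → (Fin 2 → Fin 2) → ℂ, IsKillingSpinor s W 2 κ ∧ IsSymmSquareOn s W L κ := by
  obtain ⟨i, hi⟩ := s.cover p
  by_cases h0 : L i p = 0
  -- A zero of `L` is an interior point of its zero set, so near it the zero spinor is a root.
  · obtain ⟨W, hW, hWo, hpW⟩ := eventually_nhds_iff.1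
      ((eventually_eq_zero hA hΨ hL hi h0).and ((s.isOpen_dom i).mem_nhds hi))
    refine ⟨W, hWo, hpW, fun _ _ => 0, isKillingSpinor_zero s W 2, fun j x hx => ?_⟩
    rw [spinSymmSq_zero]
    exact hL.eq_zero_of_eq_zero (hW x hx.2).2 hx.1 trivial (hW x hx.2).1
  · have hs : p ∈ s.dom i ∩ (extChartAt (𝓡 4) p).source :=
      ⟨hi, mem_extChartAt_source (I := 𝓡 4) p⟩
    obtain ⟨V, hVo, hpV, hVU, κ, hκ, hκs, hκL⟩ := (localKilling hA hΨ hL i p).exists_root hs h0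
    obtain ⟨W, hW, hWo, hpW⟩ := eventually_nhds_iff.1
      ((eventually_ne_zero hL.toIsSpinorField isOpen_univ ⟨hi, trivial⟩ h0).and (hVo.mem_nhds hpV))
    have hWi : W ⊆ s.dom i := fun x hx => (hVU (hW x hx).2).1
    have hWV : W ⊆ V := fun x hx => (hW x hx).2
    have hsq : IsSymmSquareOn s W L fun j x => spinTransform (s.trans i j x) (κ x) :=
      fun j x hx => by
        rw [← spinTransform_spinSymmSq, ← hκL x (hWV hx.2)]
        exact hL.eq_spinTransform (hWi hx.2) hx.1 trivial
    exact ⟨W, hWo, hpW, _, isKillingSpinor_of_isSymmSquareOn hA hΨ hL hWo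
      (fun j x hx hj => (hW x hx.2).1 (hL.eq_zero_of_eq_zero hx.1 (hWi hx.2) trivial hj))
      (.of_frame hWi (fun β => (hκ β).mono hWV) fun x hx => hκs x (hWV hx)) hsq, hsq⟩

end SpinStructure

/-! ## Gluing of signs on a simply connected space -/

section Signs

open Filter

variable {X : Type*} [TopologicalSpace X] {W : X → Set X} {σ : X → X → X → ℤˣ}

/-- The double cover given by a cocycle of locally constant signs. -/
def signBundle (hW : ∀ p, IsOpen (W p)) (hmem : ∀ p, p ∈ W p)
    (hself : ∀ p, ∀ x ∈ W p, σ p p x = 1)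
    (hcomp : ∀ p q r, ∀ x ∈ W p ∩ W q ∩ W r, σ p q x * σ q r x = σ p r x)
    (hloc : ∀ p q, ∀ x ∈ W p ∩ W q, ∀ᶠ y in nhds x, σ p q y = σ p q x) :
    FiberBundleCore X X ℤˣ where
  baseSet := W
  isOpen_baseSet := hW
  indexAt := id
  mem_baseSet_at := hmem
  coordChange p q x v := v * σ p q x
  coordChange_self p x hx v := by rw [hself p x hx, mul_one]
  continuousOn_coordChange p q := by
    rintro ⟨x, v⟩ hx
    have h1 : ContinuousAt (σ p q) x :=
      continuousAt_const.congr (EventuallyEq.symm (hloc p q x hx.1))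
    exact (continuousAt_snd.mul (ContinuousAt.comp (f := Prod.fst) (x := (x, v)) h1
      continuousAt_fst)).continuousWithinAt
  coordChange_comp p q r x hx v := by rw [mul_assoc, hcomp p q r x hx]

/-- A cocycle of locally constant signs on a simply connected space is a coboundary. -/
theorem exists_global_sign [SimplyConnectedSpace X] [LocallyPathConnectedSpace X]
    (hW : ∀ p, IsOpen (W p)) (hmem : ∀ p, p ∈ W p) (hself : ∀ p, ∀ x ∈ W p, σ p p x = 1)
    (hcomp : ∀ p q r, ∀ x ∈ W p ∩ W q ∩ W r, σ p q x * σ q r x = σ p r x)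
    (hloc : ∀ p q, ∀ x ∈ W p ∩ W q, ∀ᶠ y in nhds x, σ p q y = σ p q x) :
    ∃ t : X → ℤˣ, ∀ q, ∀ x ∈ W q, ∀ᶠ y in nhds x, t y * σ y q y = t x * σ x q x := by
  set Z := signBundle hW hmem hself hcomp hloc with hZ
  have hcov : IsCoveringMap (Bundle.TotalSpace.proj : Bundle.TotalSpace ℤˣ Z.Fiber → X) :=
    FiberBundle.isCoveringMap
  obtain ⟨x₀⟩ : Nonempty X := inferInstance
  -- A lift of the identity of the simply connected base is a continuous section of the double
  -- cover.
  obtain ⟨F, ⟨-, hF⟩, -⟩ := hcov.existsUnique_continuousMap_lifts (ContinuousMap.id X) x₀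
    ⟨x₀, (1 : ℤˣ)⟩ rfl
  have hF' : ∀ y, (F y).proj = y := fun y => congrFun hF y
  let fib : Bundle.TotalSpace ℤˣ Z.Fiber → ℤˣ := fun e => e.snd
  have htriv : ∀ q y, (Z.localTriv q (F y)).2 = fib (F y) * σ y q y := fun q y => by
    have h1 : (Z.localTriv q (F y)).2 = fib (F y) * σ (F y).proj q (F y).proj := rfl
    rw [h1, hF']
  -- The sign at `y` is the fibre coordinate of the section in the trivialization labelled by `y`
  -- itself. In a fixed trivialization the coordinate is continuous with discrete values, hence
  -- locally constant.
  refine ⟨fun y => fib (F y), fun q x hx => ?_⟩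
  have hmemx : F x ∈ (Z.localTriv q).source := by
    rw [(Z.localTriv q).mem_source]
    change (F x).proj ∈ W q
    rwa [hF']
  have hc : ContinuousAt (fun y => (Z.localTriv q (F y)).2) x :=
    continuousAt_snd.comp (((Z.localTriv q).continuousOn.continuousAt
      ((Z.localTriv q).open_source.mem_nhds hmemx)).comp F.continuous.continuousAt)
  filter_upwards [hc.eventually ((isOpen_discrete {(Z.localTriv q (F x)).2}).mem_nhds rfl)] with y hy
  rw [← htriv, ← htriv]
  exact hy

end Signs


/-! ### Uniqueness of roots up to sign, and gluing -/

open MvPolynomial Filter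

/-- Forms over `ℂ` have no zero divisors, so equal squares come from roots that agree up to sign. -/
theorem IsSymmSpinor.eq_or_eq_neg {κ κ' : (Fin 2 → Fin 2) → ℂ} (h : IsSymmSpinor κ)
    (h' : IsSymmSpinor κ') (he : spinSymmSq κ = spinSymmSq κ') :
    ∃ u : ℤˣ, κ = ((u : ℤ) : ℂ) • κ' := by
  have h1 := congrArg polyOf he
  rw [polyOf_spinSymmSq, polyOf_spinSymmSq, mul_self_eq_mul_self_iff] at h1
  rcases h1 with h1 | h1
  · exact ⟨1, by rw [h.eq_of_polyOf_eq h' h1]; simp⟩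
  · refine ⟨-1, h.eq_of_polyOf_eq (fun π α => by simp only [Pi.smul_apply, h' π α]) ?_⟩
    have h2 : polyOf ((((-1 : ℤˣ) : ℤ) : ℂ) • κ') = C (((-1 : ℤˣ) : ℤ) : ℂ) * polyOf κ' :=
      polyOf_mul _ κ'
    rw [h1, h2]
    simp

theorem spinSymmSq_smul (u : ℤˣ) (κ : (Fin 2 → Fin 2) → ℂ) :
    spinSymmSq (((u : ℤ) : ℂ) • κ) = spinSymmSq κ := by
  rcases Int.units_eq_one_or u with rfl | rfl <;> simp [spinSymmSq]

namespace SpinStructure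

variable {g : LorentzMetric M} {ι : Type*} {s : SpinStructure g ι}
  {L : ι → M → (Fin 4 → Fin 2) → ℂ}

/-- Two square roots differ by a sign. -/
theorem exists_sign {V W : Set M} {κ κ' : ι → M → (Fin 2 → Fin 2) → ℂ}
    (hκ : IsSpinorField s V 2 κ) (hκ' : IsSpinorField s W 2 κ') (h : IsSymmSquareOn s V L κ)
    (h' : IsSymmSquareOn s W L κ') {x : M} (hV : x ∈ V) (hW : x ∈ W) :
    ∃ u : ℤˣ, ∀ i, x ∈ s.dom i → κ i x = ((u : ℤ) : ℂ) • κ' i x := by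
  obtain ⟨i, hi⟩ := s.cover x
  obtain ⟨u, hu⟩ := IsSymmSpinor.eq_or_eq_neg (hκ.symmetric i x ⟨hi, hV⟩)
    (hκ'.symmetric i x ⟨hi, hW⟩) (by rw [← h i x ⟨hi, hV⟩, ← h' i x ⟨hi, hW⟩])
  exact ⟨u, fun j hj => by
    rw [hκ.eq_spinTransform hi hj hV, hκ'.eq_spinTransform hi hj hW, hu, spinTransform_smul]⟩

theorem ne_zero_of_isSymmSquareOn {W : Set M} {κ : ι → M → (Fin 2 → Fin 2) → ℂ}
    (h : IsSymmSquareOn s W L κ) {i : ι} {x : M} (hx : x ∈ s.dom i ∩ W) (h0 : L i x ≠ 0) :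
    κ i x ≠ 0 := fun h1 => h0 (by rw [h i x hx, h1, spinSymmSq_zero])

theorem sign_unique {φ : (Fin 2 → Fin 2) → ℂ} (hφ : φ ≠ 0) {u v : ℤˣ}
    (h : ((u : ℤ) : ℂ) • φ = ((v : ℤ) : ℂ) • φ) : u = v := by
  have h1 := smul_left_injective ℂ hφ h
  exact Units.ext (by exact_mod_cast h1)

/-- Local square roots of a spinor without zeros on a simply connected space can be glued. -/
theorem exists_global_root [SimplyConnectedSpace M] (h0 : ∀ i, ∀ x ∈ s.dom i, L i x ≠ 0)
    {W : M → Set M} (hW : ∀ p, IsOpen (W p)) (hmem : ∀ p, p ∈ W p)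
    {κ : M → ι → M → (Fin 2 → Fin 2) → ℂ} (hκ : ∀ p, IsSpinorField s (W p) 2 (κ p))
    (hsq : ∀ p, IsSymmSquareOn s (W p) L (κ p)) :
    ∃ ψ : ι → M → (Fin 2 → Fin 2) → ℂ,
      IsSpinorField s Set.univ 2 ψ ∧ IsSymmSquareOn s Set.univ L ψ := by
  classical
  have := ChartedSpace.locallyPathConnectedSpace (EuclideanSpace ℝ (Fin 4)) M
  have hne : ∀ p i x, x ∈ s.dom i → x ∈ W p → κ p i x ≠ 0 := fun p i x hi hx =>
    ne_zero_of_isSymmSquareOn (hsq p) ⟨hi, hx⟩ (h0 i x hi)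
  set σ : M → M → M → ℤˣ := fun p q x =>
    if h : x ∈ W p ∧ x ∈ W q then (exists_sign (hκ p) (hκ q) (hsq p) (hsq q) h.1 h.2).choose else 1
    with hσdef
  have hσ : ∀ p q x, x ∈ W p → x ∈ W q → ∀ i, x ∈ s.dom i →
      κ p i x = ((σ p q x : ℤ) : ℂ) • κ q i x := fun p q x hp hq => by
    simp only [hσdef, dif_pos (And.intro hp hq)]
    exact (exists_sign (hκ p) (hκ q) (hsq p) (hsq q) hp hq).choose_spec
  obtain ⟨t, ht⟩ := exists_global_sign (σ := σ) hW hmem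
    (fun p x hx => by
      obtain ⟨i, hi⟩ := s.cover x
      refine sign_unique (hne p i x hi hx) ?_
      rw [← hσ p p x hx hx i hi]
      simp)
    (fun p q r x hx => by
      obtain ⟨i, hi⟩ := s.cover x
      refine sign_unique (hne r i x hi hx.2) ?_
      rw [← hσ p r x hx.1.1 hx.2 i hi, Units.val_mul, Int.cast_mul, mul_smul,
        ← hσ q r x hx.1.2 hx.2 i hi, ← hσ p q x hx.1.1 hx.1.2 i hi])
    (fun p q x hx => by
      obtain ⟨i, hi⟩ := s.cover x
      have hc : ∀ r, x ∈ W r → ContinuousAt (κ r i) x := fun r hr => continuousAt_pi.2 fun α =>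
        (((hκ r).smooth i α).contMDiffAt
          (((s.isOpen_dom i).inter (hW r)).mem_nhds ⟨hi, hr⟩)).continuousAt
      -- If the sign differed at `y`, this sum would vanish there; at `x` it equals twice a nonzero
      -- spinor, so continuity excludes this near `x`.
      have hsum : ContinuousAt (fun y => κ p i y + ((σ p q x : ℤ) : ℂ) • κ q i y) x :=
        (hc p hx.1).add (ContinuousAt.const_smul (hc q hx.2) ((σ p q x : ℤ) : ℂ))
      have hx0 : κ p i x + ((σ p q x : ℤ) : ℂ) • κ q i x ≠ 0 := by
        rw [← hσ p q x hx.1 hx.2 i hi, ← two_smul ℂ]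
        exact smul_ne_zero two_ne_zero (hne p i x hi hx.1)
      filter_upwards [hsum.eventually_ne hx0, (hW p).mem_nhds hx.1, (hW q).mem_nhds hx.2,
        (s.isOpen_dom i).mem_nhds hi] with y hy hyp hyq hyi
      by_contra hne'
      refine hy ?_
      rw [hσ p q y hyp hyq i hyi, Int.units_ne_iff_eq_neg.1 hne']
      simp)
  -- The glued field takes its value at `y` from the root labelled by `y`, a different one at each
  -- point. Near `x` it nevertheless agrees with a constant sign times the root labelled by `x`,
  -- whence its smoothness.
  have hnear : ∀ x, ∀ᶠ y in nhds x, ∀ i, y ∈ s.dom i →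
      ((t y : ℤ) : ℂ) • κ y i y = (((t x * σ x x x : ℤˣ) : ℤ) : ℂ) • κ x i y := fun x => by
    filter_upwards [ht x x (hmem x), (hW x).mem_nhds (hmem x)] with y hy hyx i hi
    rw [← hy, Units.val_mul, Int.cast_mul, mul_smul, ← hσ y x y (hmem y) hyx i hi]
  refine ⟨fun i x => ((t x : ℤ) : ℂ) • κ x i x, ⟨fun i α x hx => ?_, fun i x hx π α => ?_,
    fun i j x hx β => ?_⟩, fun i x hx => ?_⟩
  · have h1 : ContMDiffAt (𝓡 4) 𝓘(ℝ, ℂ) ∞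
        (fun y => (((t x * σ x x x : ℤˣ) : ℤ) : ℂ) * κ x i y α) x :=
      contMDiffAt_const.mul (((hκ x).smooth i α).contMDiffAt
        (((s.isOpen_dom i).inter (hW x)).mem_nhds ⟨hx.1, hmem x⟩))
    refine (h1.congr_of_eventuallyEq ?_).contMDiffWithinAt
    filter_upwards [hnear x, (s.isOpen_dom i).mem_nhds hx.1] with y hy hyi
    exact congrFun (hy i hyi) α
  · simp only [Pi.smul_apply, (hκ x).symmetric i x ⟨hx.1, hmem x⟩ π α]
  · change (((t x : ℤ) : ℂ) • κ x j x) β =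
      spinTransform (s.trans i j x) (((t x : ℤ) : ℂ) • κ x i x) β
    rw [spinTransform_smul, (hκ x).eq_spinTransform hx.1.1 hx.1.2 (hmem x)]
  · rw [spinSymmSq_smul]
    exact hsq x i x ⟨hx.1, hmem x⟩

/-- The zero set of a Killing spinor of valence `(4,0)` on a connected space is empty or
everything. -/
theorem eq_zero_or_ne_zero [PreconnectedSpace M] (hA : AlignedMatter s) (hΨ : WeylNonvanishing s)
    (hL : IsKillingSpinor s Set.univ 4 L) :
    (∀ i, ∀ x ∈ s.dom i, L i x = 0) ∨ ∀ i, ∀ x ∈ s.dom i, L i x ≠ 0 := by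
  have hframe : ∀ {i j x}, x ∈ s.dom i → x ∈ s.dom j → L i x = 0 → L j x = 0 := fun hi hj h =>
    hL.eq_zero_of_eq_zero hi hj trivial h
  -- Closed by continuity, open by the linear equation for the ratio to the Weyl spinor.
  have hclopen : IsClopen {x | ∀ i, x ∈ s.dom i → L i x = 0} := by
    constructor
    · rw [← isOpen_compl_iff, isOpen_iff_mem_nhds]
      intro x hx
      simp only [Set.mem_compl_iff, Set.mem_ofPred_eq, not_forall] at hx
      obtain ⟨i, hi, h0⟩ := hx
      filter_upwards [eventually_ne_zero hL.toIsSpinorField isOpen_univ ⟨hi, trivial⟩ h0,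
        (s.isOpen_dom i).mem_nhds hi] with y hy hyi hyz
      exact hy (hyz i hyi)
    · rw [isOpen_iff_mem_nhds]
      intro x hx
      obtain ⟨i, hi⟩ := s.cover x
      filter_upwards [eventually_eq_zero hA hΨ hL hi (hx i hi), (s.isOpen_dom i).mem_nhds hi]
        with y hy hyi j hj
      exact hframe hyi hj hy
  rcases isClopen_iff.1 hclopen with h | h
  · refine Or.inr fun i x hi h0 => ?_
    have : x ∈ {x | ∀ i, x ∈ s.dom i → L i x = 0} := fun j hj => hframe hi hj h0
    rw [h] at this
    exact this
  · refine Or.inl fun i x hi => ?_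
    have : x ∈ {x | ∀ i, x ∈ s.dom i → L i x = 0} := h ▸ Set.mem_univ x
    exact this i hi

end SpinStructure

end

theorem theorem1p5 {M : Type*} [TopologicalSpace M] [T2Space M] [SecondCountableTopology M]
    [ChartedSpace (EuclideanSpace ℝ (Fin 4)) M] [IsManifold (𝓡 4) ∞ M]
    (g : LorentzMetric M) {ι : Type*} (s : SpinStructure g ι)
    (hAligned : AlignedMatter s) (hWeyl : WeylNonvanishing s)
    (L : ι → M → (Fin 4 → Fin 2) → ℂ) (hL : IsKillingSpinor s Set.univ 4 L) :
    (∀ p : M, ∃ W : Set M, IsOpen W ∧ p ∈ W ∧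
      ∃ κ : ι → M → (Fin 2 → Fin 2) → ℂ,
        IsKillingSpinor s W 2 κ ∧ IsSymmSquareOn s W L κ) ∧
    (SimplyConnectedSpace M →
      ∃ κ : ι → M → (Fin 2 → Fin 2) → ℂ,
        IsKillingSpinor s Set.univ 2 κ ∧ IsSymmSquareOn s Set.univ L κ) := by
  have hloc := SpinStructure.exists_local_root hAligned hWeyl hL
  refine ⟨hloc, fun hsc => ?_⟩
  -- The comparison signs of local roots are well defined only where `L` has no zeros, so the
  -- identically zero case is split off before gluing.
  rcases SpinStructure.eq_zero_or_ne_zero hAligned hWeyl hL with h0 | h0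
  · refine ⟨fun _ _ => 0, isKillingSpinor_zero s Set.univ 2, fun i x hx => ?_⟩
    rw [spinSymmSq_zero]
    exact h0 i x hx.1
  · choose W hW hmem κ hκ hsq using hloc
    obtain ⟨ψ, hψ, hψL⟩ :=
      SpinStructure.exists_global_root h0 hW hmem (fun p => (hκ p).toIsSpinorField) hsq
    exact ⟨ψ, SpinStructure.isKillingSpinor_of_isSymmSquareOn hAligned hWeyl hL isOpen_univ
      (fun i x hx => h0 i x hx.1) hψ hψL, hψL⟩
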